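/- Let $\alpha_1\ge\alpha_2>0$ and $m\ge 0$. Put $b(x_1,x_2)=(1+x_1^2)^{1/2}(1+x_2^2)^{1/2}$. For $1\le p<\infty$ let $L^p(m)$ be the Banach space of (classes of) measurable $f:\mathbb R^2\to\mathbb R$ with $\|f\|_{L^p(m)}=\|b^m f\|_{L^p(\mathbb R^2)}<\infty$, and let $X^p(m)=C^0_b(\mathbb R,L^p(m))$ be the space of bounded continuous maps $\omega:\mathbb R\to L^p(m)$ with norm $\|\omega\|_{X^p(m)}=\sup_{x_3\in\mathbb R}\|\omega(x_3)\|_{L^p(m)}$. Let $X^p_{\rm loc}(m)$ be $X^p(m)$ with the topology defined by the seminorms $\sup_{|x_3|\le n}\|\omega(x_3)\|_{L^p(m)}$, $n=1,2,\dots$. For $m>1/2$ let $X^2_0(m)$ be the set of $\omega\in X^2(m)$ with $\int_{\mathbb R^2}\omega(x_3)\,dx_1dx_2=0$ for all $x_3$. For $t>0$ let $a_i(t)=(1-e^{-\alpha_i t})/\alpha_i$ $(i=1,2)$, $$K_t(x,z)=\prod_{i=1}^2\frac{1}{\sqrt{4\pi a_i(t)}}\exp\Bigl(-\frac{(x_i-z_ie^{-\alpha_it/2})^2}{4a_i(t)}\Bigr),\qquad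 x,z\in\mathbb R^2,$$ $$G_t(s)=\frac{1}{\sqrt{2\pi(1-e^{-2t})}}\exp\Bigl(-\frac{s^2}{2(1-e^{-2t})}\Bigr),\qquad s\in\mathbb R,$$ $(E_tf)(x)=\int_{\mathbb R^2}K_t(x,z)f(z)\,dz$, and $(E_t\partial_kf)(x)=-\int_{\mathbb R^2}\partial_{z_k}K_t(x,z)f(z)\,dz$ for $k=1,2$. Define $S_0=\mathbf 1$ and, for $t>0$, $$(S_t\omega)(x_3)=\int_{\mathbb R}G_t(x_3e^{-t}-y_3)\,E_t\omega(y_3)\,dy_3,$$ $$(S_t\partial_k\omega)(x_3)=\int_{\mathbb R}G_t(x_3e^{-t}-y_3)\,E_t\partial_k\omega(y_3)\,dy_3\quad(k=1,2),$$ $$(S_t\partial_3\omega)(x_3)=-\int_{\mathbb R}\partial_{y_3}\bigl[G_t(x_3e^{-t}-y_3)\bigr]\,E_t\omega(y_3)\,dy_3,$$ as integrals with values in $L^2(m)$. Then $\{S_t\}_{t\ge0}$ is well defined and is a semigroup of bounded linear operators on $X^2(m)$. For every $\omega_0\in X^2(m)$ the map $t\mapsto\omega(t)=S_t\omega_0$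 is continuous from $[0,\infty)$ to $X^2_{\rm loc}(m)$, and $\omega(t)$ solves, for $t>0$, the equation $$\partial_t\omega=\Delta\omega+\tfrac{\alpha_1}{2}x_1\partial_1\omega+\tfrac{\alpha_2}{2}x_2\partial_2\omega-x_3\partial_3\omega+\tfrac{\alpha_1+\alpha_2}{2}\omega,$$ in the sense that there is a $C^\infty$ function $u(t,x_1,x_2,x_3)$ on $\{t>0\}$ which satisfies this equation pointwise and such that, for all $t>0$ and $x_3\in\mathbb R$, $u(t,\cdot,\cdot,x_3)=(S_t\omega_0)(x_3)$ almost everywhere. For every $R>0$, if the ball $B_R=\{\omega\in X^2(m):\|\omega\|_{X^2(m)}\le R\}$ carries the topology of $X^2_{\rm loc}(m)$, then $S_t:B_R\to X^2_{\rm loc}(m)$ is continuous, uniformly for $t$ in compact intervals: for every $T\ge0$ and every neighbourhood $V$ of $0$ in $X^2_{\rm loc}(m)$ there is a neighbourhood $U$ of $0$ in $X^2_{\rm loc}(m)$ such that $S_t\omega-S_t\eta\in V$ whenever $0\le t\le T$, $\omega,\eta\in B_R$ and $\omega-\eta\in U$. Moreover: (i) If $m>1/2$, then $\sup_{t\ge0}\|S_t\|_{X^2(m)\to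 X^2(m)}<\infty$. (ii) If $m>3/2$, there is $C=C(m,\alpha_1,\alpha_2)>0$ such that $\|S_t\omega\|_{X^2(m)}\le Ce^{-\alpha_2t/2}\|\omega\|_{X^2(m)}$ for all $\omega\in X^2_0(m)$ and $t\ge0$. (iii) If $m>3/2$ and $p\in[1,2]$, then for $t>0$ and $k=1,2,3$ the formula for $S_t\partial_k$ defines a bounded linear operator from $X^p(m)$ to $X^2(m)$, and there is $C=C(m,\alpha_1,\alpha_2,p)>0$ such that, for all $t>0$ and $\omega\in X^p(m)$, $$\|S_t\partial_1\omega\|_{X^2(m)}\le C\,\frac{e^{-\alpha_1t/2}}{a_1(t)^{\frac1{2p}+\frac14}a_2(t)^{\frac1{2p}-\frac14}}\|\omega\|_{X^p(m)},$$ $$\|S_t\partial_2\omega\|_{X^2(m)}\le C\,\frac{e^{-\alpha_2t/2}}{a_1(t)^{\frac1{2p}-\frac14}a_2(t)^{\frac1{2p}+\frac14}}\|\omega\|_{X^p(m)},$$ $$\|S_t\partial_3\omega\|_{X^2(m)}\le \frac{C}{\sqrt{1-e^{-2t}}}\,\frac{1}{a_1(t)^{\frac1{2p}-\frac14}a_2(t)^{\frac1{2p}-\frac14}}\|\omega\|_{X^p(m)}.$$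 -/

import Mathlib

open MeasureTheory Topology
open scoped ENNReal NNReal BoundedContinuousFunction

noncomputable section

namespace BurgersSemigroup

/-! ### Function spaces -/

/-- The weight `b(x₁,x₂) = (1+x₁²)^{1/2} (1+x₂²)^{1/2}` on the plane. -/
def weight (x : ℝ × ℝ) : ℝ := √(1 + x.1 ^ 2) * √(1 + x.2 ^ 2)

/-- The measure `b(x)^{mp} dx` on the plane, for `1 ≤ p < ∞`. -/
def weightedMeasure (p : ℝ≥0∞) (m : ℝ) : Measure (ℝ × ℝ) :=
  volume.withDensity fun x => ENNReal.ofReal (weight x ^ (m * p.toReal))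

/-- The Banach space `L^p(m)` (`1 ≤ p < ∞`, `m ≥ 0`) of real functions on the plane with norm
`‖f‖ = ‖b^m f‖_{L^p} = (∫ |f|^p b^{mp} dx)^{1/p}`. -/
abbrev WLp (p : ℝ≥0∞) (m : ℝ) : Type := Lp ℝ p (weightedMeasure p m)

/-- The Banach space `X^p(m) = C⁰_b(ℝ, L^p(m))` with the supremum norm. -/
abbrev XSpace (p : ℝ≥0∞) [Fact (1 ≤ p)] (m : ℝ) : Type := ℝ →ᵇ WLp p m

/-- The seminorm `|ω|_{X^p_n(m)} = sup_{|x₃| ≤ n} ‖ω(x₃)‖_{L^p(m)}`, `n = 1, 2, …`. -/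
def locSeminorm (p : ℝ≥0∞) [Fact (1 ≤ p)] (m : ℝ) : SeminormFamily ℝ (XSpace p m) ℕ+ := fun n =>
  have bdd : ∀ ω : XSpace p m,
      BddAbove (Set.range fun x : Set.Icc (-(n : ℝ)) n => ‖ω x‖) := fun ω =>
    ⟨‖ω‖, by rintro _ ⟨x, rfl⟩; exact ω.norm_coe_le_norm x⟩
  have ne : Nonempty (Set.Icc (-(n : ℝ)) n) :=
    ⟨⟨0, by simp⟩⟩
  Seminorm.of (fun ω => ⨆ x : Set.Icc (-(n : ℝ)) n, ‖ω x‖)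
    (fun ω η => ciSup_le fun x => (norm_add_le _ _).trans
      (add_le_add (le_ciSup (bdd ω) x) (le_ciSup (bdd η) x)))
    (fun c ω => by
      simp only [BoundedContinuousFunction.coe_smul, norm_smul]
      rw [Real.mul_iSup_of_nonneg (norm_nonneg c)])

/-- The topology of `X^p_loc(m)`: the locally convex topology on `X^p(m)` defined by the
seminorms `|·|_{X^p_n(m)}`, `n = 1, 2, …`. -/
@[reducible]
def locTopology (p : ℝ≥0∞) [Fact (1 ≤ p)] (m : ℝ) : TopologicalSpace (XSpace p m) :=
  (locSeminorm p m).moduleFilterBasis.topology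

/-- Membership in the subspace `X²_0(m)` (for `m > 1/2`): zero mean on every horizontal plane. -/
def ZeroMean {m : ℝ} (ω : XSpace 2 m) : Prop := ∀ x₃ : ℝ, ∫ x : ℝ × ℝ, ω x₃ x = 0

/-! ### Integral operators -/

/-- The integral operator `f ↦ ∫ K(·,z) f(z) dz` from `L^p(m)` to `L²(m)` (with the value `0` if
the result is not in `L²(m)`, which `KernelDefined` excludes). -/
def kernelOp {p : ℝ≥0∞} {m : ℝ} (K : ℝ × ℝ → ℝ × ℝ → ℝ) (f : WLp p m) : WLp 2 m :=
  open Classical in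
  if h : MemLp (fun x => ∫ z : ℝ × ℝ, K x z * f z) 2 (weightedMeasure 2 m) then h.toLp _ else 0

/-- The integral operator with kernel `K` is well defined from `L^p(m)` to `L²(m)`. -/
def KernelDefined (p : ℝ≥0∞) (m : ℝ) (K : ℝ × ℝ → ℝ × ℝ → ℝ) : Prop :=
  ∀ f : WLp p m, (∀ x, Integrable fun z : ℝ × ℝ => K x z * f z) ∧
    MemLp (fun x => ∫ z : ℝ × ℝ, K x z * f z) 2 (weightedMeasure 2 m)

/-- The tensor product of the integral operator in `x₃` with kernel `g` and of the integral
operator in the plane with kernel `K`, acting on `ω ∈ X^p(m)`: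
`x₃ ↦ ∫ g(x₃,y₃) (K ω(y₃)) dy₃`, an integral with values in `L²(m)`. -/
def tensorOp {p : ℝ≥0∞} [Fact (1 ≤ p)] {m : ℝ} (g : ℝ → ℝ → ℝ) (K : ℝ × ℝ → ℝ × ℝ → ℝ)
    (ω : XSpace p m) (x₃ : ℝ) : WLp 2 m :=
  ∫ y₃ : ℝ, g x₃ y₃ • (kernelOp K (ω y₃) : WLp 2 m)

/-- All the integrals in `tensorOp g K ω` converge, for every `ω ∈ X^p(m)`. -/
def TensorDefined (p : ℝ≥0∞) [Fact (1 ≤ p)] (m : ℝ) (g : ℝ → ℝ → ℝ)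
    (K : ℝ × ℝ → ℝ × ℝ → ℝ) : Prop :=
  KernelDefined p m K ∧
    ∀ (ω : XSpace p m) (x₃ : ℝ), Integrable fun y₃ : ℝ => g x₃ y₃ • (kernelOp K (ω y₃) : WLp 2 m)

/-! ### The explicit kernels, for `t > 0` -/

/-- `a(t) = (1 - e^{-αt})/α`. -/
def aCoeff (α t : ℝ) : ℝ := (1 - Real.exp (-α * t)) / α

/-- The integral kernel of `e^{t𝓛_α}`, `𝓛_α = ∂_x² + (α/2) x ∂_x + α/2`, with respect to `dz`:
`(4πa(t))^{-1/2} exp(-(x - z e^{-αt/2})²/(4a(t)))`. -/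
def lineKernel (α t x z : ℝ) : ℝ :=
  1 / √(4 * Real.pi * aCoeff α t) *
    Real.exp (-(x - z * Real.exp (-α * t / 2)) ^ 2 / (4 * aCoeff α t))

/-- The usual form of the one-dimensional semigroup `e^{t𝓛_α}`, obtained from the kernel by the
substitution `z = y e^{αt/2}`. -/
theorem integral_lineKernel (α t x : ℝ) (f : ℝ → ℝ) :
    ∫ z, lineKernel α t x z * f z =
      Real.exp (α * t / 2) / √(4 * Real.pi * aCoeff α t) *
        ∫ y, Real.exp (-(x - y) ^ 2 / (4 * aCoeff α t)) * f (y * Real.exp (α * t / 2)) := by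
  have key := Measure.integral_comp_mul_right (fun z => lineKernel α t x z * f z)
    (Real.exp (α * t / 2))
  have e1 : Real.exp (α * t / 2) * Real.exp (-α * t / 2) = 1 := by
    rw [← Real.exp_add]; ring_nf; exact Real.exp_zero
  rw [abs_of_pos (inv_pos.2 (Real.exp_pos _)), smul_eq_mul] at key
  have h : ∫ z, lineKernel α t x z * f z = Real.exp (α * t / 2) *
      ∫ y, lineKernel α t x (y * Real.exp (α * t / 2)) * f (y * Real.exp (α * t / 2)) := by
    rw [key, ← mul_assoc, mul_inv_cancel₀ (Real.exp_pos _).ne', one_mul]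
  rw [h, ← integral_const_mul, ← integral_const_mul]
  congr 1
  funext y
  unfold lineKernel
  rw [mul_assoc y, e1, mul_one]
  ring

/-- The integral kernel of `e^{t𝓛_{α₁,α₂}} = e^{t𝓛_{α₁}} ⊗ e^{t𝓛_{α₂}}`. -/
def planeKernel (α₁ α₂ t : ℝ) (x z : ℝ × ℝ) : ℝ :=
  lineKernel α₁ t x.1 z.1 * lineKernel α₂ t x.2 z.2

/-- The integral kernel of `e^{t𝓛_{α₁,α₂}} ∂₁`: the derivative falls on the kernel, with a minus
sign (pairing of the distribution `∂₁ f` with the Gaussian kernel). -/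
def planeKernelD₁ (α₁ α₂ t : ℝ) (x z : ℝ × ℝ) : ℝ :=
  -deriv (fun s => planeKernel α₁ α₂ t x (s, z.2)) z.1

/-- The integral kernel of `e^{t𝓛_{α₁,α₂}} ∂₂`. -/
def planeKernelD₂ (α₁ α₂ t : ℝ) (x z : ℝ × ℝ) : ℝ :=
  -deriv (fun s => planeKernel α₁ α₂ t x (z.1, s)) z.2

/-- The Gaussian `G_t(x₃) = (2π(1-e^{-2t}))^{-1/2} exp(-x₃²/(2(1-e^{-2t})))`. -/
def gauss (t x₃ : ℝ) : ℝ :=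
  √(1 / (2 * Real.pi * (1 - Real.exp (-2 * t)))) *
    Real.exp (-x₃ ^ 2 / (2 * (1 - Real.exp (-2 * t))))

/-- The integral kernel `G_t(x₃ e^{-t} - y₃)` of `e^{t𝓛̂₃}`, `𝓛̂₃ = ∂₃² - x₃ ∂₃`. -/
def axialKernel (t x₃ y₃ : ℝ) : ℝ := gauss t (x₃ * Real.exp (-t) - y₃)

/-- The integral kernel of `e^{t𝓛̂₃} ∂₃`. -/
def axialKernelD (t x₃ y₃ : ℝ) : ℝ := -deriv (fun s => axialKernel t x₃ s) y₃

/-! ### The three-dimensional semigroup -/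

/-- `(S_t ω)(x₃) = ∫ G_t(x₃e^{-t} - y₃) (e^{t𝓛_{α₁,α₂}} ω(y₃)) dy₃` for `t > 0`, and
`S_0 ω = ω`. -/
def semigroupS (α₁ α₂ : ℝ) {m : ℝ} (t : ℝ) (ω : XSpace 2 m) (x₃ : ℝ) : WLp 2 m :=
  if t = 0 then ω x₃ else tensorOp (axialKernel t) (planeKernel α₁ α₂ t) ω x₃

/-- The plane factor of the kernel of `S_t ∂_k` (`k = 0, 1, 2` stands for `∂₁, ∂₂, ∂₃`). -/
def planeFactor (α₁ α₂ t : ℝ) : Fin 3 → ℝ × ℝ → ℝ × ℝ → ℝ :=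
  ![planeKernelD₁ α₁ α₂ t, planeKernelD₂ α₁ α₂ t, planeKernel α₁ α₂ t]

/-- The axial factor of the kernel of `S_t ∂_k` (`k = 0, 1, 2` stands for `∂₁, ∂₂, ∂₃`). -/
def axialFactor (t : ℝ) : Fin 3 → ℝ → ℝ → ℝ :=
  ![axialKernel t, axialKernel t, axialKernelD t]

/-- `u(t,x₁,x₂,x₃)` is smooth for `t > 0` and solves there
`∂_t u = Δu + (α₁/2) x₁ ∂₁u + (α₂/2) x₂ ∂₂u - x₃ ∂₃u + ((α₁+α₂)/2) u`. -/
def SolvesLinear (α₁ α₂ : ℝ) (u : ℝ → ℝ → ℝ → ℝ → ℝ) : Prop :=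
  ContDiffOn ℝ (⊤ : ℕ∞) (fun q : ℝ × ℝ × ℝ × ℝ => u q.1 q.2.1 q.2.2.1 q.2.2.2) {q | 0 < q.1} ∧
  ∀ t x₁ x₂ x₃ : ℝ, 0 < t →
    deriv (fun s => u s x₁ x₂ x₃) t =
      iteratedDeriv 2 (fun s => u t s x₂ x₃) x₁ + iteratedDeriv 2 (fun s => u t x₁ s x₃) x₂
        + iteratedDeriv 2 (fun s => u t x₁ x₂ s) x₃
        + α₁ / 2 * x₁ * deriv (fun s => u t s x₂ x₃) x₁
        + α₂ / 2 * x₂ * deriv (fun s => u t x₁ s x₃) x₂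
        - x₃ * deriv (fun s => u t x₁ x₂ s) x₃
        + (α₁ + α₂) / 2 * u t x₁ x₂ x₃

end BurgersSemigroup

end

open BurgersSemigroup

open MeasureTheory Topology
open scoped ENNReal NNReal BoundedContinuousFunction

noncomputable section

namespace BurgersSemigroup

/-! The generator is a sum of three commuting one-dimensional operators. Hence `S_t` is the product
of a planar operator `E_t`, applied to the values of `ω`, and an Ornstein–Uhlenbeck average in `x₃`.
One dilated Gaussian convolution identity, `integral_heatKernel_mul_heatKernel`, gives
Chapman–Kolmogorov for both factors, and they commute because bounded operators pass through Bochner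
integrals (`axialSemigroup_comp`). The axial average is taken against a probability density, so norm
bounds come from the plane; only `∂₃` costs an axial factor, of order `(1-e^{-2t})^{-1/2}`.

Planar bounds come from a weighted Schur test from `L^p` to `L²`, checked one coordinate at a time
(`LineBound`). With `β = e^{-αt/2}`, integrating the Gaussian in `z` produces `β⁻¹`, which grows in
time. It is compensated by the square of the weight ratio between `βz` and `z`, which is at most an
integrable function plus a multiple of `β^{2m}` when `m > 1/2`; this gives uniform boundedness
(`exists_lineBound_of_le_exp`). On functions of zero mean, `K_t(x,z)` may be replaced by `K_t(x,z) -
K_t(x,0)`. In each variable the part `|βz| ≤ 1` gains `β|z|` from the mean value inequality, and the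
part `|βz| > 1` gains a power of `β` from the weight. The loss of `|z|` is affordable since
`|z|(1+z²)^{-m/2}` is square integrable for `m > 3/2` (`exists_planeBound_sub`).

For continuity in time, a substitution turns the kernels into a fixed Gaussian with a moving
argument, which is regular down to `t = 0`; density of `C_c` and local uniform bounds do the rest.
Continuity on balls for the local topology holds because the tail of the axial Gaussian is small.

For the equation, the exponent of the full kernel is quadratic in the integration variables with
coefficients smooth in `(t,x)`. Integrals against it are smooth functions of these coefficients, and
the equation reduces to an algebraic identity between moments (`gaussSolution_pde`). The axial
factor is the line kernel with `α = -2`, up to `e^t`. Restarting at a positive time, where the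
solution is bounded and measurable, reduces general data to this case (`burgersSolution_add`). -/

/-! ### One-dimensional Gaussian kernels -/

/-- The heat kernel `(4πa)^{-1/2} exp(-u²/(4a))` on the line. -/
def heatKernel (a u : ℝ) : ℝ := 1 / √(4 * Real.pi * a) * Real.exp (-u ^ 2 / (4 * a))

theorem heatKernel_nonneg (a u : ℝ) : 0 ≤ heatKernel a u := by
  unfold heatKernel; positivity

theorem continuous_heatKernel (a : ℝ) : Continuous (heatKernel a) := by
  unfold heatKernel; fun_prop

theorem heatKernel_neg (a u : ℝ) : heatKernel a (-u) = heatKernel a u := by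
  simp [heatKernel]

theorem heatKernel_eq_exp (a u : ℝ) :
    heatKernel a u = 1 / √(4 * Real.pi * a) * Real.exp (-(1 / (4 * a)) * u ^ 2) := by
  unfold heatKernel; congr 2; ring

theorem integrable_heatKernel {a : ℝ} (ha : 0 < a) : Integrable (heatKernel a) := by
  have h := (integrable_exp_neg_mul_sq (b := 1 / (4 * a)) (by positivity)).const_mul
    (1 / √(4 * Real.pi * a))
  exact h.congr (ae_of_all _ fun u => (heatKernel_eq_exp a u).symm)

theorem integral_heatKernel {a : ℝ} (ha : 0 < a) : ∫ u, heatKernel a u = 1 := by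
  simp_rw [heatKernel_eq_exp]
  rw [integral_const_mul, integral_gaussian]
  have : Real.pi / (1 / (4 * a)) = 4 * Real.pi * a := by field_simp
  rw [this]
  have : √(4 * Real.pi * a) ≠ 0 := by positivity
  field_simp

theorem heatKernel_scale {a : ℝ} (ha : 0 < a) (u : ℝ) :
    √a * heatKernel a (√a * u) = heatKernel 1 u := by
  unfold heatKernel
  rw [mul_pow, Real.sq_sqrt ha.le]
  have h1 : √(4 * Real.pi * a) = √(4 * Real.pi * 1) * √a := by
    rw [mul_one, ← Real.sqrt_mul (by positivity)]
  have h2 : √a ≠ 0 := by positivity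
  have h3 : -(a * u ^ 2) / (4 * a) = -u ^ 2 / (4 * 1) := by field_simp
  rw [h1, h3]
  field_simp

/-- Substitution `y = c - √a ξ` in a convolution with the heat kernel. -/
theorem integral_heatKernel_sub_smul {F : Type*} [NormedAddCommGroup F] [NormedSpace ℝ F]
    {a : ℝ} (ha : 0 < a) (c : ℝ) (f : ℝ → F) :
    ∫ y, heatKernel a (c - y) • f y = ∫ ξ, heatKernel 1 ξ • f (c - √a * ξ) := by
  have hs : 0 < √a := Real.sqrt_pos.2 ha
  rw [← integral_sub_left_eq_self (fun y => heatKernel a (c - y) • f y) volume c]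
  simp only [sub_sub_cancel]
  have h := Measure.integral_comp_mul_left (fun y => heatKernel a y • f (c - y)) (√a)
  rw [abs_of_pos (inv_pos.2 hs)] at h
  have h2 : ∫ y, heatKernel a y • f (c - y) =
      √a • ∫ y, heatKernel a (√a * y) • f (c - √a * y) := by
    rw [h, smul_smul, mul_inv_cancel₀ hs.ne', one_smul]
  rw [h2, ← integral_smul]
  simp_rw [smul_smul, heatKernel_scale ha]

/-- Completing the square. -/
theorem heatKernel_mul_heatKernel {A B β x y w : ℝ} (hA : 0 < A) (hB : 0 < B) :
    heatKernel A (x - β * w) * heatKernel B (w - y) =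
      heatKernel (A + β ^ 2 * B) (x - β * y) *
        heatKernel (A * B / (A + β ^ 2 * B))
          (w - (A * y + β * B * x) / (A + β ^ 2 * B)) := by
  have hD : 0 < A + β ^ 2 * B := by positivity
  unfold heatKernel
  have e : ∀ p q r s : ℝ, 1 / √p * Real.exp r * (1 / √q * Real.exp s) =
      1 / (√p * √q) * Real.exp (r + s) := by
    intro p q r s; rw [Real.exp_add]; ring
  rw [e, e]
  refine congrArg₂ _ ?_ (congrArg _ ?_)
  · rw [← Real.sqrt_mul (by positivity), ← Real.sqrt_mul (by positivity)]
    congr 2; field_simp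
  · field_simp
    ring

/-- After completing the square the second factor is a unit-mass Gaussian in `w`, so only the first
one survives. Both the planar and the axial Chapman–Kolmogorov identities rest on this. -/
theorem integral_heatKernel_mul_heatKernel {A B : ℝ} (hA : 0 < A) (hB : 0 < B) (β x y : ℝ) :
    ∫ w, heatKernel A (x - β * w) * heatKernel B (w - y) =
      heatKernel (A + β ^ 2 * B) (x - β * y) := by
  have hD : 0 < A + β ^ 2 * B := by positivity
  simp_rw [heatKernel_mul_heatKernel hA hB]
  rw [integral_const_mul, integral_sub_right_eq_self (heatKernel _),
    integral_heatKernel (by positivity), mul_one]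

theorem integrable_heatKernel_mul_heatKernel {A B : ℝ} (hA : 0 < A) (hB : 0 < B) (β x y : ℝ) :
    Integrable fun w => heatKernel A (x - β * w) * heatKernel B (w - y) := by
  have hD : 0 < A + β ^ 2 * B := by positivity
  simp_rw [heatKernel_mul_heatKernel hA hB]
  exact ((integrable_heatKernel (by positivity)).comp_sub_right _).const_mul _

theorem hasDerivAt_heatKernel (a u : ℝ) :
    HasDerivAt (heatKernel a) (-(u / (2 * a)) * heatKernel a u) u := by
  unfold heatKernel
  have h : HasDerivAt (fun u : ℝ => -u ^ 2 / (4 * a)) (-(2 * u) / (4 * a)) u := by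
    have := ((hasDerivAt_pow 2 u).neg).div_const (4 * a)
    simpa using this
  refine (h.exp.const_mul (1 / √(4 * Real.pi * a))).congr_deriv ?_
  have : -(2 * u) / (4 * a) = -(u / (2 * a)) := by
    rw [neg_div, show (4 : ℝ) * a = 2 * (2 * a) by ring, mul_div_mul_left _ _ two_ne_zero]
  rw [this]; ring

/-- Minus the derivative of the heat kernel. -/
def heatKernelD (a u : ℝ) : ℝ := u / (2 * a) * heatKernel a u

theorem continuous_heatKernelD (a : ℝ) : Continuous (heatKernelD a) := by
  unfold heatKernelD
  exact (continuous_id.div_const _).mul (continuous_heatKernel a)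

/-! ### The coefficients -/

theorem aCoeff_pos {α t : ℝ} (hα : 0 < α) (ht : 0 < t) : 0 < aCoeff α t := by
  unfold aCoeff
  have : Real.exp (-α * t) < 1 := by
    rw [Real.exp_lt_one_iff]; nlinarith [mul_pos hα ht]
  exact div_pos (by linarith) hα

theorem aCoeff_le {α : ℝ} (hα : 0 < α) (t : ℝ) : aCoeff α t ≤ 1 / α := by
  unfold aCoeff
  gcongr
  linarith [Real.exp_pos (-α * t)]

theorem aCoeff_mono {α s t : ℝ} (hα : 0 < α) (h : s ≤ t) : aCoeff α s ≤ aCoeff α t := by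
  unfold aCoeff
  gcongr ?_ / α
  have : Real.exp (-α * t) ≤ Real.exp (-α * s) := Real.exp_le_exp.2 (by nlinarith)
  linarith

/-- Variances add after a dilation by `e^{-αs/2}`; this is what makes the kernels compose. The case
`α = 2` serves the axial variance. -/
theorem aCoeff_add {α : ℝ} (s t : ℝ) :
    aCoeff α s + Real.exp (-α * s / 2) ^ 2 * aCoeff α t = aCoeff α (s + t) := by
  unfold aCoeff
  rw [← Real.exp_nat_mul, show ((2 : ℕ) : ℝ) * (-α * s / 2) = -α * s by push_cast; ring,
    mul_add (-α) s t, Real.exp_add]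
  ring

/-- Half of the variance of the axial Gaussian. -/
def axialVar (t : ℝ) : ℝ := (1 - Real.exp (-2 * t)) / 2

theorem lineKernel_eq (α t x z : ℝ) :
    lineKernel α t x z = heatKernel (aCoeff α t) (x - Real.exp (-α * t / 2) * z) := by
  unfold lineKernel heatKernel; rw [mul_comm z]

theorem gauss_eq (t x : ℝ) : gauss t x = heatKernel (axialVar t) x := by
  unfold gauss heatKernel axialVar
  rw [Real.sqrt_div zero_le_one, Real.sqrt_one,
    show 4 * Real.pi * ((1 - Real.exp (-2 * t)) / 2) = 2 * Real.pi * (1 - Real.exp (-2 * t)) by ring,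
    show 4 * ((1 - Real.exp (-2 * t)) / 2) = 2 * (1 - Real.exp (-2 * t)) by ring]

theorem axialKernel_eq (t x y : ℝ) :
    axialKernel t x y = heatKernel (axialVar t) (x * Real.exp (-t) - y) := by
  unfold axialKernel; rw [gauss_eq]

theorem axialKernelD_eq (t x y : ℝ) :
    axialKernelD t x y = -heatKernelD (axialVar t) (x * Real.exp (-t) - y) := by
  unfold axialKernelD
  simp_rw [axialKernel_eq]
  have h := (hasDerivAt_heatKernel (axialVar t) (x * Real.exp (-t) - y)).comp y
    ((hasDerivAt_id y).const_sub (x * Real.exp (-t)))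
  have h' := h.deriv
  simp only [Function.comp_def] at h'
  rw [h', heatKernelD]; ring

/-- The kernel of `e^{t𝓛_α}∂`. -/
def lineKernelD (α t x z : ℝ) : ℝ :=
  -Real.exp (-α * t / 2) * heatKernelD (aCoeff α t) (x - Real.exp (-α * t / 2) * z)

theorem hasDerivAt_lineKernel (α t x z : ℝ) :
    HasDerivAt (fun s => lineKernel α t x s) (-lineKernelD α t x z) z := by
  simp_rw [lineKernel_eq]
  have h := (hasDerivAt_heatKernel (aCoeff α t) (x - Real.exp (-α * t / 2) * z)).comp z
    (((hasDerivAt_id z).const_mul (Real.exp (-α * t / 2))).const_sub x)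
  refine h.congr_deriv ?_
  simp only [lineKernelD, heatKernelD]; ring

theorem planeKernelD₁_eq (α₁ α₂ t : ℝ) (x z : ℝ × ℝ) :
    planeKernelD₁ α₁ α₂ t x z = lineKernelD α₁ t x.1 z.1 * lineKernel α₂ t x.2 z.2 := by
  unfold planeKernelD₁ planeKernel
  dsimp only
  rw [((hasDerivAt_lineKernel α₁ t x.1 z.1).mul_const _).deriv]; ring

theorem planeKernelD₂_eq (α₁ α₂ t : ℝ) (x z : ℝ × ℝ) :
    planeKernelD₂ α₁ α₂ t x z = lineKernel α₁ t x.1 z.1 * lineKernelD α₂ t x.2 z.2 := by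
  unfold planeKernelD₂ planeKernel
  dsimp only
  rw [((hasDerivAt_lineKernel α₂ t x.2 z.2).const_mul _).deriv]; ring

theorem continuous_lineKernel (α t : ℝ) : Continuous fun q : ℝ × ℝ => lineKernel α t q.1 q.2 := by
  simp_rw [lineKernel_eq]
  exact (continuous_heatKernel _).comp (by fun_prop)

theorem integral_lineKernel_mul_lineKernel {α s t : ℝ} (hα : 0 < α) (hs : 0 < s) (ht : 0 < t)
    (x z : ℝ) :
    ∫ w, lineKernel α s x w * lineKernel α t w z = lineKernel α (s + t) x z := by
  simp_rw [lineKernel_eq]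
  rw [integral_heatKernel_mul_heatKernel (aCoeff_pos hα hs) (aCoeff_pos hα ht), aCoeff_add,
    ← mul_assoc, ← Real.exp_add]
  congr 4; ring

theorem integrable_lineKernel_mul_lineKernel {α s t : ℝ} (hα : 0 < α) (hs : 0 < s) (ht : 0 < t)
    (x z : ℝ) :
    Integrable fun w => lineKernel α s x w * lineKernel α t w z := by
  simp_rw [lineKernel_eq]
  exact integrable_heatKernel_mul_heatKernel (aCoeff_pos hα hs) (aCoeff_pos hα ht) _ _ _

theorem lineKernel_nonneg (α t x z : ℝ) : 0 ≤ lineKernel α t x z := by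
  rw [lineKernel_eq]; exact heatKernel_nonneg _ _

/-! ### Schur's test from `L^p` to `L²` -/

/-- Hölder with three factors: `H G^(1/r-1/2) F = (H^r F^p)^(1/2) (H^r G)^(1/r-1/2)
(F^p)^(1/p-1/2)`, whose exponents add up to `1` because `1/r + 1/p = 3/2`. -/
theorem lintegral_mul_rpow_mul_le {Z : Type*} [MeasurableSpace Z] (ν : Measure Z) {p r : ℝ}
    (hp : 1 ≤ p) (hp2 : p ≤ 2) (hr : 0 < r) (hpr : 1 / r + 1 / p = 3 / 2)
    {H G F : Z → ℝ≥0∞} (hH : Measurable H) (hG : Measurable G) (hF : Measurable F) :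
    ∫⁻ z, H z * G z ^ (1 / r - 1 / 2) * F z ∂ν ≤
      (∫⁻ z, H z ^ r * F z ^ p ∂ν) ^ (1 / 2 : ℝ) * (∫⁻ z, H z ^ r * G z ∂ν) ^ (1 / r - 1 / 2) *
        (∫⁻ z, F z ^ p ∂ν) ^ (1 / p - 1 / 2) := by
  have hp0 : 0 < p := by linarith
  have hp1 : 1 / p ≤ 1 := by rw [div_le_one hp0]; exact hp
  have hp3 : 1 / 2 ≤ 1 / p := one_div_le_one_div_of_le hp0 hp2
  have hθ : 0 ≤ 1 / r - 1 / 2 := by linarith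
  have hκ : 0 ≤ 1 / p - 1 / 2 := by linarith
  have key := ENNReal.lintegral_prod_norm_pow_le (μ := ν) Finset.univ
    (f := ![fun z => H z ^ r * F z ^ p, fun z => H z ^ r * G z, fun z => F z ^ p])
    (p := ![1 / 2, 1 / r - 1 / 2, 1 / p - 1 / 2])
    (by
      intro i _
      fin_cases i
      · exact ((hH.pow_const r).mul (hF.pow_const p)).aemeasurable
      · exact ((hH.pow_const r).mul hG).aemeasurable
      · exact (hF.pow_const p).aemeasurable)
    (by
      simp only [Fin.sum_univ_three, Matrix.cons_val_zero, Matrix.cons_val_one, Matrix.cons_val]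
      linarith)
    (by
      intro i _
      fin_cases i
      · simp
      · simpa using hθ
      · simpa using hκ)
  simp only [Fin.prod_univ_three, Matrix.cons_val_zero, Matrix.cons_val_one, Matrix.cons_val] at key
  refine le_trans (le_of_eq (lintegral_congr fun z => ?_)) key
  rw [ENNReal.mul_rpow_of_nonneg _ _ (by norm_num), ENNReal.mul_rpow_of_nonneg _ _ hθ,
    ← ENNReal.rpow_mul, ← ENNReal.rpow_mul, ← ENNReal.rpow_mul, ← ENNReal.rpow_mul]
  have e1 : H z = H z ^ (r * (1 / 2)) * H z ^ (r * (1 / r - 1 / 2)) := by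
    rw [← ENNReal.rpow_add_of_nonneg _ _ (by positivity) (mul_nonneg hr.le hθ)]
    rw [show r * (1 / 2) + r * (1 / r - 1 / 2) = 1 by field_simp; ring, ENNReal.rpow_one]
  have e2 : F z = F z ^ (p * (1 / 2)) * F z ^ (p * (1 / p - 1 / 2)) := by
    rw [← ENNReal.rpow_add_of_nonneg _ _ (by positivity) (mul_nonneg hp0.le hκ)]
    rw [show p * (1 / 2) + p * (1 / p - 1 / 2) = 1 by field_simp; ring, ENNReal.rpow_one]
  conv_lhs => rw [e1, e2]
  ring

/-- Schur's test from `L^p` to `L²`, `1 ≤ p ≤ 2`. -/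
theorem lintegral_schur {X Z : Type*} [MeasurableSpace X] [MeasurableSpace Z] (μ : Measure X)
    (ν : Measure Z) [SFinite μ] [SFinite ν] {p r : ℝ}
    (hp : 1 ≤ p) (hp2 : p ≤ 2) (hr : 0 < r) (hpr : 1 / r + 1 / p = 3 / 2)
    {H G : X → Z → ℝ≥0∞} {F : Z → ℝ≥0∞} (hH : Measurable (Function.uncurry H))
    (hG : Measurable (Function.uncurry G)) (hF : Measurable F) (N : ℝ≥0∞)
    (h1 : ∀ x, ∫⁻ z, H x z ^ r * G x z ∂ν ≤ N ^ r) (h2 : ∀ z, ∫⁻ x, H x z ^ r ∂μ ≤ N ^ r) :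
    ∫⁻ x, (∫⁻ z, H x z * G x z ^ (1 / r - 1 / 2) * F z ∂ν) ^ (2 : ℝ) ∂μ ≤
      N ^ (2 : ℝ) * (∫⁻ z, F z ^ p ∂ν) ^ (2 / p) := by
  have hp0 : 0 < p := by linarith
  have hp1 : 1 / p ≤ 1 := by rw [div_le_one hp0]; exact hp
  have hp3 : 1 / 2 ≤ 1 / p := one_div_le_one_div_of_le hp0 hp2
  have hθ : 0 ≤ 1 / r - 1 / 2 := by linarith
  have hκ : 0 ≤ 1 / p - 1 / 2 := by linarith
  set Q := ∫⁻ z, F z ^ p ∂ν with hQ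
  -- Squaring makes the first Hölder factor linear in `H^r F^p`, ready for Tonelli and the column
  -- bound `h2`; the row bound `h1` disposes of the second factor.
  have pt : ∀ x, (∫⁻ z, H x z * G x z ^ (1 / r - 1 / 2) * F z ∂ν) ^ (2 : ℝ) ≤
      (∫⁻ z, H x z ^ r * F z ^ p ∂ν) * (N ^ (2 - r) * Q ^ (2 / p - 1)) := by
    intro x
    have h := lintegral_mul_rpow_mul_le ν hp hp2 hr hpr (H := H x) (G := G x) (F := F)
      (hH.comp measurable_prodMk_left) (hG.comp measurable_prodMk_left) hF
    have h' := h.trans (mul_le_mul_left (mul_le_mul_right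
      (ENNReal.rpow_le_rpow (h1 x) hθ) _) _)
    refine (ENNReal.rpow_le_rpow h' zero_le_two).trans (le_of_eq ?_)
    rw [ENNReal.mul_rpow_of_nonneg _ _ zero_le_two, ENNReal.mul_rpow_of_nonneg _ _ zero_le_two,
      ← ENNReal.rpow_mul, ← ENNReal.rpow_mul, ← ENNReal.rpow_mul, ← ENNReal.rpow_mul, mul_assoc]
    rw [show (1 / 2 : ℝ) * 2 = 1 by norm_num, ENNReal.rpow_one,
      show r * ((1 / r - 1 / 2) * 2) = 2 - r by field_simp,
      show (1 / p - 1 / 2) * 2 = 2 / p - 1 by ring]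
  have hr2 : r ≤ 2 := by
    have : 1 / 2 ≤ 1 / r := by linarith
    exact (one_div_le_one_div two_pos hr).1 this
  have hHF : Measurable fun q : X × Z => H q.1 q.2 ^ r * F q.2 ^ p :=
    (hH.pow_const r).mul ((hF.comp measurable_snd).pow_const p)
  calc _ ≤ ∫⁻ x, (∫⁻ z, H x z ^ r * F z ^ p ∂ν) * (N ^ (2 - r) * Q ^ (2 / p - 1)) ∂μ :=
        lintegral_mono pt
    _ = (∫⁻ x, ∫⁻ z, H x z ^ r * F z ^ p ∂ν ∂μ) * (N ^ (2 - r) * Q ^ (2 / p - 1)) :=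
        lintegral_mul_const _ hHF.lintegral_prod_right'
    _ = (∫⁻ z, (∫⁻ x, H x z ^ r ∂μ) * F z ^ p ∂ν) * (N ^ (2 - r) * Q ^ (2 / p - 1)) := by
        rw [lintegral_lintegral_swap hHF.aemeasurable]
        congr 1
        refine lintegral_congr fun z => ?_
        exact lintegral_mul_const _ ((hH.comp measurable_prodMk_right).pow_const r)
    _ ≤ (N ^ r * Q) * (N ^ (2 - r) * Q ^ (2 / p - 1)) := by
        gcongr
        rw [hQ, ← lintegral_const_mul _ (hF.pow_const p)]
        exact lintegral_mono fun z => mul_le_mul_left (h2 z) _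
    _ = N ^ (2 : ℝ) * Q ^ (2 / p) := by
        have e1 : N ^ (2 : ℝ) = N ^ r * N ^ (2 - r) := by
          rw [← ENNReal.rpow_add_of_nonneg _ _ hr.le (by linarith)]; congr 1; ring
        have e2 : Q ^ (2 / p) = Q * Q ^ (2 / p - 1) := by
          have h3 : (2 : ℝ) / p = 2 * (1 / p) := by ring
          nth_rewrite 2 [← ENNReal.rpow_one Q]
          rw [← ENNReal.rpow_add_of_nonneg _ _ zero_le_one (by linarith)]; congr 1; ring
        rw [e1, e2]; ring

/-! ### Weights -/

/-- The one-dimensional weight `(1+u²)^{m/2}`. -/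
def lineWeight (m u : ℝ) : ℝ := √(1 + u ^ 2) ^ m

theorem one_le_sqrt_one_add_sq (u : ℝ) : 1 ≤ √(1 + u ^ 2) := by
  rw [Real.one_le_sqrt]; nlinarith [sq_nonneg u]

theorem one_le_lineWeight {m : ℝ} (hm : 0 ≤ m) (u : ℝ) : 1 ≤ lineWeight m u :=
  Real.one_le_rpow (one_le_sqrt_one_add_sq u) hm

theorem lineWeight_pos (m u : ℝ) : 0 < lineWeight m u :=
  Real.rpow_pos_of_pos (zero_lt_one.trans_le (one_le_sqrt_one_add_sq u)) m

theorem continuous_lineWeight (m : ℝ) : Continuous (lineWeight m) := by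
  unfold lineWeight
  refine Continuous.rpow_const (by fun_prop) fun u => Or.inl ?_
  exact (zero_lt_one.trans_le (one_le_sqrt_one_add_sq u)).ne'

theorem lineWeight_mono {m u v : ℝ} (hm : 0 ≤ m) (h : |u| ≤ |v|) :
    lineWeight m u ≤ lineWeight m v := by
  unfold lineWeight
  have := sq_le_sq.2 h
  exact Real.rpow_le_rpow (Real.sqrt_nonneg _) (Real.sqrt_le_sqrt (by linarith)) hm

theorem weight_pos (x : ℝ × ℝ) : 0 < weight x :=
  mul_pos (zero_lt_one.trans_le (one_le_sqrt_one_add_sq _))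
    (zero_lt_one.trans_le (one_le_sqrt_one_add_sq _))

theorem weight_rpow (m : ℝ) (x : ℝ × ℝ) :
    weight x ^ m = lineWeight m x.1 * lineWeight m x.2 :=
  Real.mul_rpow (Real.sqrt_nonneg _) (Real.sqrt_nonneg _)

theorem continuous_weight_rpow (m : ℝ) : Continuous fun x => weight x ^ m := by
  simp_rw [weight_rpow]
  exact ((continuous_lineWeight m).comp continuous_fst).mul
    ((continuous_lineWeight m).comp continuous_snd)

theorem one_le_weight_rpow {m : ℝ} (hm : 0 ≤ m) (x : ℝ × ℝ) : 1 ≤ weight x ^ m := by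
  rw [weight_rpow]
  exact one_le_mul_of_one_le_of_one_le (one_le_lineWeight hm _) (one_le_lineWeight hm _)

theorem measurable_ofReal_weight_rpow (m : ℝ) :
    Measurable fun x : ℝ × ℝ => ENNReal.ofReal (weight x ^ m) :=
  (continuous_weight_rpow m).measurable.ennreal_ofReal

theorem eLpNorm_weightedMeasure {p : ℝ≥0∞} (hp0 : p ≠ 0) (hp : p ≠ ⊤) (m : ℝ) (f : ℝ × ℝ → ℝ) :
    eLpNorm f p (weightedMeasure p m) =
      (∫⁻ x, (ENNReal.ofReal (weight x ^ m) * ‖f x‖ₑ) ^ p.toReal) ^ (1 / p.toReal) := by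
  rw [eLpNorm_eq_lintegral_rpow_enorm_toReal hp0 hp, weightedMeasure,
    lintegral_withDensity_eq_lintegral_mul_non_measurable _ (measurable_ofReal_weight_rpow _)
      (ae_of_all _ fun x => ENNReal.ofReal_lt_top)]
  congr 2
  funext x
  rw [Pi.mul_apply, ENNReal.mul_rpow_of_nonneg _ _ ENNReal.toReal_nonneg, Real.rpow_mul
    (weight_pos x).le, ENNReal.ofReal_rpow_of_nonneg (Real.rpow_nonneg (weight_pos x).le _)
    ENNReal.toReal_nonneg]

theorem weightedMeasure_absolutelyContinuous (p : ℝ≥0∞) (m : ℝ) :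
    weightedMeasure p m ≪ volume := withDensity_absolutelyContinuous _ _

theorem absolutelyContinuous_weightedMeasure (p : ℝ≥0∞) (m : ℝ) :
    (volume : Measure (ℝ × ℝ)) ≪ weightedMeasure p m :=
  withDensity_absolutelyContinuous' (measurable_ofReal_weight_rpow _).aemeasurable
    (ae_of_all _ fun x => by
      simpa using Real.rpow_pos_of_pos (weight_pos x) _)

/-! ### Tensor products of one-dimensional kernels -/

/-- Weighted Schur bounds with constant `N` for an integral kernel on the line, from `L^p` to `L²`
when `1/r + 1/p = 3/2`. -/
def LineBound (m r : ℝ) (k : ℝ → ℝ → ℝ) (N : ℝ≥0∞) : Prop :=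
  ∃ H G : ℝ → ℝ → ℝ≥0∞, Measurable (Function.uncurry H) ∧ Measurable (Function.uncurry G) ∧
    (∀ x z, ENNReal.ofReal (lineWeight m x) * ‖k x z‖ₑ ≤
      H x z * G x z ^ (1 / r - 1 / 2) * ENNReal.ofReal (lineWeight m z)) ∧
    (∀ x, ∫⁻ z, H x z ^ r * G x z ≤ N ^ r) ∧ ∀ z, ∫⁻ x, H x z ^ r ≤ N ^ r

/-- The weight and both Schur conditions factor over the coordinates, so the constants on the line
multiply. The function `G` in `LineBound` brings extra decay in `z` into the row integrals only,
where the dilation by `β` would otherwise be costly. -/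
theorem eLpNorm_integral_tensor_le {m r : ℝ} {p : ℝ≥0∞} (hp : 1 ≤ p) (hp2 : p ≤ 2)
    (hr : 0 < r) (hpr : 1 / r + 1 / p.toReal = 3 / 2) {k₁ k₂ : ℝ → ℝ → ℝ} {N₁ N₂ : ℝ≥0∞}
    (h₁ : LineBound m r k₁ N₁) (h₂ : LineBound m r k₂ N₂) {f : ℝ × ℝ → ℝ}
    (hf : Measurable f) :
    eLpNorm (fun x : ℝ × ℝ => ∫ z : ℝ × ℝ, k₁ x.1 z.1 * k₂ x.2 z.2 * f z) 2
      (weightedMeasure 2 m) ≤ N₁ * N₂ * eLpNorm f p (weightedMeasure p m) := by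
  obtain ⟨H₁, G₁, hH₁, hG₁, hb₁, hA₁, hB₁⟩ := h₁
  obtain ⟨H₂, G₂, hH₂, hG₂, hb₂, hA₂, hB₂⟩ := h₂
  have hptop : p ≠ ⊤ := (hp2.trans_lt (by simp)).ne
  have hp0 : p ≠ 0 := (zero_lt_one.trans_le hp).ne'
  have hp' : 1 ≤ p.toReal := by
    rw [← ENNReal.toReal_one]; exact (ENNReal.toReal_le_toReal (by simp) hptop).2 hp
  have hp2' : p.toReal ≤ 2 := by
    rw [← ENNReal.toReal_ofNat]; exact (ENNReal.toReal_le_toReal hptop (by simp)).2 hp2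
  have hθ : 0 ≤ 1 / r - 1 / 2 := by
    have : 1 / p.toReal ≤ 1 := by rw [div_le_one (by linarith)]; exact hp'
    linarith
  rw [eLpNorm_weightedMeasure two_ne_zero (by simp), eLpNorm_weightedMeasure hp0 hptop]
  set F : ℝ × ℝ → ℝ≥0∞ := fun z => ENNReal.ofReal (weight z ^ m) * ‖f z‖ₑ with hF
  have hFm : Measurable F := (measurable_ofReal_weight_rpow m).mul hf.enorm
  have m1 : Measurable fun q : (ℝ × ℝ) × (ℝ × ℝ) => (q.1.1, q.2.1) := by fun_prop
  have m2 : Measurable fun q : (ℝ × ℝ) × (ℝ × ℝ) => (q.1.2, q.2.2) := by fun_prop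
  have key := lintegral_schur (volume : Measure (ℝ × ℝ)) (volume : Measure (ℝ × ℝ)) hp' hp2' hr hpr
    (H := fun x z => H₁ x.1 z.1 * H₂ x.2 z.2) (G := fun x z => G₁ x.1 z.1 * G₂ x.2 z.2) (F := F)
    ((hH₁.comp m1).mul (hH₂.comp m2)) ((hG₁.comp m1).mul (hG₂.comp m2)) hFm (N₁ * N₂)
    (by
      intro x
      have e : ∀ z : ℝ × ℝ, (H₁ x.1 z.1 * H₂ x.2 z.2) ^ r * (G₁ x.1 z.1 * G₂ x.2 z.2) =
          (H₁ x.1 z.1 ^ r * G₁ x.1 z.1) * (H₂ x.2 z.2 ^ r * G₂ x.2 z.2) := by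
        intro z; rw [ENNReal.mul_rpow_of_nonneg _ _ hr.le]; ring
      simp_rw [e]
      rw [Measure.volume_eq_prod, lintegral_prod_mul
        (f := fun z => H₁ x.1 z ^ r * G₁ x.1 z) (g := fun z => H₂ x.2 z ^ r * G₂ x.2 z)
        (((hH₁.comp measurable_prodMk_left).pow_const r).mul
          (hG₁.comp measurable_prodMk_left)).aemeasurable
        (((hH₂.comp measurable_prodMk_left).pow_const r).mul
          (hG₂.comp measurable_prodMk_left)).aemeasurable, ENNReal.mul_rpow_of_nonneg _ _ hr.le]
      exact mul_le_mul' (hA₁ _) (hA₂ _))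
    (by
      intro z
      simp_rw [ENNReal.mul_rpow_of_nonneg _ _ hr.le]
      rw [Measure.volume_eq_prod, lintegral_prod_mul
        (f := fun x => H₁ x z.1 ^ r) (g := fun x => H₂ x z.2 ^ r)
        ((hH₁.comp measurable_prodMk_right).pow_const r).aemeasurable
        ((hH₂.comp measurable_prodMk_right).pow_const r).aemeasurable]
      exact mul_le_mul' (hB₁ _) (hB₂ _))
  have pt : ∀ x : ℝ × ℝ, ENNReal.ofReal (weight x ^ m) *
      ‖∫ z : ℝ × ℝ, k₁ x.1 z.1 * k₂ x.2 z.2 * f z‖ₑ ≤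
      ∫⁻ z, (H₁ x.1 z.1 * H₂ x.2 z.2) * (G₁ x.1 z.1 * G₂ x.2 z.2) ^ (1 / r - 1 / 2) * F z := by
    intro x
    refine (mul_le_mul_right (enorm_integral_le_lintegral_enorm _) _).trans ?_
    rw [← lintegral_const_mul' _ _ ENNReal.ofReal_ne_top]
    refine lintegral_mono fun z => ?_
    simp only [hF, weight_rpow, enorm_mul, ENNReal.ofReal_mul (lineWeight_pos m _).le]
    rw [ENNReal.mul_rpow_of_nonneg _ _ hθ]
    calc _ = (ENNReal.ofReal (lineWeight m x.1) * ‖k₁ x.1 z.1‖ₑ) *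
          (ENNReal.ofReal (lineWeight m x.2) * ‖k₂ x.2 z.2‖ₑ) * ‖f z‖ₑ := by ring
      _ ≤ _ := mul_le_mul_left (mul_le_mul' (hb₁ _ _) (hb₂ _ _)) _
      _ = _ := by ring
  have h2 : (2 : ℝ≥0∞).toReal = 2 := by simp
  rw [h2]
  calc _ ≤ ((N₁ * N₂) ^ (2 : ℝ) * (∫⁻ z, F z ^ p.toReal) ^ (2 / p.toReal)) ^ (1 / 2 : ℝ) := by
        refine ENNReal.rpow_le_rpow (le_trans (lintegral_mono fun x => ?_) key) (by norm_num)
        exact ENNReal.rpow_le_rpow (pt x) zero_le_two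
    _ = _ := by
        rw [ENNReal.mul_rpow_of_nonneg _ _ (by norm_num), ← ENNReal.rpow_mul, ← ENNReal.rpow_mul,
          show (2 : ℝ) * (1 / 2) = 1 by norm_num, ENNReal.rpow_one,
          show 2 / p.toReal * (1 / 2) = 1 / p.toReal by ring]

/-! ### Bounds for the one-dimensional kernels -/

/-- Peetre's inequality `1 + (u+v)² ≤ 2(1+u²)(1+v²)`. It splits the weight at `x = u + βz` into a
part absorbed by the Gaussian in `u` and a part at `βz`. -/
theorem lineWeight_add_le {m : ℝ} (hm : 0 ≤ m) (u v : ℝ) :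
    lineWeight m (u + v) ≤ √2 ^ m * (lineWeight m u * lineWeight m v) := by
  unfold lineWeight
  rw [← Real.mul_rpow (Real.sqrt_nonneg _) (Real.sqrt_nonneg _), ← Real.sqrt_mul (by positivity),
    ← Real.mul_rpow (Real.sqrt_nonneg _) (Real.sqrt_nonneg _), ← Real.sqrt_mul zero_le_two]
  refine Real.rpow_le_rpow (Real.sqrt_nonneg _) (Real.sqrt_le_sqrt ?_) hm
  nlinarith [sq_nonneg (u - v), sq_nonneg (u * v), sq_nonneg u, sq_nonneg v]

theorem lineWeight_neg (m u : ℝ) : lineWeight (-m) u = (lineWeight m u)⁻¹ :=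
  Real.rpow_neg (Real.sqrt_nonneg _) m

theorem lineWeight_sq (m u : ℝ) : lineWeight m u ^ 2 = lineWeight (2 * m) u := by
  unfold lineWeight
  rw [← Real.rpow_natCast, ← Real.rpow_mul (Real.sqrt_nonneg _)]
  congr 1; push_cast; ring

theorem lineWeight_eq_rpow (m u : ℝ) : lineWeight m u = (1 + u ^ 2) ^ (m / 2) := by
  unfold lineWeight
  rw [Real.sqrt_eq_rpow, ← Real.rpow_mul (by positivity)]
  congr 1; ring

theorem integrable_lineWeight {s : ℝ} (hs : 1 < s) : Integrable (lineWeight (-s)) := by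
  have h := integrable_rpow_neg_one_add_norm_sq (E := ℝ) (μ := volume) (r := s) (by simpa using hs)
  refine h.congr (ae_of_all _ fun u => ?_)
  simp only [lineWeight_eq_rpow, Real.norm_eq_abs, sq_abs]

theorem exists_lineWeight_mul_exp_le (m : ℝ) {b : ℝ} (hb : 0 < b) :
    ∃ C, 0 < C ∧ ∀ u, lineWeight m u * Real.exp (-b * u ^ 2) ≤ C := by
  obtain ⟨n, hn⟩ := exists_nat_ge (m / 2)
  -- The constant comes from `y^n/n! ≤ e^y` at `y = b(1+u²)`, with a natural power `n ≥ m/2`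
  -- dominating the weight.
  refine ⟨n.factorial / b ^ n * Real.exp b, by positivity, fun u => ?_⟩
  have h1 : lineWeight m u ≤ (1 + u ^ 2) ^ n := by
    rw [lineWeight_eq_rpow, ← Real.rpow_natCast (1 + u ^ 2) n]
    exact Real.rpow_le_rpow_of_exponent_le (le_add_of_nonneg_right (sq_nonneg u)) hn
  have h2 := Real.pow_div_factorial_le_exp (b * (1 + u ^ 2)) (by positivity) n
  have h3 : (1 + u ^ 2) ^ n ≤ n.factorial / b ^ n * Real.exp (b * (1 + u ^ 2)) := by
    rw [mul_pow, div_le_iff₀ (by positivity)] at h2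
    rw [div_mul_eq_mul_div, le_div_iff₀ (by positivity)]
    linarith
  calc lineWeight m u * Real.exp (-b * u ^ 2)
      ≤ (n.factorial / b ^ n * Real.exp (b * (1 + u ^ 2))) * Real.exp (-b * u ^ 2) := by
        gcongr; exact h1.trans h3
    _ = n.factorial / b ^ n * Real.exp b := by
        rw [mul_assoc, ← Real.exp_add]; congr 2; ring

theorem integrable_exp_neg_mul_sub_sq {b : ℝ} (hb : 0 < b) {β : ℝ} (hβ : 0 < β) (x : ℝ) :
    Integrable fun z => Real.exp (-b * (x - β * z) ^ 2) := by
  have h := ((integrable_exp_neg_mul_sq (b := b) hb).comp_sub_left x).comp_mul_left' hβ.ne'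
  exact h

theorem integral_exp_neg_mul_sub_sq {b : ℝ} {β : ℝ} (hβ : 0 < β) (x : ℝ) :
    ∫ z, Real.exp (-b * (x - β * z) ^ 2) = β⁻¹ * √(Real.pi / b) := by
  rw [Measure.integral_comp_mul_left (fun y => Real.exp (-b * (x - y) ^ 2)),
    integral_sub_left_eq_self (fun y => Real.exp (-b * y ^ 2)), integral_gaussian,
    abs_of_pos (inv_pos.2 hβ), smul_eq_mul]

theorem lintegral_le_ofReal_integral {X : Type*} [MeasurableSpace X] {μ : Measure X}
    {f : X → ℝ≥0∞} {g : X → ℝ} (h : ∀ x, f x ≤ ENNReal.ofReal (g x)) (hg : Integrable g μ)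
    (hg0 : ∀ x, 0 ≤ g x) {c : ℝ} (hc : ∫ x, g x ∂μ ≤ c) : ∫⁻ x, f x ∂μ ≤ ENNReal.ofReal c :=
  (lintegral_mono h).trans <| by
    rw [← ofReal_integral_eq_lintegral_ofReal hg (ae_of_all _ hg0)]
    exact ENNReal.ofReal_le_ofReal hc

/-- For `β|z| ≤ 1` the squared numerator is at most `2^m`; for `β|z| > 1` it is at most `2^m β^(2m)`
times the squared denominator. The first term is integrable in `z` when `2m > 1`, and in the second
`β^(2m)` then beats the `β⁻¹` produced by integrating a Gaussian in `βz`. -/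
theorem lineWeight_mul_div_sq_le {m β : ℝ} (hm : 0 ≤ m) (hβ : 0 < β) (z : ℝ) :
    (lineWeight m (β * z) / lineWeight m z) ^ 2 ≤
      2 ^ m * lineWeight (-(2 * m)) z + 2 ^ m * β ^ (2 * m) := by
  rw [div_pow, lineWeight_sq, lineWeight_sq, lineWeight_neg]
  have hw := lineWeight_pos (2 * m) z
  have e2 : 2 * m / 2 = m := by ring
  rcases le_or_gt (β ^ 2 * z ^ 2) 1 with h | h
  · have : lineWeight (2 * m) (β * z) ≤ 2 ^ m := by
      rw [lineWeight_eq_rpow, e2]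
      exact Real.rpow_le_rpow (by positivity) (by nlinarith) hm
    rw [div_eq_mul_inv]
    have h3 : lineWeight (2 * m) (β * z) * (lineWeight (2 * m) z)⁻¹ ≤
      2 ^ m * (lineWeight (2 * m) z)⁻¹ := by gcongr
    have h4 : (0 : ℝ) ≤ 2 ^ m * β ^ (2 * m) := by positivity
    linarith
  · have : lineWeight (2 * m) (β * z) ≤ 2 ^ m * β ^ (2 * m) * lineWeight (2 * m) z := by
      rw [lineWeight_eq_rpow, lineWeight_eq_rpow, e2, Real.rpow_mul hβ.le, ← Real.mul_rpow
        zero_le_two (by positivity), ← Real.mul_rpow (by positivity) (by positivity)]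
      refine Real.rpow_le_rpow (by positivity) ?_ hm
      rw [Real.rpow_two]; nlinarith [sq_nonneg β]
    have h3 : lineWeight (2 * m) (β * z) / lineWeight (2 * m) z ≤ 2 ^ m * β ^ (2 * m) := by
      rw [div_le_iff₀ hw]; exact this
    have h4 : 0 ≤ 2 ^ m * (lineWeight (2 * m) z)⁻¹ := by positivity
    linarith

/-- Half of the exponent is given away so that the kernel and its derivative share one Gaussian
envelope, the input of `exists_lineBound_of_le_exp`. -/
theorem heatKernel_le_exp {a : ℝ} (ha : 0 < a) (u : ℝ) :
    |heatKernel a u| ≤ 1 / √a * Real.exp (-(u ^ 2 / (8 * a))) := by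
  rw [abs_of_nonneg (heatKernel_nonneg a u)]
  unfold heatKernel
  have h1 : √a ≤ √(4 * Real.pi * a) := Real.sqrt_le_sqrt (by nlinarith [Real.pi_gt_three])
  have h2 : -u ^ 2 / (4 * a) ≤ -(u ^ 2 / (8 * a)) := by
    rw [neg_div, neg_le_neg_iff]
    exact div_le_div_of_nonneg_left (by positivity) (by positivity) (by linarith)
  gcongr

/-- The half of the exponent given away absorbs the linear factor: `s e^{-s²/8} ≤ 2` with `s =
|u|/√a`. -/
theorem heatKernelD_le_exp {a : ℝ} (ha : 0 < a) (u : ℝ) :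
    |heatKernelD a u| ≤ 1 / a * Real.exp (-(u ^ 2 / (8 * a))) := by
  have hs : 0 < √a := Real.sqrt_pos.2 ha
  have hsa : √a * √a = a := Real.mul_self_sqrt ha.le
  unfold heatKernelD
  rw [abs_mul, abs_of_nonneg (heatKernel_nonneg a u), abs_div, abs_of_pos (by positivity : 0 < 2 * a)]
  have e : Real.exp (-u ^ 2 / (4 * a)) =
      Real.exp (-(u ^ 2 / (8 * a))) * Real.exp (-(u ^ 2 / (8 * a))) := by
    rw [← Real.exp_add]; congr 1; field_simp; ring
  have h3 : √(4 * Real.pi * a) ≥ 3 * √a := by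
    rw [ge_iff_le, show (3 : ℝ) * √a = √(9 * a) by
      rw [Real.sqrt_mul (by norm_num), show (9 : ℝ) = 3 ^ 2 by norm_num,
        Real.sqrt_sq (by norm_num)]]
    exact Real.sqrt_le_sqrt (by nlinarith [Real.pi_gt_three])
  have h4 : |u| / √a * Real.exp (-(u ^ 2 / (8 * a))) ≤ 2 := by
    rw [Real.exp_neg, ← div_eq_mul_inv, div_le_iff₀ (Real.exp_pos _)]
    have h5 := Real.add_one_le_exp (u ^ 2 / (8 * a))
    have h6 : u ^ 2 / (8 * a) = (|u| / √a) ^ 2 / 8 := by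
      rw [div_pow, Real.sq_sqrt ha.le, sq_abs]; field_simp
    rw [h6] at h5 ⊢
    nlinarith [sq_nonneg (|u| / √a - 2)]
  unfold heatKernel
  rw [e]
  calc |u| / (2 * a) * (1 / √(4 * Real.pi * a) *
        (Real.exp (-(u ^ 2 / (8 * a))) * Real.exp (-(u ^ 2 / (8 * a)))))
      ≤ |u| / (2 * a) * (1 / (3 * √a) *
        (Real.exp (-(u ^ 2 / (8 * a))) * Real.exp (-(u ^ 2 / (8 * a))))) := by gcongr
    _ = (|u| / √a * Real.exp (-(u ^ 2 / (8 * a)))) * (1 / 6) *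
        (1 / a * Real.exp (-(u ^ 2 / (8 * a)))) := by field_simp; ring
    _ ≤ 1 * (1 / a * Real.exp (-(u ^ 2 / (8 * a)))) := by
        gcongr; linarith
    _ = _ := one_mul _

-- With `u = x - βz`, the envelope splits into two equal Gaussian halves. One absorbs the weight in
-- `u`, uniformly in `t` because `a ≤ 1/α`; the other, `e`, becomes `H` up to a constant. The
-- remaining weight ratio `ρ ≤ 1` goes into `G = ρ²`. The column integral of `e` is of order `√a`.
-- The row integral is of order `β⁻¹√a`, harmless for bounded `t` and compensated by `ρ²` when `1/2
-- < m`.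
set_option maxHeartbeats 1000000 in
theorem exists_lineBound_of_le_exp {α m r : ℝ} (hα : 0 < α) (hm : 0 ≤ m) (hr1 : 1 ≤ r)
    (hr2 : r ≤ 2) (T : ℝ) :
    ∃ C, 0 < C ∧ ∀ t, 0 < t → (t ≤ T ∨ 1 / 2 < m) → ∀ (h : ℝ → ℝ) (κ : ℝ), 0 ≤ κ →
      (∀ u, |h u| ≤ κ * Real.exp (-(u ^ 2 / (8 * aCoeff α t)))) →
      LineBound m r (fun x z => h (x - Real.exp (-α * t / 2) * z))
        (ENNReal.ofReal (C * κ * aCoeff α t ^ (1 / (2 * r)))) := by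
  have hr0 : 0 < r := by linarith
  obtain ⟨C₀, hC₀, hC₀b⟩ := exists_lineWeight_mul_exp_le m (b := α / 16) (by positivity)
  set J : ℝ := ∫ z, lineWeight (-(2 * m)) z with hJ
  have hJ0 : 0 ≤ J := integral_nonneg fun z => (lineWeight_pos _ _).le
  have ha1 : 0 < aCoeff α 1 := aCoeff_pos hα one_pos
  -- The first term bounds the row integral for `t ≤ max T 1` and also the column integral; the
  -- other two bound the row integral for larger `t`. Dividing by `√(aCoeff α 1)` lets the constant
  -- `J` be charged to `√a`, as `a ≥ aCoeff α 1` there. From `L ≥ 1` follows `L ≤ L^r`.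
  set L : ℝ := √(16 * Real.pi) * Real.exp (α * max T 1 / 2) + 2 ^ m * J / √(aCoeff α 1) +
    2 ^ m * √(16 * Real.pi) with hL
  have h16 : 1 ≤ √(16 * Real.pi) := Real.one_le_sqrt.2 (by nlinarith [Real.pi_gt_three])
  have hexpT : 1 ≤ Real.exp (α * max T 1 / 2) := Real.one_le_exp (by positivity)
  have hL1 : √(16 * Real.pi) * Real.exp (α * max T 1 / 2) ≤ L := by
    have h1 : 0 ≤ 2 ^ m * J / √(aCoeff α 1) := by positivity
    have h2 : 0 ≤ 2 ^ m * √(16 * Real.pi) := by positivity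
    linarith
  have hL2 : 2 ^ m * J / √(aCoeff α 1) + 2 ^ m * √(16 * Real.pi) ≤ L := by
    have : 0 ≤ √(16 * Real.pi) * Real.exp (α * max T 1 / 2) := by positivity
    linarith
  have hL4 : √(16 * Real.pi) ≤ L := (le_mul_of_one_le_right (by positivity) hexpT).trans hL1
  have hL3 : 1 ≤ L := h16.trans hL4
  set C₁ : ℝ := √2 ^ m * C₀ with hC₁
  have hC₁0 : 0 < C₁ := by positivity
  refine ⟨C₁ * L, by positivity, fun t ht hTm h κ hκ hh => ?_⟩
  set a := aCoeff α t with ha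
  have ha0 : 0 < a := aCoeff_pos hα ht
  have haα : a ≤ 1 / α := aCoeff_le hα t
  set β := Real.exp (-α * t / 2) with hβ
  have hβ0 : 0 < β := Real.exp_pos _
  have hβ1 : β ≤ 1 := Real.exp_le_one_iff.2 (by nlinarith [mul_pos hα ht])
  set b : ℝ := 1 / (16 * a) with hb
  have hb0 : 0 < b := by positivity
  have hsb : √(Real.pi / b) = √(16 * Real.pi) * √a := by
    rw [← Real.sqrt_mul (by positivity)]; congr 1; rw [hb]; field_simp
  set e : ℝ → ℝ → ℝ := fun x z => Real.exp (-b * (x - β * z) ^ 2) with he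
  have he0 : ∀ x z, 0 ≤ e x z := fun x z => (Real.exp_pos _).le
  have hec : Continuous (Function.uncurry e) := by
    simp only [he, Function.uncurry_def]; fun_prop
  set ρ : ℝ → ℝ := fun z => lineWeight m (β * z) / lineWeight m z with hρ
  have hρ0 : ∀ z, 0 < ρ z := fun z => div_pos (lineWeight_pos _ _) (lineWeight_pos _ _)
  have hρ1 : ∀ z, ρ z ≤ 1 := fun z => (div_le_one (lineWeight_pos _ _)).2 <|
    lineWeight_mono hm (by
      rw [abs_mul, abs_of_pos hβ0]; exact mul_le_of_le_one_left (abs_nonneg z) hβ1)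
  have hρc : Continuous ρ := ((continuous_lineWeight m).comp (by fun_prop)).div
    (continuous_lineWeight m) fun z => (lineWeight_pos m z).ne'
  have hθ : 0 ≤ 1 / r - 1 / 2 := by
    have := one_div_le_one_div_of_le hr0 hr2; linarith
  have hθ1 : 2 * (1 / r - 1 / 2) ≤ 1 := by
    have : 1 / r ≤ 1 := by rw [div_le_one hr0]; exact hr1
    linarith
  have hN : ENNReal.ofReal (C₁ * L * κ * a ^ (1 / (2 * r))) ^ r =
      ENNReal.ofReal ((C₁ * κ) ^ r * (L ^ r * √a)) := by
    rw [ENNReal.ofReal_rpow_of_nonneg (by positivity) hr0.le]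
    congr 1
    rw [Real.mul_rpow (by positivity) (by positivity), ← Real.rpow_mul ha0.le,
      show 1 / (2 * r) * r = 1 / 2 by field_simp, ← Real.sqrt_eq_rpow,
      show C₁ * L * κ = (C₁ * κ) * L by ring, Real.mul_rpow (by positivity) (by positivity)]
    ring
  have hLr : L ≤ L ^ r := by
    conv_lhs => rw [← Real.rpow_one L]
    exact Real.rpow_le_rpow_of_exponent_le hL3 hr1
  have hHr : ∀ x z, ENNReal.ofReal (C₁ * κ * e x z) ^ r ≤
      ENNReal.ofReal ((C₁ * κ) ^ r * e x z) := by
    intro x z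
    rw [ENNReal.ofReal_rpow_of_nonneg (mul_nonneg (by positivity) (he0 _ _)) hr0.le]
    refine ENNReal.ofReal_le_ofReal ?_
    rw [Real.mul_rpow (by positivity) (he0 _ _)]
    gcongr
    have h1 : e x z ≤ 1 := Real.exp_le_one_iff.2 (by nlinarith [sq_nonneg (x - β * z)])
    calc e x z ^ r ≤ e x z ^ (1 : ℝ) :=
          Real.rpow_le_rpow_of_exponent_ge (Real.exp_pos _) h1 hr1
      _ = e x z := Real.rpow_one _
  refine ⟨fun x z => ENNReal.ofReal (C₁ * κ * e x z), fun _ z => ENNReal.ofReal (ρ z ^ 2),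
    (hec.measurable.const_mul (C₁ * κ)).ennreal_ofReal,
    ((hρc.pow 2).comp continuous_snd).measurable.ennreal_ofReal, fun x z => ?_, fun x => ?_,
    fun z => ?_⟩
  -- Since `ρ ≤ 1` and `2(1/r - 1/2) ≤ 1`, the power of `ρ²` allowed by `LineBound` is no smaller
  -- than `ρ` itself.
  · have hG : ENNReal.ofReal (ρ z) ≤ ENNReal.ofReal (ρ z ^ 2) ^ (1 / r - 1 / 2) := by
      rw [ENNReal.ofReal_rpow_of_nonneg (by positivity) hθ]
      refine ENNReal.ofReal_le_ofReal ?_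
      rw [← Real.rpow_natCast, ← Real.rpow_mul (hρ0 z).le]
      calc ρ z = ρ z ^ (1 : ℝ) := (Real.rpow_one _).symm
        _ ≤ _ := Real.rpow_le_rpow_of_exponent_ge (hρ0 z) (hρ1 z) (by exact_mod_cast hθ1)
    refine le_trans ?_ (mul_le_mul_left (mul_le_mul_right hG _) _)
    rw [← ENNReal.ofReal_mul (mul_nonneg (by positivity) (he0 _ _)), ← ENNReal.ofReal_mul
      (mul_nonneg (mul_nonneg (by positivity) (he0 _ _)) (hρ0 z).le), Real.enorm_eq_ofReal_abs,
      ← ENNReal.ofReal_mul (lineWeight_pos _ _).le]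
    refine ENNReal.ofReal_le_ofReal ?_
    set u := x - β * z with hu
    have hx : x = u + β * z := by rw [hu]; ring
    have e1 : Real.exp (-(u ^ 2 / (8 * a))) = Real.exp (-b * u ^ 2) * Real.exp (-b * u ^ 2) := by
      rw [← Real.exp_add, hb]; congr 1; field_simp; ring
    have e2 : lineWeight m u * Real.exp (-b * u ^ 2) ≤ C₀ := by
      refine le_trans ?_ (hC₀b u)
      gcongr
      · exact (lineWeight_pos _ _).le
      · rw [hb, div_le_div_iff₀ (by norm_num) (by positivity)]
        rw [le_div_iff₀ hα] at haα
        nlinarith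
    calc lineWeight m x * |h u|
        ≤ (√2 ^ m * (lineWeight m u * lineWeight m (β * z))) *
          (κ * (Real.exp (-b * u ^ 2) * Real.exp (-b * u ^ 2))) := by
          rw [← e1]
          gcongr
          · exact (mul_nonneg (by positivity) (mul_nonneg (lineWeight_pos _ _).le
              (lineWeight_pos _ _).le))
          · conv_lhs => rw [hx]
            exact lineWeight_add_le hm u (β * z)
          · exact hh u
      _ = √2 ^ m * (lineWeight m u * Real.exp (-b * u ^ 2)) * κ * Real.exp (-b * u ^ 2) *
          lineWeight m (β * z) := by ring
      _ ≤ √2 ^ m * C₀ * κ * Real.exp (-b * u ^ 2) * lineWeight m (β * z) := by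
          gcongr
          exact (lineWeight_pos _ _).le
      _ = C₁ * κ * e x z * ρ z * lineWeight m z := by
          simp only [he, hρ, hC₁, ← hu]
          have := (lineWeight_pos m z).ne'
          field_simp
  · rw [hN]
    rcases le_or_gt t (max T 1) with hT | hT
    · refine lintegral_le_ofReal_integral (g := fun z => (C₁ * κ) ^ r * e x z) (fun z => ?_)
        ((integrable_exp_neg_mul_sub_sq hb0 hβ0 x).const_mul _)
        (fun z => mul_nonneg (by positivity) (he0 _ _)) ?_
      · have hg : ENNReal.ofReal (ρ z ^ 2) ≤ 1 :=
          ENNReal.ofReal_le_one.2 (pow_le_one₀ (hρ0 z).le (hρ1 z))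
        exact (mul_le_mul' (hHr x z) hg).trans (mul_one _).le
      · rw [integral_const_mul, integral_exp_neg_mul_sub_sq hβ0, hsb]
        refine mul_le_mul_of_nonneg_left ?_ (by positivity)
        have h1 : β⁻¹ ≤ Real.exp (α * max T 1 / 2) := by
          rw [hβ, ← Real.exp_neg]
          apply Real.exp_le_exp.2
          nlinarith
        calc β⁻¹ * (√(16 * Real.pi) * √a)
            ≤ Real.exp (α * max T 1 / 2) * (√(16 * Real.pi) * √a) := by gcongr
          _ = √(16 * Real.pi) * Real.exp (α * max T 1 / 2) * √a := by ring
          _ ≤ L ^ r * √a := by gcongr; exact hL1.trans hLr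
    -- Long times: `ρ²` is replaced by its two-term bound, and `β^(2m) β⁻¹ ≤ 1` removes the growth
    -- of the row integral.
    · have hm2 : 1 / 2 < m := hTm.resolve_left (not_le.2 ((le_max_left _ _).trans_lt hT))
      have ht1 : 1 ≤ t := ((le_max_right _ _).trans_lt hT).le
      have hint := integrable_lineWeight (s := 2 * m) (by linarith)
      have hint2 := integrable_exp_neg_mul_sub_sq hb0 hβ0 x
      refine lintegral_le_ofReal_integral (g := fun z => (C₁ * κ) ^ r *
          (2 ^ m * lineWeight (-(2 * m)) z + 2 ^ m * β ^ (2 * m) * e x z)) (fun z => ?_)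
        (((hint.const_mul _).add (hint2.const_mul _)).const_mul _)
        (fun z => mul_nonneg (by positivity) (add_nonneg (mul_nonneg (by positivity)
          (lineWeight_pos _ _).le) (mul_nonneg (by positivity) (he0 _ _)))) ?_
      · refine (mul_le_mul_left (hHr x z) _).trans ?_
        rw [← ENNReal.ofReal_mul (mul_nonneg (by positivity) (he0 _ _))]
        refine ENNReal.ofReal_le_ofReal ?_
        rw [mul_assoc]
        refine mul_le_mul_of_nonneg_left ?_ (by positivity)
        have h1 : e x z ≤ 1 := Real.exp_le_one_iff.2 (by nlinarith [sq_nonneg (x - β * z)])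
        have h2 := lineWeight_mul_div_sq_le hm hβ0 z
        have h3 := mul_le_mul_of_nonneg_left h2 (he0 x z)
        have h4 : e x z * (2 ^ m * lineWeight (-(2 * m)) z) ≤ 2 ^ m * lineWeight (-(2 * m)) z :=
          mul_le_of_le_one_left (mul_nonneg (by positivity) (lineWeight_pos _ _).le) h1
        calc _ ≤ _ := h3
          _ = e x z * (2 ^ m * lineWeight (-(2 * m)) z) + 2 ^ m * β ^ (2 * m) * e x z := by ring
          _ ≤ _ := by linarith
      · rw [integral_const_mul, integral_add (hint.const_mul _) (hint2.const_mul _),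
          integral_const_mul, integral_const_mul, integral_exp_neg_mul_sub_sq hβ0, hsb, ← hJ]
        refine mul_le_mul_of_nonneg_left ?_ (by positivity)
        have h1 : √(aCoeff α 1) ≤ √a := Real.sqrt_le_sqrt (aCoeff_mono hα ht1)
        have h2 : β ^ (2 * m) * β⁻¹ ≤ 1 := by
          rw [← Real.rpow_neg_one β, ← Real.rpow_add hβ0]
          exact Real.rpow_le_one hβ0.le hβ1 (by linarith)
        have h3 : 0 < √(aCoeff α 1) := Real.sqrt_pos.2 ha1
        calc 2 ^ m * J + 2 ^ m * β ^ (2 * m) * (β⁻¹ * (√(16 * Real.pi) * √a))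
            = 2 ^ m * J / √(aCoeff α 1) * √(aCoeff α 1) +
              (β ^ (2 * m) * β⁻¹) * (2 ^ m * √(16 * Real.pi) * √a) := by field_simp
          _ ≤ 2 ^ m * J / √(aCoeff α 1) * √a + 1 * (2 ^ m * √(16 * Real.pi) * √a) := by gcongr
          _ = (2 ^ m * J / √(aCoeff α 1) + 2 ^ m * √(16 * Real.pi)) * √a := by ring
          _ ≤ L ^ r * √a := by gcongr; exact hL2.trans hLr
  · rw [hN]
    have hi := (integrable_exp_neg_mul_sq (b := b) hb0).comp_sub_right (β * z)
    refine lintegral_le_ofReal_integral (g := fun x => (C₁ * κ) ^ r * e x z) (fun x => hHr x z)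
      (hi.const_mul _) (fun x => mul_nonneg (by positivity) (he0 _ _)) ?_
    rw [integral_const_mul]
    have : ∫ x, e x z = √(Real.pi / b) := by
      simp only [he]
      rw [integral_sub_right_eq_self (fun x => Real.exp (-b * x ^ 2)), integral_gaussian]
    rw [this, hsb]
    exact mul_le_mul_of_nonneg_left (mul_le_mul_of_nonneg_right (hL4.trans hLr)
      (Real.sqrt_nonneg _)) (by positivity)

theorem exists_lineBound_lineKernel {α m q r : ℝ} (hα : 0 < α) (hm : 0 ≤ m) (hq : 1 ≤ q)
    (hq2 : q ≤ 2) (hr : 0 < r) (hqr : 1 / r + 1 / q = 3 / 2) (T : ℝ) :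
    ∃ C, 0 < C ∧ ∀ t, 0 < t → (t ≤ T ∨ 1 / 2 < m) →
      LineBound m r (lineKernel α t)
        (ENNReal.ofReal (C / aCoeff α t ^ (1 / (2 * q) - 1 / 4))) ∧
      LineBound m r (lineKernelD α t)
        (ENNReal.ofReal (C * Real.exp (-α * t / 2) / aCoeff α t ^ (1 / (2 * q) + 1 / 4))) := by
  have hq0 : 0 < q := by linarith
  have hq1 : 1 / q ≤ 1 := by rw [div_le_one hq0]; exact hq
  have hq3 : 1 / 2 ≤ 1 / q := one_div_le_one_div_of_le hq0 hq2
  have hr1 : 1 ≤ r := by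
    have : 1 / r ≤ 1 := by linarith
    rwa [div_le_one hr] at this
  have hr2 : r ≤ 2 := by
    have : 1 / 2 ≤ 1 / r := by linarith
    exact (one_div_le_one_div two_pos hr).1 this
  obtain ⟨C, hC, h⟩ := exists_lineBound_of_le_exp hα hm hr1 hr2 T
  refine ⟨C, hC, fun t ht htT => ?_⟩
  have ha := aCoeff_pos hα ht
  set a := aCoeff α t with ha'
  -- Multiplying `a^(1/(2r))` by the envelope constants, `a^(-1/2)` for the kernel and `a⁻¹` for its
  -- derivative, then yields the two announced powers.
  have e1 : 1 / (2 * r) = 3 / 4 - 1 / (2 * q) := by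
    have h1 : 1 / (2 * r) = 1 / r / 2 := by field_simp
    have h2 : 1 / (2 * q) = 1 / q / 2 := by field_simp
    rw [h1, h2]; linarith
  constructor
  · have h1 := h t ht htT (heatKernel a) (1 / √a) (by positivity) (heatKernel_le_exp ha)
    have e2 : C / a ^ (1 / (2 * q) - 1 / 4) = C * (1 / √a) * a ^ (1 / (2 * r)) := by
      rw [e1, mul_assoc, div_eq_mul_inv C, Real.sqrt_eq_rpow, one_div (a ^ _),
        ← Real.rpow_neg ha.le, ← Real.rpow_neg ha.le, ← Real.rpow_add ha]
      congr 2; ring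
    have e3 : lineKernel α t = fun x z => heatKernel a (x - Real.exp (-α * t / 2) * z) :=
      funext fun x => funext fun z => lineKernel_eq α t x z
    rw [e2, e3]
    exact h1
  · have h1 := h t ht htT (fun u => -Real.exp (-α * t / 2) * heatKernelD a u)
      (Real.exp (-α * t / 2) * (1 / a)) (by positivity) (fun u => by
        rw [abs_mul, abs_neg, Real.abs_exp, mul_assoc]
        exact mul_le_mul_of_nonneg_left (heatKernelD_le_exp ha u) (Real.exp_pos _).le)
    have e2 : C * Real.exp (-α * t / 2) / a ^ (1 / (2 * q) + 1 / 4) =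
        C * (Real.exp (-α * t / 2) * (1 / a)) * a ^ (1 / (2 * r)) := by
      rw [e1, div_eq_mul_inv, mul_assoc, mul_assoc, mul_assoc, one_div a,
        ← Real.rpow_neg_one a, ← Real.rpow_neg ha.le, ← Real.rpow_add ha]
      congr 3; ring
    rw [e2]
    exact h1

/-! ### Differences of kernels -/

/-- The part `|βz| ≤ 1` of the kernel `k(x - βz)`, minus `k(x)`. -/
def lineKernelNear (α t x z : ℝ) : ℝ :=
  (if |Real.exp (-α * t / 2) * z| ≤ 1 then lineKernel α t x z else 0) - lineKernel α t x 0

/-- The part `|βz| > 1` of the kernel `k(x - βz)`. -/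
def lineKernelFar (α t x z : ℝ) : ℝ :=
  if |Real.exp (-α * t / 2) * z| ≤ 1 then 0 else lineKernel α t x z

theorem lineKernelNear_add_lineKernelFar (α t x z : ℝ) :
    lineKernelNear α t x z + lineKernelFar α t x z = lineKernel α t x z - lineKernel α t x 0 := by
  unfold lineKernelNear lineKernelFar; split_ifs <;> ring

/-- Mean value inequality on the unit ball around `x`. There `x² ≤ 2v² + 2`, so the Gaussian at `v`
is dominated by a wider one at `x` at the cost of `e^{1/(8a)}`. -/
theorem heatKernel_sub_le {a : ℝ} (ha : 0 < a) {y : ℝ} (hy : |y| ≤ 1) (x : ℝ) :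
    |heatKernel a (x - y) - heatKernel a x| ≤
      1 / a * Real.exp (1 / (8 * a)) * Real.exp (-(x ^ 2 / (16 * a))) * |y| := by
  have hd : ∀ v ∈ Metric.closedBall x 1, HasDerivWithinAt (heatKernel a)
      (-(v / (2 * a)) * heatKernel a v) (Metric.closedBall x 1) v :=
    fun v _ => (hasDerivAt_heatKernel a v).hasDerivWithinAt
  have hb : ∀ v ∈ Metric.closedBall x 1, ‖-(v / (2 * a)) * heatKernel a v‖ ≤
      1 / a * Real.exp (1 / (8 * a)) * Real.exp (-(x ^ 2 / (16 * a))) := by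
    intro v hv
    rw [Metric.mem_closedBall, Real.dist_eq] at hv
    have h1 := heatKernelD_le_exp ha v
    rw [heatKernelD] at h1
    rw [neg_mul, norm_neg, Real.norm_eq_abs, mul_assoc, ← Real.exp_add]
    refine h1.trans ?_
    gcongr
    have h2 : x ^ 2 ≤ 2 * v ^ 2 + 2 := by
      have h3 : (v - x) ^ 2 ≤ 1 := (sq_le_one_iff_abs_le_one _).2 hv
      nlinarith [sq_nonneg (x - 2 * v)]
    have h4 : x ^ 2 / (16 * a) ≤ v ^ 2 / (8 * a) + 1 / (8 * a) := by
      rw [← add_div, div_le_div_iff₀ (by positivity) (by positivity)]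
      nlinarith
    linarith
  have := (convex_closedBall x 1).norm_image_sub_le_of_norm_hasDerivWithin_le hd hb
    (Metric.mem_closedBall_self zero_le_one) (y := x - y) (by
      rw [Metric.mem_closedBall, Real.dist_eq]; simpa using hy)
  simpa using this

/-- Both branches are of size `β|z|` times a Gaussian in `x`: by the mean value bound if `|βz| ≤ 1`,
and otherwise because only `-k(x,0)` is left and `1 < β|z|`. The factor `β` is the decay. The factor
`|z|` is charged to the weight: `(|z|/lineWeight m z)²` is integrable because `2m - 2 > 1`. -/
theorem exists_lineBound_lineKernelNear {α m : ℝ} (hα : 0 < α) (hm : 3 / 2 < m) :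
    ∃ C, 0 < C ∧ ∀ t, 1 ≤ t →
      LineBound m 1 (lineKernelNear α t) (ENNReal.ofReal (C * Real.exp (-α * t / 2))) := by
  obtain ⟨C₀, hC₀, hC₀b⟩ := exists_lineWeight_mul_exp_le m (b := α / 32) (by positivity)
  have ha1 : 0 < aCoeff α 1 := aCoeff_pos hα one_pos
  set a₁ := aCoeff α 1 with ha₁
  -- `κ` dominates the constants of both branches for all `t ≥ 1`, since `a ≥ a₁` there.
  set κ : ℝ := 1 / a₁ * Real.exp (1 / (8 * a₁)) + 1 / √a₁ with hκ
  have hκ0 : 0 < κ := by positivity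
  set J : ℝ := ∫ z, lineWeight (-(2 * m - 2)) z with hJ
  have hJ0 : 0 ≤ J := integral_nonneg fun z => (lineWeight_pos _ _).le
  have hJi := integrable_lineWeight (s := 2 * m - 2) (by linarith)
  set b : ℝ := α / 32 with hb
  have hb0 : 0 < b := by positivity
  set L := J + √(Real.pi / b) with hL
  have hL0 : 0 < L := add_pos_of_nonneg_of_pos hJ0 (by positivity)
  refine ⟨κ * C₀ * L, by positivity, fun t ht => ?_⟩
  have ht0 : 0 < t := by linarith
  set a := aCoeff α t with ha
  have ha0 : 0 < a := aCoeff_pos hα ht0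
  have haα : a ≤ 1 / α := aCoeff_le hα t
  have haa : a₁ ≤ a := aCoeff_mono hα ht
  set β := Real.exp (-α * t / 2) with hβ
  have hβ0 : 0 < β := Real.exp_pos _
  have hexp : ∀ x : ℝ, ∀ c, 0 < c → c ≤ 16 → Real.exp (-(x ^ 2 / (c * a))) ≤
      Real.exp (-b * x ^ 2) * Real.exp (-b * x ^ 2) := by
    intro x c hc hc'
    rw [← Real.exp_add]
    apply Real.exp_le_exp.2
    have : α / 16 * x ^ 2 ≤ x ^ 2 / (c * a) := by
      rw [le_div_iff₀ (by positivity)]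
      rw [le_div_iff₀ hα] at haα
      have : α * (c * a) ≤ 16 := by nlinarith
      nlinarith [sq_nonneg x]
    rw [hb]; linarith
  have hpt : ∀ x z, |lineKernelNear α t x z| ≤
      κ * (Real.exp (-b * x ^ 2) * Real.exp (-b * x ^ 2)) * (β * |z|) := by
    intro x z
    have habs : |β * z| = β * |z| := by rw [abs_mul, abs_of_pos hβ0]
    have hk1 : 1 / a * Real.exp (1 / (8 * a)) ≤ κ := by
      have : 1 / a * Real.exp (1 / (8 * a)) ≤ 1 / a₁ * Real.exp (1 / (8 * a₁)) := by gcongr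
      have h2 : 0 ≤ 1 / √a₁ := by positivity
      linarith
    have hk2 : 1 / √a ≤ κ := by
      have : 1 / √a ≤ 1 / √a₁ := by gcongr
      have h2 : 0 ≤ 1 / a₁ * Real.exp (1 / (8 * a₁)) := by positivity
      linarith
    unfold lineKernelNear
    simp only [lineKernel_eq, ← ha, ← hβ, mul_zero, sub_zero]
    split_ifs with h
    · refine (heatKernel_sub_le ha0 h x).trans ?_
      rw [habs]
      gcongr
      exact hexp x 16 (by norm_num) le_rfl
    · rw [zero_sub, abs_neg]
      push Not at h
      rw [habs] at h
      refine (heatKernel_le_exp ha0 x).trans ?_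
      calc 1 / √a * Real.exp (-(x ^ 2 / (8 * a)))
          ≤ κ * (Real.exp (-b * x ^ 2) * Real.exp (-b * x ^ 2)) := by
            gcongr
            exact hexp x 8 (by norm_num) (by norm_num)
        _ ≤ _ := le_mul_of_one_le_right (by positivity) h.le
  have hGc : Continuous fun z : ℝ => (|z| / lineWeight m z) ^ 2 :=
    ((continuous_abs).div (continuous_lineWeight m) fun z => (lineWeight_pos m z).ne').pow 2
  refine ⟨fun x _ => ENNReal.ofReal (κ * C₀ * β * Real.exp (-b * x ^ 2)),
    fun _ z => ENNReal.ofReal ((|z| / lineWeight m z) ^ 2),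
    (Continuous.measurable (by fun_prop)).ennreal_ofReal,
    (hGc.comp continuous_snd).measurable.ennreal_ofReal, fun x z => ?_, fun x => ?_, fun z => ?_⟩
  · have h0 : 0 ≤ |z| / lineWeight m z := div_nonneg (abs_nonneg z) (lineWeight_pos _ _).le
    rw [ENNReal.ofReal_rpow_of_nonneg (by positivity) (by norm_num),
      show ((1 : ℝ) / 1 - 1 / 2) = 1 / 2 by norm_num, ← Real.sqrt_eq_rpow, Real.sqrt_sq h0,
      ← ENNReal.ofReal_mul (by positivity), ← ENNReal.ofReal_mul (by positivity),
      Real.enorm_eq_ofReal_abs, ← ENNReal.ofReal_mul (lineWeight_pos _ _).le]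
    refine ENNReal.ofReal_le_ofReal ?_
    have hw := lineWeight_pos m z
    calc lineWeight m x * |lineKernelNear α t x z|
        ≤ lineWeight m x * (κ * (Real.exp (-b * x ^ 2) * Real.exp (-b * x ^ 2)) * (β * |z|)) :=
          mul_le_mul_of_nonneg_left (hpt x z) (lineWeight_pos _ _).le
      _ = (lineWeight m x * Real.exp (-b * x ^ 2)) *
          (κ * Real.exp (-b * x ^ 2) * (β * |z|)) := by ring
      _ ≤ C₀ * (κ * Real.exp (-b * x ^ 2) * (β * |z|)) :=
          mul_le_mul_of_nonneg_right (hC₀b x) (by positivity)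
      _ = _ := by field_simp
  · simp only [ENNReal.rpow_one]
    refine lintegral_le_ofReal_integral (g := fun z => κ * C₀ * β * lineWeight (-(2 * m - 2)) z)
      (fun z => ?_) (hJi.const_mul _) (fun z => mul_nonneg (by positivity)
        (lineWeight_pos _ _).le) ?_
    · rw [← ENNReal.ofReal_mul (by positivity)]
      refine ENNReal.ofReal_le_ofReal ?_
      rw [mul_assoc]
      refine mul_le_mul_of_nonneg_left ?_ (by positivity)
      have h1 : Real.exp (-b * x ^ 2) ≤ 1 :=
        Real.exp_le_one_iff.2 (by nlinarith [sq_nonneg x])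
      have h2 : (|z| / lineWeight m z) ^ 2 ≤ lineWeight (-(2 * m - 2)) z := by
        have e : lineWeight (-(2 * m - 2)) z = (1 + z ^ 2) / lineWeight (2 * m) z := by
          rw [lineWeight_eq_rpow, lineWeight_eq_rpow, eq_div_iff (by positivity),
            ← Real.rpow_add (by positivity)]
          conv_rhs => rw [← Real.rpow_one (1 + z ^ 2)]
          congr 1; ring
        rw [div_pow, lineWeight_sq, sq_abs, e]
        have := lineWeight_pos (2 * m) z
        gcongr
        linarith
      calc _ ≤ 1 * lineWeight (-(2 * m - 2)) z := by gcongr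
        _ = _ := one_mul _
    · rw [integral_const_mul, ← hJ]
      have : J ≤ L := le_add_of_nonneg_right (by positivity)
      calc κ * C₀ * β * J ≤ κ * C₀ * β * L := by gcongr
        _ = _ := by ring
  · simp only [ENNReal.rpow_one]
    refine lintegral_le_ofReal_integral (g := fun x => κ * C₀ * β * Real.exp (-b * x ^ 2))
      (fun x => le_rfl) ((integrable_exp_neg_mul_sq hb0).const_mul _) (fun x => by positivity) ?_
    rw [integral_const_mul, integral_gaussian]
    have : √(Real.pi / b) ≤ L := le_add_of_nonneg_left hJ0
    calc κ * C₀ * β * √(Real.pi / b) ≤ κ * C₀ * β * L := by gcongr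
      _ = _ := by ring

/-- On `β|z| > 1` the weight at `βz` is at most `2^m β^m` times the weight at `z`. One power of `β`
is the decay. The other `β^(m-1)` enters through `G`, where its square outweighs the `β⁻¹` of the
row integral because `2m - 3 ≥ 0`. -/
theorem exists_lineBound_lineKernelFar {α m : ℝ} (hα : 0 < α) (hm : 3 / 2 < m) :
    ∃ C, 0 < C ∧ ∀ t, 1 ≤ t →
      LineBound m 1 (lineKernelFar α t) (ENNReal.ofReal (C * Real.exp (-α * t / 2))) := by
  have hm0 : 0 ≤ m := by linarith
  obtain ⟨C₀, hC₀, hC₀b⟩ := exists_lineWeight_mul_exp_le m (b := α / 32) (by positivity)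
  have ha1 : 0 < aCoeff α 1 := aCoeff_pos hα one_pos
  set a₁ := aCoeff α 1 with ha₁
  set κ : ℝ := 1 / √a₁ with hκ
  have hκ0 : 0 < κ := by positivity
  set b : ℝ := α / 32 with hb
  have hb0 : 0 < b := by positivity
  set A : ℝ := √2 ^ m * κ * C₀ * 2 ^ m with hA
  have hA0 : 0 < A := by positivity
  refine ⟨A * √(Real.pi / b), by positivity, fun t ht => ?_⟩
  have ht0 : 0 < t := by linarith
  set a := aCoeff α t with ha
  have ha0 : 0 < a := aCoeff_pos hα ht0
  have haα : a ≤ 1 / α := aCoeff_le hα t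
  have haa : a₁ ≤ a := aCoeff_mono hα ht
  set β := Real.exp (-α * t / 2) with hβ
  have hβ0 : 0 < β := Real.exp_pos _
  have hβ1 : β ≤ 1 := Real.exp_le_one_iff.2 (by nlinarith [mul_pos hα ht0])
  have hexp : ∀ x : ℝ, Real.exp (-(x ^ 2 / (8 * a))) ≤
      Real.exp (-b * x ^ 2) * Real.exp (-b * x ^ 2) := by
    intro x
    rw [← Real.exp_add]
    apply Real.exp_le_exp.2
    have : α / 16 * x ^ 2 ≤ x ^ 2 / (8 * a) := by
      rw [le_div_iff₀ (by positivity)]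
      rw [le_div_iff₀ hα] at haα
      have : α * (8 * a) ≤ 16 := by nlinarith
      nlinarith [sq_nonneg x]
    rw [hb]; linarith
  have hec : Continuous fun q : ℝ × ℝ => A * β * Real.exp (-b * (q.1 - β * q.2) ^ 2) := by
    fun_prop
  refine ⟨fun x z => ENNReal.ofReal (A * β * Real.exp (-b * (x - β * z) ^ 2)),
    fun _ _ => ENNReal.ofReal ((β ^ (m - 1)) ^ 2), hec.measurable.ennreal_ofReal,
    measurable_const, fun x z => ?_, fun x => ?_, fun z => ?_⟩
  · rw [ENNReal.ofReal_rpow_of_nonneg (by positivity) (by norm_num),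
      show ((1 : ℝ) / 1 - 1 / 2) = 1 / 2 by norm_num, ← Real.sqrt_eq_rpow,
      Real.sqrt_sq (by positivity),
      ← ENNReal.ofReal_mul (by positivity), ← ENNReal.ofReal_mul (by positivity),
      Real.enorm_eq_ofReal_abs, ← ENNReal.ofReal_mul (lineWeight_pos _ _).le]
    refine ENNReal.ofReal_le_ofReal ?_
    have hw := lineWeight_pos m z
    unfold lineKernelFar
    split_ifs with h
    · rw [abs_zero, mul_zero]; positivity
    · push Not at h
      set u := x - β * z with hu
      have hx : x = u + β * z := by rw [hu]; ring
      have h1 : lineWeight m (β * z) ≤ 2 ^ m * β ^ m * lineWeight m z := by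
        have h2 : 1 ≤ β ^ 2 * z ^ 2 := by
          rw [← mul_pow, ← sq_abs]
          exact one_le_pow₀ h.le
        rw [lineWeight_eq_rpow, lineWeight_eq_rpow]
        have e1 : (2 : ℝ) ^ m * β ^ m * (1 + z ^ 2) ^ (m / 2) =
            (4 * β ^ 2 * (1 + z ^ 2)) ^ (m / 2) := by
          rw [Real.mul_rpow (by positivity) (by positivity), Real.mul_rpow (by positivity)
            (by positivity), show (4 : ℝ) = 2 ^ (2 : ℝ) by norm_num, ← Real.rpow_mul zero_le_two,
            ← Real.rpow_natCast β 2, ← Real.rpow_mul hβ0.le]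
          congr 3 <;> (push_cast; ring)
        rw [e1]
        refine Real.rpow_le_rpow (by positivity) ?_ (by linarith)
        nlinarith [sq_nonneg β]
      have h3 : |lineKernel α t x z| ≤ κ * (Real.exp (-b * u ^ 2) * Real.exp (-b * u ^ 2)) := by
        rw [lineKernel_eq]
        refine (heatKernel_le_exp ha0 u).trans ?_
        have : 1 / √a ≤ κ := by rw [hκ]; gcongr
        exact mul_le_mul this (hexp u) (Real.exp_pos _).le hκ0.le
      have h4 : β ^ m = β * β ^ (m - 1) := by
        conv_rhs => rw [← Real.rpow_one β, ← Real.rpow_mul hβ0.le, one_mul,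
          ← Real.rpow_add hβ0]
        congr 1; ring
      calc lineWeight m x * |lineKernel α t x z|
          ≤ (√2 ^ m * (lineWeight m u * (2 ^ m * β ^ m * lineWeight m z))) *
            (κ * (Real.exp (-b * u ^ 2) * Real.exp (-b * u ^ 2))) := by
            have hwx := lineWeight_add_le hm0 u (β * z)
            rw [← hx] at hwx
            have hwu := (lineWeight_pos m u).le
            have : lineWeight m x ≤ √2 ^ m * (lineWeight m u * (2 ^ m * β ^ m * lineWeight m z)) :=
              hwx.trans (mul_le_mul_of_nonneg_left (mul_le_mul_of_nonneg_left h1 hwu)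
                (by positivity))
            exact mul_le_mul this h3 (abs_nonneg _) (by positivity)
        _ = (lineWeight m u * Real.exp (-b * u ^ 2)) *
            (√2 ^ m * κ * 2 ^ m * Real.exp (-b * u ^ 2) * β ^ m * lineWeight m z) := by ring
        _ ≤ C₀ * (√2 ^ m * κ * 2 ^ m * Real.exp (-b * u ^ 2) * β ^ m * lineWeight m z) :=
            mul_le_mul_of_nonneg_right (hC₀b u) (by positivity)
        _ = _ := by rw [h4, hA]; ring
  · simp only [ENNReal.rpow_one]
    refine lintegral_le_ofReal_integral (g := fun z => (A * β * (β ^ (m - 1)) ^ 2) *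
      Real.exp (-b * (x - β * z) ^ 2)) (fun z => ?_)
      ((integrable_exp_neg_mul_sub_sq hb0 hβ0 x).const_mul _) (fun z => by positivity) ?_
    · rw [← ENNReal.ofReal_mul (by positivity)]
      exact ENNReal.ofReal_le_ofReal (le_of_eq (by ring))
    · rw [integral_const_mul, integral_exp_neg_mul_sub_sq hβ0]
      have h5 : (β ^ (m - 1)) ^ 2 * β⁻¹ ≤ 1 := by
        rw [← Real.rpow_natCast, ← Real.rpow_mul hβ0.le, ← Real.rpow_neg_one β,
          ← Real.rpow_add hβ0]
        exact Real.rpow_le_one hβ0.le hβ1 (by push_cast; linarith)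
      calc A * β * (β ^ (m - 1)) ^ 2 * (β⁻¹ * √(Real.pi / b))
          = A * β * √(Real.pi / b) * ((β ^ (m - 1)) ^ 2 * β⁻¹) := by ring
        _ ≤ A * β * √(Real.pi / b) * 1 := by gcongr
        _ = _ := by ring
  · simp only [ENNReal.rpow_one]
    have hi := (integrable_exp_neg_mul_sq (b := b) hb0).comp_sub_right (β * z)
    refine lintegral_le_ofReal_integral (g := fun x => A * β * Real.exp (-b * (x - β * z) ^ 2))
      (fun x => le_rfl) (hi.const_mul _) (fun x => by positivity) ?_
    rw [integral_const_mul, integral_sub_right_eq_self (fun x => Real.exp (-b * x ^ 2)),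
      integral_gaussian]
    exact le_of_eq (by ring)

/-! ### Integral operators on the weighted spaces -/

theorem volume_le_weightedMeasure (p : ℝ≥0∞) {m : ℝ} (hm : 0 ≤ m) :
    (volume : Measure (ℝ × ℝ)) ≤ weightedMeasure p m := by
  conv_lhs => rw [← withDensity_one (μ := (volume : Measure (ℝ × ℝ)))]
  refine withDensity_mono (ae_of_all _ fun x => ?_)
  simpa using one_le_weight_rpow (mul_nonneg hm ENNReal.toReal_nonneg) x

theorem memLp_volume {p : ℝ≥0∞} {m : ℝ} (hm : 0 ≤ m) (f : WLp p m) :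
    MemLp f p (volume : Measure (ℝ × ℝ)) :=
  (Lp.memLp f).mono_measure (volume_le_weightedMeasure p hm)

theorem ae_volume {p : ℝ≥0∞} {m : ℝ} {P : ℝ × ℝ → Prop}
    (h : ∀ᵐ x ∂(weightedMeasure p m), P x) : ∀ᵐ x, P x :=
  (absolutelyContinuous_weightedMeasure p m).ae_le h

theorem ae_weightedMeasure {p : ℝ≥0∞} {m : ℝ} {P : ℝ × ℝ → Prop}
    (h : ∀ᵐ x, P x) : ∀ᵐ x ∂(weightedMeasure p m), P x :=
  (weightedMeasure_absolutelyContinuous p m).ae_le h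

/-- Continuous bounded kernels on the line which are integrable in the second variable. -/
structure NiceKernel (k : ℝ → ℝ → ℝ) : Prop where
  continuous : Continuous fun q : ℝ × ℝ => k q.1 q.2
  integrable : ∀ x, Integrable (k x)
  bounded : ∃ B, ∀ x z, |k x z| ≤ B

theorem NiceKernel.of_le_exp {a β : ℝ} (ha : 0 < a) (hβ : 0 < β) {h : ℝ → ℝ} (hc : Continuous h)
    {κ : ℝ} (hh : ∀ u, |h u| ≤ κ * Real.exp (-(u ^ 2 / (8 * a)))) :
    NiceKernel fun x z => h (x - β * z) where
  continuous := hc.comp (by fun_prop)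
  integrable x := by
    refine Integrable.mono' ((integrable_exp_neg_mul_sub_sq (b := 1 / (8 * a))
      (by positivity) hβ x).const_mul κ)
      (hc.comp (by fun_prop : Continuous fun z : ℝ => x - β * z)).aestronglyMeasurable
      (ae_of_all _ fun z => (hh _).trans (le_of_eq ?_))
    congr 2; ring
  bounded := ⟨|κ|, fun x z => (hh _).trans <| by
    have h1 : Real.exp (-((x - β * z) ^ 2 / (8 * a))) ≤ 1 :=
      Real.exp_le_one_iff.2 (neg_nonpos.2 (by positivity))
    calc κ * Real.exp (-((x - β * z) ^ 2 / (8 * a)))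
        ≤ |κ| * Real.exp (-((x - β * z) ^ 2 / (8 * a))) := by
          gcongr; exact le_abs_self κ
      _ ≤ |κ| := mul_le_of_le_one_right (abs_nonneg _) h1⟩

theorem niceKernel_lineKernel {α t : ℝ} (hα : 0 < α) (ht : 0 < t) :
    NiceKernel (lineKernel α t) := by
  have h := NiceKernel.of_le_exp (aCoeff_pos hα ht) (Real.exp_pos (-α * t / 2))
    (continuous_heatKernel _) (heatKernel_le_exp (aCoeff_pos hα ht))
  have e : lineKernel α t = fun x z => heatKernel (aCoeff α t) (x - Real.exp (-α * t / 2) * z) :=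
    funext fun x => funext fun z => lineKernel_eq α t x z
  rwa [e]

theorem niceKernel_lineKernelD {α t : ℝ} (hα : 0 < α) (ht : 0 < t) :
    NiceKernel (lineKernelD α t) :=
  NiceKernel.of_le_exp (h := fun u => -Real.exp (-α * t / 2) * heatKernelD (aCoeff α t) u)
    (aCoeff_pos hα ht) (Real.exp_pos (-α * t / 2))
    (continuous_const.mul (continuous_heatKernelD _))
    (κ := Real.exp (-α * t / 2) * (1 / aCoeff α t)) fun u => by
      rw [abs_mul, abs_neg, Real.abs_exp, mul_assoc]
      exact mul_le_mul_of_nonneg_left (heatKernelD_le_exp (aCoeff_pos hα ht) u)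
        (Real.exp_pos _).le

/-- The tensor product of two kernels on the line. -/
def tensorKernel (k₁ k₂ : ℝ → ℝ → ℝ) (x z : ℝ × ℝ) : ℝ := k₁ x.1 z.1 * k₂ x.2 z.2

theorem planeKernel_eq (α₁ α₂ t : ℝ) :
    planeKernel α₁ α₂ t = tensorKernel (lineKernel α₁ t) (lineKernel α₂ t) := rfl

theorem planeKernelD₁_eq' (α₁ α₂ t : ℝ) :
    planeKernelD₁ α₁ α₂ t = tensorKernel (lineKernelD α₁ t) (lineKernel α₂ t) :=
  funext fun x => funext fun z => planeKernelD₁_eq α₁ α₂ t x z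

theorem planeKernelD₂_eq' (α₁ α₂ t : ℝ) :
    planeKernelD₂ α₁ α₂ t = tensorKernel (lineKernel α₁ t) (lineKernelD α₂ t) :=
  funext fun x => funext fun z => planeKernelD₂_eq α₁ α₂ t x z

section Tensor

variable {k₁ k₂ : ℝ → ℝ → ℝ}

theorem continuous_tensorKernel (h₁ : NiceKernel k₁) (h₂ : NiceKernel k₂) :
    Continuous fun q : (ℝ × ℝ) × (ℝ × ℝ) => tensorKernel k₁ k₂ q.1 q.2 :=
  (h₁.continuous.comp (by fun_prop :
    Continuous fun q : (ℝ × ℝ) × (ℝ × ℝ) => (q.1.1, q.2.1))).mul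
    (h₂.continuous.comp (by fun_prop :
      Continuous fun q : (ℝ × ℝ) × (ℝ × ℝ) => (q.1.2, q.2.2)))

theorem integrable_tensorKernel (h₁ : NiceKernel k₁) (h₂ : NiceKernel k₂) (x : ℝ × ℝ) :
    Integrable (tensorKernel k₁ k₂ x) :=
  (h₁.integrable x.1).mul_prod (h₂.integrable x.2)

theorem exists_abs_tensorKernel_le (h₁ : NiceKernel k₁) (h₂ : NiceKernel k₂) :
    ∃ B, ∀ x z, |tensorKernel k₁ k₂ x z| ≤ B := by
  obtain ⟨B₁, hB₁⟩ := h₁.bounded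
  obtain ⟨B₂, hB₂⟩ := h₂.bounded
  refine ⟨B₁ * B₂, fun x z => ?_⟩
  rw [tensorKernel, abs_mul]
  exact mul_le_mul (hB₁ _ _) (hB₂ _ _) (abs_nonneg _) ((abs_nonneg _).trans (hB₁ 0 0))

/-- Since `|f| ≤ 1 + |f|^p`, the constant is paired with the integrability of `g` and `|f|^p` with
its boundedness. -/
theorem integrable_mul_of_memLp {X : Type*} [MeasurableSpace X] {μ : Measure X} {p : ℝ≥0∞}
    (hp : 1 ≤ p) (hpt : p ≠ ⊤) {g f : X → ℝ} (hg : Integrable g μ) {B : ℝ} (hB : ∀ x, |g x| ≤ B)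
    (hf : MemLp f p μ) : Integrable (fun x => g x * f x) μ := by
  have hp0 : p ≠ 0 := (zero_lt_one.trans_le hp).ne'
  have hp' : 1 ≤ p.toReal := by
    rw [← ENNReal.toReal_one]; exact (ENNReal.toReal_le_toReal (by simp) hpt).2 hp
  refine Integrable.mono' (hg.norm.add ((hf.integrable_norm_rpow hp0 hpt).const_mul B))
    (hg.1.mul hf.1) (ae_of_all _ fun x => ?_)
  simp only [Pi.add_apply, norm_mul, Real.norm_eq_abs]
  have h1 : |f x| ≤ 1 + |f x| ^ p.toReal := by
    rcases le_total |f x| 1 with h | h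
    · have : 0 ≤ |f x| ^ p.toReal := by positivity
      linarith
    · have := Real.rpow_le_rpow_of_exponent_le h hp'
      rw [Real.rpow_one] at this
      linarith
  have h2 : 0 ≤ |f x| ^ p.toReal := by positivity
  calc |g x| * |f x| ≤ |g x| * (1 + |f x| ^ p.toReal) := by gcongr
    _ = |g x| + |g x| * |f x| ^ p.toReal := by ring
    _ ≤ |g x| + B * |f x| ^ p.toReal := by gcongr; exact hB x

theorem kernelDefined_tensorKernel {p : ℝ≥0∞} {m r : ℝ} (hm : 0 ≤ m) (hp : 1 ≤ p) (hp2 : p ≤ 2)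
    (hr : 0 < r) (hpr : 1 / r + 1 / p.toReal = 3 / 2)
    (h₁ : NiceKernel k₁) (h₂ : NiceKernel k₂) {N₁ N₂ : ℝ}
    (b₁ : LineBound m r k₁ (ENNReal.ofReal N₁)) (b₂ : LineBound m r k₂ (ENNReal.ofReal N₂)) :
    KernelDefined p m (tensorKernel k₁ k₂) := by
  have hpt : p ≠ ⊤ := (hp2.trans_lt (by simp)).ne
  intro f
  constructor
  · intro x
    obtain ⟨B, hB⟩ := exists_abs_tensorKernel_le h₁ h₂
    exact integrable_mul_of_memLp hp hpt (integrable_tensorKernel h₁ h₂ x) (hB x)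
      (memLp_volume hm f)
  · constructor
    · have : StronglyMeasurable fun q : (ℝ × ℝ) × (ℝ × ℝ) => tensorKernel k₁ k₂ q.1 q.2 * f q.2 :=
        (continuous_tensorKernel h₁ h₂).stronglyMeasurable.mul
          ((Lp.stronglyMeasurable f).comp_measurable measurable_snd)
      exact this.integral_prod_right.aestronglyMeasurable
    · refine (eLpNorm_integral_tensor_le hp hp2 hr hpr b₁ b₂
        (Lp.stronglyMeasurable f).measurable).trans_lt ?_
      exact ENNReal.mul_lt_top (ENNReal.mul_lt_top ENNReal.ofReal_lt_top ENNReal.ofReal_lt_top)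
        (Lp.eLpNorm_lt_top f)

end Tensor

theorem coeFn_kernelOp {p : ℝ≥0∞} {m : ℝ} {K : ℝ × ℝ → ℝ × ℝ → ℝ} (h : KernelDefined p m K)
    (f : WLp p m) : (kernelOp K f : WLp 2 m) =ᵐ[volume] fun x => ∫ z, K x z * f z := by
  unfold kernelOp
  rw [dif_pos (h f).2]
  exact ae_volume (h f).2.coeFn_toLp

theorem norm_kernelOp {p : ℝ≥0∞} {m : ℝ} {K : ℝ × ℝ → ℝ × ℝ → ℝ} (h : KernelDefined p m K)
    (f : WLp p m) : ‖(kernelOp K f : WLp 2 m)‖ =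
      (eLpNorm (fun x => ∫ z, K x z * f z) 2 (weightedMeasure 2 m)).toReal := by
  unfold kernelOp
  rw [dif_pos (h f).2, Lp.norm_toLp]

theorem kernelOp_ext {p : ℝ≥0∞} {m : ℝ} {f g : WLp p m} (h : f =ᵐ[volume] g) : f = g :=
  Lp.ext (ae_weightedMeasure h)

theorem kernelOp_add {p : ℝ≥0∞} {m : ℝ} {K : ℝ × ℝ → ℝ × ℝ → ℝ} (h : KernelDefined p m K)
    (f g : WLp p m) : (kernelOp K (f + g) : WLp 2 m) = kernelOp K f + kernelOp K g := by
  apply kernelOp_ext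
  filter_upwards [coeFn_kernelOp h (f + g), coeFn_kernelOp h f, coeFn_kernelOp h g,
    ae_volume (Lp.coeFn_add (kernelOp K f : WLp 2 m) (kernelOp K g))] with x h1 h2 h3 h4
  rw [h1, h4, Pi.add_apply, h2, h3, ← integral_add ((h f).1 x) ((h g).1 x)]
  refine integral_congr_ae ?_
  filter_upwards [ae_volume (Lp.coeFn_add f g)] with z hz
  rw [hz, Pi.add_apply, mul_add]

theorem kernelOp_smul {p : ℝ≥0∞} {m : ℝ} {K : ℝ × ℝ → ℝ × ℝ → ℝ} (h : KernelDefined p m K)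
    (c : ℝ) (f : WLp p m) : (kernelOp K (c • f) : WLp 2 m) = c • kernelOp K f := by
  apply kernelOp_ext
  filter_upwards [coeFn_kernelOp h (c • f), coeFn_kernelOp h f,
    ae_volume (Lp.coeFn_smul c (kernelOp K f : WLp 2 m))] with x h1 h2 h4
  rw [h1, h4, Pi.smul_apply, h2, smul_eq_mul, ← integral_const_mul]
  refine integral_congr_ae ?_
  filter_upwards [ae_volume (Lp.coeFn_smul c f)] with z hz
  rw [hz, Pi.smul_apply, smul_eq_mul]; ring

/-- A bounded integral operator as a continuous linear map (`0` if it is not well defined). -/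
def kernelCLM (p : ℝ≥0∞) [Fact (1 ≤ p)] (m : ℝ) (K : ℝ × ℝ → ℝ × ℝ → ℝ) :
    WLp p m →L[ℝ] WLp 2 m :=
  open Classical in
  if h : KernelDefined p m K ∧ ∃ C, ∀ f : WLp p m, ‖(kernelOp K f : WLp 2 m)‖ ≤ C * ‖f‖ then
    LinearMap.mkContinuousOfExistsBound
      { toFun := fun f => kernelOp K f
        map_add' := kernelOp_add h.1
        map_smul' := kernelOp_smul h.1 } h.2
  else 0

theorem kernelCLM_apply {p : ℝ≥0∞} [Fact (1 ≤ p)] {m : ℝ} {K : ℝ × ℝ → ℝ × ℝ → ℝ}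
    (h : KernelDefined p m K) {C : ℝ} (hC : ∀ f : WLp p m, ‖(kernelOp K f : WLp 2 m)‖ ≤ C * ‖f‖)
    (f : WLp p m) : kernelCLM p m K f = kernelOp K f := by
  unfold kernelCLM
  rw [dif_pos ⟨h, C, hC⟩]
  rfl

theorem norm_kernelOp_tensorKernel_le {p : ℝ≥0∞} {m r : ℝ} (hm : 0 ≤ m) (hp : 1 ≤ p)
    (hp2 : p ≤ 2) (hr : 0 < r) (hpr : 1 / r + 1 / p.toReal = 3 / 2) {k₁ k₂ : ℝ → ℝ → ℝ}
    (h₁ : NiceKernel k₁) (h₂ : NiceKernel k₂) {N₁ N₂ : ℝ} (hN₁ : 0 ≤ N₁) (hN₂ : 0 ≤ N₂)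
    (b₁ : LineBound m r k₁ (ENNReal.ofReal N₁)) (b₂ : LineBound m r k₂ (ENNReal.ofReal N₂))
    (f : WLp p m) :
    ‖(kernelOp (tensorKernel k₁ k₂) f : WLp 2 m)‖ ≤ N₁ * N₂ * ‖f‖ := by
  rw [norm_kernelOp (kernelDefined_tensorKernel hm hp hp2 hr hpr h₁ h₂ b₁ b₂), Lp.norm_def]
  have h := eLpNorm_integral_tensor_le hp hp2 hr hpr b₁ b₂ (Lp.stronglyMeasurable f).measurable
  have h2 := ENNReal.toReal_mono (ENNReal.mul_ne_top (ENNReal.mul_ne_top ENNReal.ofReal_ne_top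
    ENNReal.ofReal_ne_top) (Lp.eLpNorm_ne_top f)) h
  rwa [ENNReal.toReal_mul, ENNReal.toReal_mul, ENNReal.toReal_ofReal hN₁,
    ENNReal.toReal_ofReal hN₂] at h2

section Tensor

variable {p : ℝ≥0∞} [hp : Fact (1 ≤ p)] {m r : ℝ} {k₁ k₂ : ℝ → ℝ → ℝ} {N₁ N₂ : ℝ}

theorem kernelCLM_tensorKernel_apply (hm : 0 ≤ m)
    (hp2 : p ≤ 2) (hr : 0 < r) (hpr : 1 / r + 1 / p.toReal = 3 / 2)
    (h₁ : NiceKernel k₁) (h₂ : NiceKernel k₂) (hN₁ : 0 ≤ N₁) (hN₂ : 0 ≤ N₂)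
    (b₁ : LineBound m r k₁ (ENNReal.ofReal N₁)) (b₂ : LineBound m r k₂ (ENNReal.ofReal N₂))
    (f : WLp p m) :
    kernelCLM p m (tensorKernel k₁ k₂) f = kernelOp (tensorKernel k₁ k₂) f :=
  kernelCLM_apply (kernelDefined_tensorKernel hm hp.out hp2 hr hpr h₁ h₂ b₁ b₂)
    (norm_kernelOp_tensorKernel_le hm hp.out hp2 hr hpr h₁ h₂ hN₁ hN₂ b₁ b₂) f

theorem norm_kernelCLM_tensorKernel_le (hm : 0 ≤ m)
    (hp2 : p ≤ 2) (hr : 0 < r) (hpr : 1 / r + 1 / p.toReal = 3 / 2)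
    (h₁ : NiceKernel k₁) (h₂ : NiceKernel k₂) (hN₁ : 0 ≤ N₁) (hN₂ : 0 ≤ N₂)
    (b₁ : LineBound m r k₁ (ENNReal.ofReal N₁)) (b₂ : LineBound m r k₂ (ENNReal.ofReal N₂)) :
    ‖kernelCLM p m (tensorKernel k₁ k₂)‖ ≤ N₁ * N₂ :=
  ContinuousLinearMap.opNorm_le_bound _ (by positivity) fun f => by
    rw [kernelCLM_tensorKernel_apply hm hp2 hr hpr h₁ h₂ hN₁ hN₂ b₁ b₂]
    exact norm_kernelOp_tensorKernel_le hm hp.out hp2 hr hpr h₁ h₂ hN₁ hN₂ b₁ b₂ f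

end Tensor

/-! ### The planar semigroup -/

/-- For `p = 2` the Schur exponent is `r = 1` and the power of `aCoeff` is zero, so there is no
singularity at `t = 0`. -/
theorem lineBound_two (α m : ℝ) (hα : 0 < α) (hm : 0 ≤ m) (T : ℝ) :
    ∃ C, 0 < C ∧ ∀ t, 0 < t → (t ≤ T ∨ 1 / 2 < m) →
      LineBound m 1 (lineKernel α t) (ENNReal.ofReal C) := by
  obtain ⟨C, hC, h⟩ := exists_lineBound_lineKernel hα hm one_le_two le_rfl one_pos
    (by norm_num : (1 : ℝ) / 1 + 1 / 2 = 3 / 2) T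
  refine ⟨C, hC, fun t ht htT => ?_⟩
  have := (h t ht htT).1
  rwa [show (1 : ℝ) / (2 * 2) - 1 / 4 = 0 by norm_num, Real.rpow_zero, div_one] at this

section Plane

variable {α₁ α₂ m : ℝ}

theorem kernelDefined_planeKernel (h₁ : 0 < α₁) (h₂ : 0 < α₂) (hm : 0 ≤ m) {t : ℝ} (ht : 0 < t) :
    KernelDefined 2 m (planeKernel α₁ α₂ t) := by
  obtain ⟨C₁, hC₁, b₁⟩ := lineBound_two α₁ m h₁ hm t
  obtain ⟨C₂, hC₂, b₂⟩ := lineBound_two α₂ m h₂ hm t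
  exact kernelDefined_tensorKernel hm one_le_two le_rfl one_pos (by norm_num)
    (niceKernel_lineKernel h₁ ht) (niceKernel_lineKernel h₂ ht) (b₁ t ht (Or.inl le_rfl))
    (b₂ t ht (Or.inl le_rfl))

variable (α₁ α₂ m) in
/-- The semigroup `E_t` in the plane. -/
def planeSemigroup (t : ℝ) : WLp 2 m →L[ℝ] WLp 2 m :=
  if t = 0 then ContinuousLinearMap.id ℝ _ else kernelCLM 2 m (planeKernel α₁ α₂ t)

@[simp] theorem planeSemigroup_zero :
    planeSemigroup α₁ α₂ m 0 = ContinuousLinearMap.id ℝ (WLp 2 m) := if_pos rfl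

theorem planeSemigroup_apply (h₁ : 0 < α₁) (h₂ : 0 < α₂) (hm : 0 ≤ m) {t : ℝ} (ht : 0 < t)
    (f : WLp 2 m) : planeSemigroup α₁ α₂ m t f = kernelOp (planeKernel α₁ α₂ t) f := by
  obtain ⟨C₁, hC₁, b₁⟩ := lineBound_two α₁ m h₁ hm t
  obtain ⟨C₂, hC₂, b₂⟩ := lineBound_two α₂ m h₂ hm t
  rw [planeSemigroup, if_neg ht.ne']
  exact kernelCLM_tensorKernel_apply hm le_rfl one_pos (by norm_num)
    (niceKernel_lineKernel h₁ ht) (niceKernel_lineKernel h₂ ht) hC₁.le hC₂.le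
    (b₁ t ht (Or.inl le_rfl)) (b₂ t ht (Or.inl le_rfl)) f

theorem exists_norm_planeSemigroup_le (h₁ : 0 < α₁) (h₂ : 0 < α₂) (hm : 0 ≤ m) (T : ℝ) :
    ∃ C, 0 < C ∧ ∀ t, 0 ≤ t → (t ≤ T ∨ 1 / 2 < m) → ‖planeSemigroup α₁ α₂ m t‖ ≤ C := by
  obtain ⟨C₁, hC₁, b₁⟩ := lineBound_two α₁ m h₁ hm T
  obtain ⟨C₂, hC₂, b₂⟩ := lineBound_two α₂ m h₂ hm T
  refine ⟨max (C₁ * C₂) 1, by positivity, fun t ht htT => ?_⟩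
  rcases ht.eq_or_lt with rfl | ht
  · rw [planeSemigroup_zero]
    exact ContinuousLinearMap.norm_id_le.trans (le_max_right _ _)
  · rw [planeSemigroup, if_neg ht.ne']
    exact (norm_kernelCLM_tensorKernel_le hm le_rfl one_pos (by norm_num)
      (niceKernel_lineKernel h₁ ht) (niceKernel_lineKernel h₂ ht) hC₁.le hC₂.le
      (b₁ t ht htT) (b₂ t ht htT)).trans (le_max_left _ _)

theorem planeKernel_nonneg (t : ℝ) (x z : ℝ × ℝ) : 0 ≤ planeKernel α₁ α₂ t x z :=
  mul_nonneg (lineKernel_nonneg _ _ _ _) (lineKernel_nonneg _ _ _ _)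

theorem integral_planeKernel_mul (h₁ : 0 < α₁) (h₂ : 0 < α₂) {s t : ℝ} (hs : 0 < s) (ht : 0 < t)
    (x z : ℝ × ℝ) :
    ∫ w, planeKernel α₁ α₂ s x w * planeKernel α₁ α₂ t w z = planeKernel α₁ α₂ (s + t) x z := by
  have e : ∀ w : ℝ × ℝ, planeKernel α₁ α₂ s x w * planeKernel α₁ α₂ t w z =
      (lineKernel α₁ s x.1 w.1 * lineKernel α₁ t w.1 z.1) *
        (lineKernel α₂ s x.2 w.2 * lineKernel α₂ t w.2 z.2) := by
    intro w; simp only [planeKernel]; ring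
  simp_rw [e]
  rw [Measure.volume_eq_prod, integral_prod_mul
    (f := fun w => lineKernel α₁ s x.1 w * lineKernel α₁ t w z.1)
    (g := fun w => lineKernel α₂ s x.2 w * lineKernel α₂ t w z.2),
    integral_lineKernel_mul_lineKernel h₁ hs ht, integral_lineKernel_mul_lineKernel h₂ hs ht]
  rfl

theorem integrable_planeKernel_mul (h₁ : 0 < α₁) (h₂ : 0 < α₂) {s t : ℝ} (hs : 0 < s) (ht : 0 < t)
    (x z : ℝ × ℝ) :
    Integrable fun w => planeKernel α₁ α₂ s x w * planeKernel α₁ α₂ t w z := by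
  have h := (integrable_lineKernel_mul_lineKernel h₁ hs ht x.1 z.1).mul_prod
    (integrable_lineKernel_mul_lineKernel h₂ hs ht x.2 z.2)
  refine h.congr (ae_of_all _ fun w => ?_)
  simp only [planeKernel]; ring

theorem continuous_planeKernel (h₁ : 0 < α₁) (h₂ : 0 < α₂) {t : ℝ} (ht : 0 < t) :
    Continuous fun q : (ℝ × ℝ) × (ℝ × ℝ) => planeKernel α₁ α₂ t q.1 q.2 :=
  continuous_tensorKernel (niceKernel_lineKernel h₁ ht) (niceKernel_lineKernel h₂ ht)

/-- The Chapman–Kolmogorov identity, pointwise. -/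
theorem integral_planeKernel_mul_planeSemigroup (h₁ : 0 < α₁) (h₂ : 0 < α₂) (hm : 0 ≤ m) {s t : ℝ}
    (hs : 0 < s) (ht : 0 < t) (f : WLp 2 m) (x : ℝ × ℝ) :
    ∫ w, planeKernel α₁ α₂ s x w * planeSemigroup α₁ α₂ m t f w =
      ∫ z, planeKernel α₁ α₂ (s + t) x z * f z := by
  have hst : 0 < s + t := by positivity
  have hK := kernelDefined_planeKernel h₁ h₂ hm ht
  have e1 : ∫ w, planeKernel α₁ α₂ s x w * planeSemigroup α₁ α₂ m t f w =
      ∫ w, ∫ z, planeKernel α₁ α₂ s x w * planeKernel α₁ α₂ t w z * f z := by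
    refine integral_congr_ae ?_
    filter_upwards [coeFn_kernelOp hK f] with w hw
    rw [planeSemigroup_apply h₁ h₂ hm ht, hw, ← integral_const_mul]
    simp_rw [mul_assoc]
  have hmeas : AEStronglyMeasurable (Function.uncurry fun w z : ℝ × ℝ =>
      planeKernel α₁ α₂ s x w * planeKernel α₁ α₂ t w z * f z)
      ((volume : Measure (ℝ × ℝ)).prod volume) := by
    refine StronglyMeasurable.aestronglyMeasurable ?_
    have c1 : Continuous fun q : (ℝ × ℝ) × (ℝ × ℝ) => planeKernel α₁ α₂ s x q.1 :=
      (continuous_planeKernel h₁ h₂ hs).comp (by fun_prop :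
        Continuous fun q : (ℝ × ℝ) × (ℝ × ℝ) => (x, q.1))
    exact (c1.mul (continuous_planeKernel h₁ h₂ ht)).stronglyMeasurable.mul
      ((Lp.stronglyMeasurable f).comp_measurable measurable_snd)
  -- The kernels are nonnegative, so integrating the norm first in `w` gives `K_{s+t}(x,z)|f(z)|`,
  -- already known to be integrable in `z`.
  have hint : Integrable (Function.uncurry fun w z : ℝ × ℝ =>
      planeKernel α₁ α₂ s x w * planeKernel α₁ α₂ t w z * f z)
      ((volume : Measure (ℝ × ℝ)).prod volume) := by
    rw [integrable_prod_iff' hmeas]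
    constructor
    · exact ae_of_all _ fun z => (integrable_planeKernel_mul h₁ h₂ hs ht x z).mul_const (f z)
    · have h := ((kernelDefined_planeKernel h₁ h₂ hm hst f).1 x).norm
      refine h.congr (ae_of_all _ fun z => ?_)
      simp only [Function.uncurry, norm_mul, Real.norm_eq_abs, abs_of_nonneg (planeKernel_nonneg _ _ _)]
      rw [integral_mul_const, integral_planeKernel_mul h₁ h₂ hs ht]
  rw [e1, integral_integral_swap hint]
  refine integral_congr_ae (ae_of_all _ fun z => ?_)
  simp only
  rw [integral_mul_const, integral_planeKernel_mul h₁ h₂ hs ht]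

theorem planeSemigroup_add (h₁ : 0 < α₁) (h₂ : 0 < α₂) (hm : 0 ≤ m) {s t : ℝ}
    (hs : 0 ≤ s) (ht : 0 ≤ t) :
    planeSemigroup α₁ α₂ m (s + t) =
      (planeSemigroup α₁ α₂ m s).comp (planeSemigroup α₁ α₂ m t) := by
  rcases hs.eq_or_lt with rfl | hs
  · rw [zero_add, planeSemigroup_zero]; rfl
  rcases ht.eq_or_lt with rfl | ht
  · rw [add_zero, planeSemigroup_zero]; rfl
  have hst : 0 < s + t := by positivity
  ext1 f
  rw [ContinuousLinearMap.comp_apply]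
  apply kernelOp_ext
  rw [planeSemigroup_apply h₁ h₂ hm hst, planeSemigroup_apply h₁ h₂ hm hs]
  filter_upwards [coeFn_kernelOp (kernelDefined_planeKernel h₁ h₂ hm hst) f,
    coeFn_kernelOp (kernelDefined_planeKernel h₁ h₂ hm hs) (planeSemigroup α₁ α₂ m t f)]
    with x hx1 hx2
  rw [hx1, hx2, integral_planeKernel_mul_planeSemigroup h₁ h₂ hm hs ht]

end Plane

/-! ### Decay on functions with zero mean -/

theorem LineBound.mono {m r : ℝ} (hr : 0 ≤ r) {k : ℝ → ℝ → ℝ} {N N' : ℝ≥0∞}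
    (h : LineBound m r k N) (hN : N ≤ N') : LineBound m r k N' := by
  obtain ⟨H, G, h1, h2, h3, h4, h5⟩ := h
  exact ⟨H, G, h1, h2, h3, fun x => (h4 x).trans (ENNReal.rpow_le_rpow hN hr),
    fun z => (h5 z).trans (ENNReal.rpow_le_rpow hN hr)⟩

/-- The integral operator with bounded kernel `K` has norm at most `N` on `L¹ ∩ L²(m)`. -/
structure PlaneBound (m : ℝ) (K : ℝ × ℝ → ℝ × ℝ → ℝ) (N : ℝ≥0∞) : Prop where
  measurable : Measurable (Function.uncurry K)
  bounded : ∃ B, ∀ x z, |K x z| ≤ B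
  bound : ∀ f : ℝ × ℝ → ℝ, Measurable f → Integrable f →
    eLpNorm (fun x => ∫ z, K x z * f z) 2 (weightedMeasure 2 m) ≤
      N * eLpNorm f 2 (weightedMeasure 2 m)

namespace PlaneBound

variable {m : ℝ} {K K' : ℝ × ℝ → ℝ × ℝ → ℝ} {N N' : ℝ≥0∞}

theorem integrable (h : PlaneBound m K N) {f : ℝ × ℝ → ℝ} (hf : Integrable f) (x : ℝ × ℝ) :
    Integrable fun z => K x z * f z := by
  obtain ⟨B, hB⟩ := h.bounded
  exact hf.bdd_mul (h.measurable.comp measurable_prodMk_left).aestronglyMeasurable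
    (ae_of_all _ fun z => hB x z)

theorem aestronglyMeasurable (h : PlaneBound m K N) {f : ℝ × ℝ → ℝ} (hf : Measurable f) :
    AEStronglyMeasurable (fun x => ∫ z, K x z * f z) (weightedMeasure 2 m) := by
  have : StronglyMeasurable fun q : (ℝ × ℝ) × (ℝ × ℝ) => K q.1 q.2 * f q.2 :=
    (h.measurable.mul (hf.comp measurable_snd)).stronglyMeasurable
  exact this.integral_prod_right.aestronglyMeasurable

theorem add (h : PlaneBound m K N) (h' : PlaneBound m K' N') :
    PlaneBound m (fun x z => K x z + K' x z) (N + N') where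
  measurable := h.measurable.add h'.measurable
  bounded := by
    obtain ⟨B, hB⟩ := h.bounded
    obtain ⟨B', hB'⟩ := h'.bounded
    exact ⟨B + B', fun x z => (abs_add_le _ _).trans (add_le_add (hB x z) (hB' x z))⟩
  bound f hf hfi := by
    have e : (fun x => ∫ z, (K x z + K' x z) * f z) =
        (fun x => ∫ z, K x z * f z) + fun x => ∫ z, K' x z * f z := by
      funext x
      simp_rw [add_mul]
      exact integral_add (h.integrable hfi x) (h'.integrable hfi x)
    rw [e, add_mul]
    exact (eLpNorm_add_le (h.aestronglyMeasurable hf) (h'.aestronglyMeasurable hf)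
      one_le_two).trans (add_le_add (h.bound f hf hfi) (h'.bound f hf hfi))

theorem neg (h : PlaneBound m K N) : PlaneBound m (fun x z => -K x z) N where
  measurable := h.measurable.neg
  bounded := by
    obtain ⟨B, hB⟩ := h.bounded
    exact ⟨B, fun x z => by rw [abs_neg]; exact hB x z⟩
  bound f hf hfi := by
    have e : (fun x => ∫ z, -K x z * f z) = -fun x => ∫ z, K x z * f z := by
      funext x
      simp_rw [neg_mul]
      exact integral_neg _
    rw [e, eLpNorm_neg]
    exact h.bound f hf hfi

theorem mono (h : PlaneBound m K N) (hN : N ≤ N') : PlaneBound m K N' :=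
  ⟨h.measurable, h.bounded, fun f hf hfi => (h.bound f hf hfi).trans (mul_le_mul_left hN _)⟩

theorem tensor {k₁ k₂ : ℝ → ℝ → ℝ} {N₁ N₂ : ℝ≥0∞}
    (m₁ : Measurable (Function.uncurry k₁)) (m₂ : Measurable (Function.uncurry k₂))
    (d₁ : ∃ B, ∀ x z, |k₁ x z| ≤ B) (d₂ : ∃ B, ∀ x z, |k₂ x z| ≤ B)
    (b₁ : LineBound m 1 k₁ N₁) (b₂ : LineBound m 1 k₂ N₂) :
    PlaneBound m (tensorKernel k₁ k₂) (N₁ * N₂) where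
  measurable := (m₁.comp (by fun_prop :
      Measurable fun q : (ℝ × ℝ) × (ℝ × ℝ) => (q.1.1, q.2.1))).mul
    (m₂.comp (by fun_prop : Measurable fun q : (ℝ × ℝ) × (ℝ × ℝ) => (q.1.2, q.2.2)))
  bounded := by
    obtain ⟨B₁, hB₁⟩ := d₁
    obtain ⟨B₂, hB₂⟩ := d₂
    refine ⟨B₁ * B₂, fun x z => ?_⟩
    rw [tensorKernel, abs_mul]
    exact mul_le_mul (hB₁ _ _) (hB₂ _ _) (abs_nonneg _) ((abs_nonneg _).trans (hB₁ 0 0))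
  bound f hf _ := eLpNorm_integral_tensor_le one_le_two le_rfl one_pos (by norm_num) b₁ b₂ hf

end PlaneBound

/-! ### Measurability and boundedness of the near and far kernels -/

theorem measurable_ite_near {α t : ℝ} : MeasurableSet
    {q : ℝ × ℝ | |Real.exp (-α * t / 2) * q.2| ≤ 1} :=
  (isClosed_le (by fun_prop) continuous_const).measurableSet

theorem measurable_lineKernelFar (α t : ℝ) : Measurable (Function.uncurry (lineKernelFar α t)) :=
  Measurable.ite measurable_ite_near measurable_const (continuous_lineKernel α t).measurable

theorem measurable_lineKernelNear (α t : ℝ) : Measurable (Function.uncurry (lineKernelNear α t)) :=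
  (Measurable.ite measurable_ite_near (continuous_lineKernel α t).measurable
    measurable_const).sub ((continuous_lineKernel α t).comp
      (by fun_prop : Continuous fun q : ℝ × ℝ => (q.1, (0 : ℝ)))).measurable

theorem bounded_lineKernelFar {α t : ℝ} (hα : 0 < α) (ht : 0 < t) :
    ∃ B, ∀ x z, |lineKernelFar α t x z| ≤ B := by
  obtain ⟨B, hB⟩ := (niceKernel_lineKernel hα ht).bounded
  refine ⟨B, fun x z => ?_⟩
  unfold lineKernelFar
  split_ifs
  · rw [abs_zero]; exact (abs_nonneg _).trans (hB x z)
  · exact hB x z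

theorem bounded_lineKernelNear {α t : ℝ} (hα : 0 < α) (ht : 0 < t) :
    ∃ B, ∀ x z, |lineKernelNear α t x z| ≤ B := by
  obtain ⟨B, hB⟩ := (niceKernel_lineKernel hα ht).bounded
  refine ⟨B + B, fun x z => ?_⟩
  unfold lineKernelNear
  refine (abs_sub _ _).trans (add_le_add ?_ (hB x 0))
  split_ifs
  · exact hB x z
  · rw [abs_zero]; exact (abs_nonneg _).trans (hB x z)

/-- Cauchy–Schwarz for `f = b^{-m} · (b^m f)`, where `b^{-m}` is in `L²` of the plane because `2m >
1`. -/
theorem integrable_of_half_lt {m : ℝ} (hm : 1 / 2 < m) (f : WLp 2 m) :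
    Integrable (f : ℝ × ℝ → ℝ) := by
  have hw : MemLp (fun x : ℝ × ℝ => weight x ^ m * f x) 2 volume := by
    constructor
    · exact (continuous_weight_rpow m).aestronglyMeasurable.mul
        (Lp.stronglyMeasurable f).aestronglyMeasurable
    · have h := Lp.eLpNorm_lt_top f
      rw [eLpNorm_weightedMeasure two_ne_zero (by simp)] at h
      rw [eLpNorm_eq_lintegral_rpow_enorm_toReal two_ne_zero (by simp)]
      refine lt_of_eq_of_lt ?_ h
      congr 2
      funext x
      rw [enorm_mul, Real.enorm_of_nonneg (Real.rpow_nonneg (weight_pos x).le _)]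
  have hv : MemLp (fun x : ℝ × ℝ => weight x ^ (-m)) 2 volume := by
    rw [memLp_two_iff_integrable_sq (continuous_weight_rpow _).aestronglyMeasurable]
    have h := (integrable_lineWeight (s := 2 * m) (by linarith)).mul_prod
      (integrable_lineWeight (s := 2 * m) (by linarith))
    refine h.congr (ae_of_all _ fun x => ?_)
    simp only
    rw [weight_rpow, mul_pow, lineWeight_sq, lineWeight_sq, mul_neg]
  refine (hv.integrable_mul hw).congr (ae_of_all _ fun x => ?_)
  simp only [Pi.mul_apply]
  rw [← mul_assoc, ← Real.rpow_add (weight_pos x), neg_add_cancel, Real.rpow_zero, one_mul]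

/-- With `dᵢ = kᵢ(x,z) - kᵢ(x,0)`, the difference of products is `d₁k₂ + k₁d₂ - d₁d₂`. Splitting
each `dᵢ` into near and far parts gives eight tensor kernels, each with at least one factor of size
`O(β)`. As `α₂ ≤ α₁`, the slower rate is `e^{-α₂t/2}`. -/
theorem exists_planeBound_sub {α₁ α₂ m : ℝ} (hα₂ : 0 < α₂) (hα : α₂ ≤ α₁) (hm : 3 / 2 < m) :
    ∃ C, 0 < C ∧ ∀ t, 1 ≤ t → PlaneBound m
      (fun x z => planeKernel α₁ α₂ t x z - planeKernel α₁ α₂ t x 0)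
      (ENNReal.ofReal (C * Real.exp (-(α₂ / 2) * t))) := by
  have hα₁ : 0 < α₁ := by linarith
  obtain ⟨A₁, hA₁, a₁⟩ := lineBound_two α₁ m hα₁ (by linarith) 1
  obtain ⟨A₂, hA₂, a₂⟩ := lineBound_two α₂ m hα₂ (by linarith) 1
  obtain ⟨B₁, hB₁, b₁⟩ := exists_lineBound_lineKernelNear hα₁ hm
  obtain ⟨B₂, hB₂, b₂⟩ := exists_lineBound_lineKernelNear hα₂ hm
  obtain ⟨D₁, hD₁, d₁⟩ := exists_lineBound_lineKernelFar hα₁ hm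
  obtain ⟨D₂, hD₂, d₂⟩ := exists_lineBound_lineKernelFar hα₂ hm
  set C := A₁ + A₂ + B₁ + B₂ + D₁ + D₂ with hC
  have hC0 : 0 < C := by positivity
  -- Eight terms, each bounded by `C²β`.
  refine ⟨8 * C ^ 2, by positivity, fun t ht => ?_⟩
  have ht0 : 0 < t := by linarith
  set β := Real.exp (-(α₂ / 2) * t) with hβ
  have hβ0 : 0 < β := Real.exp_pos _
  have hβ1 : β ≤ 1 := Real.exp_le_one_iff.2 (by nlinarith)
  have e2 : Real.exp (-α₂ * t / 2) = β := by rw [hβ]; congr 1; ring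
  have e1 : Real.exp (-α₁ * t / 2) ≤ β := by rw [hβ]; apply Real.exp_le_exp.2; nlinarith
  have low : ∀ {k : ℝ → ℝ → ℝ} {c : ℝ}, c ≤ C → LineBound m 1 k (ENNReal.ofReal c) →
      LineBound m 1 k (ENNReal.ofReal C) := fun hc h =>
    h.mono zero_le_one (ENNReal.ofReal_le_ofReal hc)
  have high : ∀ {k : ℝ → ℝ → ℝ} {c e : ℝ}, 0 < c → c ≤ C → e ≤ β →
      LineBound m 1 k (ENNReal.ofReal (c * e)) →
      LineBound m 1 k (ENNReal.ofReal (C * β)) := fun hc0 hc he h =>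
    h.mono zero_le_one (ENNReal.ofReal_le_ofReal (by nlinarith))
  have k₁ := low (by linarith) (a₁ t ht0 (Or.inr (by linarith)))
  have k₂ := low (by linarith) (a₂ t ht0 (Or.inr (by linarith)))
  have n₁ := high hB₁ (by linarith) e1 (b₁ t ht)
  have n₂ := high hB₂ (by linarith) e2.le (b₂ t ht)
  have f₁ := high hD₁ (by linarith) e1 (d₁ t ht)
  have f₂ := high hD₂ (by linarith) e2.le (d₂ t ht)
  have mk₁ : Measurable (Function.uncurry (lineKernel α₁ t)) :=
    (continuous_lineKernel α₁ t).measurable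
  have mk₂ : Measurable (Function.uncurry (lineKernel α₂ t)) :=
    (continuous_lineKernel α₂ t).measurable
  have bk₁ := (niceKernel_lineKernel hα₁ ht0).bounded
  have bk₂ := (niceKernel_lineKernel hα₂ ht0).bounded
  set N := ENNReal.ofReal (C ^ 2 * β) with hN
  have le1 : ENNReal.ofReal (C * β) * ENNReal.ofReal C ≤ N := by
    rw [← ENNReal.ofReal_mul (by positivity)]; exact ENNReal.ofReal_le_ofReal (by nlinarith)
  have le2 : ENNReal.ofReal C * ENNReal.ofReal (C * β) ≤ N := by rwa [mul_comm]
  have le3 : ENNReal.ofReal (C * β) * ENNReal.ofReal (C * β) ≤ N := by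
    refine le_trans (mul_le_mul_right (ENNReal.ofReal_le_ofReal ?_) _) le1
    exact mul_le_of_le_one_right hC0.le hβ1
  have P1 := (PlaneBound.tensor (measurable_lineKernelNear α₁ t) mk₂
    (bounded_lineKernelNear hα₁ ht0) bk₂ n₁ k₂).mono le1
  have P2 := (PlaneBound.tensor (measurable_lineKernelFar α₁ t) mk₂
    (bounded_lineKernelFar hα₁ ht0) bk₂ f₁ k₂).mono le1
  have P3 := (PlaneBound.tensor mk₁ (measurable_lineKernelNear α₂ t)
    bk₁ (bounded_lineKernelNear hα₂ ht0) k₁ n₂).mono le2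
  have P4 := (PlaneBound.tensor mk₁ (measurable_lineKernelFar α₂ t)
    bk₁ (bounded_lineKernelFar hα₂ ht0) k₁ f₂).mono le2
  have P5 := ((PlaneBound.tensor (measurable_lineKernelNear α₁ t) (measurable_lineKernelNear α₂ t)
    (bounded_lineKernelNear hα₁ ht0) (bounded_lineKernelNear hα₂ ht0) n₁ n₂).mono le3).neg
  have P6 := ((PlaneBound.tensor (measurable_lineKernelNear α₁ t) (measurable_lineKernelFar α₂ t)
    (bounded_lineKernelNear hα₁ ht0) (bounded_lineKernelFar hα₂ ht0) n₁ f₂).mono le3).neg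
  have P7 := ((PlaneBound.tensor (measurable_lineKernelFar α₁ t) (measurable_lineKernelNear α₂ t)
    (bounded_lineKernelFar hα₁ ht0) (bounded_lineKernelNear hα₂ ht0) f₁ n₂).mono le3).neg
  have P8 := ((PlaneBound.tensor (measurable_lineKernelFar α₁ t) (measurable_lineKernelFar α₂ t)
    (bounded_lineKernelFar hα₁ ht0) (bounded_lineKernelFar hα₂ ht0) f₁ f₂).mono le3).neg
  have P := ((P1.add P2).add (P3.add P4)).add ((P5.add P6).add (P7.add P8))
  have hsum : N + N + (N + N) + (N + N + (N + N)) = ENNReal.ofReal (8 * C ^ 2 * β) := by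
    rw [hN, ← ENNReal.ofReal_add (by positivity) (by positivity),
      ← ENNReal.ofReal_add (by positivity) (by positivity),
      ← ENNReal.ofReal_add (by positivity) (by positivity)]
    congr 1; ring
  rw [hsum] at P
  convert P using 3 with x z
  have q1 := lineKernelNear_add_lineKernelFar α₁ t x.1 z.1
  have q2 := lineKernelNear_add_lineKernelFar α₂ t x.2 z.2
  have e3 : lineKernel α₁ t x.1 0 =
      lineKernel α₁ t x.1 z.1 - (lineKernelNear α₁ t x.1 z.1 + lineKernelFar α₁ t x.1 z.1) := by
    rw [q1]; ring
  have e4 : lineKernel α₂ t x.2 0 =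
      lineKernel α₂ t x.2 z.2 - (lineKernelNear α₂ t x.2 z.2 + lineKernelFar α₂ t x.2 z.2) := by
    rw [q2]; ring
  simp only [planeKernel, tensorKernel, Prod.fst_zero, Prod.snd_zero]
  rw [e3, e4]; ring

/-- Exponential decay of `E_t` on functions with zero mean. -/
theorem exists_norm_planeSemigroup_le_of_zero_mean {α₁ α₂ m : ℝ} (hα₂ : 0 < α₂) (hα : α₂ ≤ α₁)
    (hm : 3 / 2 < m) :
    ∃ C, 0 < C ∧ ∀ t, 0 ≤ t → ∀ f : WLp 2 m, ∫ z, f z = 0 →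
      ‖planeSemigroup α₁ α₂ m t f‖ ≤ C * Real.exp (-(α₂ / 2) * t) * ‖f‖ := by
  have hα₁ : 0 < α₁ := by linarith
  have hm0 : 0 ≤ m := by linarith
  obtain ⟨A, hA, a⟩ := exists_norm_planeSemigroup_le hα₁ hα₂ hm0 1
  obtain ⟨C, hC, h⟩ := exists_planeBound_sub hα₂ hα hm
  -- The second summand covers `t ≤ 1`, where `e^{α₂/2} e^{-α₂t/2} ≥ 1`.
  refine ⟨C + A * Real.exp (α₂ / 2), by positivity, fun t ht f hf => ?_⟩
  have hE : 0 < Real.exp (-(α₂ / 2) * t) := Real.exp_pos _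
  rcases le_total t 1 with h1 | h1
  · have h2 : 1 ≤ Real.exp (α₂ / 2) * Real.exp (-(α₂ / 2) * t) := by
      rw [← Real.exp_add]; exact Real.one_le_exp (by nlinarith)
    calc ‖planeSemigroup α₁ α₂ m t f‖ ≤ A * ‖f‖ :=
          (planeSemigroup α₁ α₂ m t).le_of_opNorm_le (a t ht (Or.inl h1)) f
      _ ≤ A * ‖f‖ * (Real.exp (α₂ / 2) * Real.exp (-(α₂ / 2) * t)) :=
          le_mul_of_one_le_right (by positivity) h2
      _ ≤ A * ‖f‖ * (Real.exp (α₂ / 2) * Real.exp (-(α₂ / 2) * t)) +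
          C * Real.exp (-(α₂ / 2) * t) * ‖f‖ := le_add_of_nonneg_right (by positivity)
      _ = _ := by ring
  · have ht0 : 0 < t := by linarith
    have hP := h t h1
    have hfi := integrable_of_half_lt (by linarith) f
    rw [planeSemigroup_apply hα₁ hα₂ hm0 ht0, norm_kernelOp (kernelDefined_planeKernel hα₁ hα₂ hm0 ht0)]
    -- Zero mean makes the subtracted term `K_t(x,0) ∫ f` vanish.
    have e : (fun x => ∫ z, planeKernel α₁ α₂ t x z * f z) = fun x =>
        ∫ z, (planeKernel α₁ α₂ t x z - planeKernel α₁ α₂ t x 0) * f z := by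
      funext x
      simp_rw [sub_mul]
      rw [integral_sub ((kernelDefined_planeKernel hα₁ hα₂ hm0 ht0 f).1 x) (hfi.const_mul _),
        integral_const_mul, hf, mul_zero, sub_zero]
    rw [e]
    have h2 := ENNReal.toReal_mono (ENNReal.mul_ne_top ENNReal.ofReal_ne_top
      (Lp.eLpNorm_ne_top f)) (hP.bound f (Lp.stronglyMeasurable f).measurable hfi)
    rw [ENNReal.toReal_mul, ENNReal.toReal_ofReal (by positivity), ← Lp.norm_def] at h2
    refine h2.trans ?_
    gcongr
    exact le_add_of_nonneg_right (by positivity)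

/-! ### Strong continuity of the planar semigroup -/

theorem continuous_aCoeff (α : ℝ) : Continuous (aCoeff α) := by
  unfold aCoeff; fun_prop

theorem aCoeff_zero (α : ℝ) : aCoeff α 0 = 0 := by simp [aCoeff]

/-- Substituting `y = βz` and then `y = x - √a ξ` turns the kernel into a fixed Gaussian; time
enters only the argument of `h` and a prefactor, a form regular at `t = 0`. -/
theorem integral_lineKernel_mul {α t : ℝ} (hα : 0 < α) (ht : 0 < t) (x : ℝ) (h : ℝ → ℝ) :
    ∫ z, lineKernel α t x z * h z = ∫ ξ, heatKernel 1 ξ * ((Real.exp (-α * t / 2))⁻¹ *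
      h ((x - √(aCoeff α t) * ξ) / Real.exp (-α * t / 2))) := by
  set β := Real.exp (-α * t / 2) with hβ
  have hβ0 : 0 < β := Real.exp_pos _
  have e1 : ∀ z, lineKernel α t x z * h z =
      (fun y => heatKernel (aCoeff α t) (x - y) * h (y / β)) (β * z) := by
    intro z
    simp only
    rw [lineKernel_eq, mul_div_cancel_left₀ _ hβ0.ne']
  rw [integral_congr_ae (ae_of_all _ e1),
    Measure.integral_comp_mul_left (fun y => heatKernel (aCoeff α t) (x - y) * h (y / β)) β,
    abs_of_pos (inv_pos.2 hβ0), smul_eq_mul]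
  have e2 := integral_heatKernel_sub_smul (aCoeff_pos hα ht) x fun y => h (y / β)
  simp only [smul_eq_mul] at e2
  rw [e2, ← integral_const_mul]
  congr 1
  funext ξ
  ring

theorem exists_heatKernel_mul_lineWeight_le (M c : ℝ) :
    ∃ C, 0 < C ∧ ∀ ξ, heatKernel 1 ξ * lineWeight M (c * ξ) ≤ C * Real.exp (-(1 / 8) * ξ ^ 2) := by
  obtain ⟨C, hC, h⟩ := exists_lineWeight_mul_exp_le M (b := 1 / (8 * (c ^ 2 + 1))) (by positivity)
  refine ⟨C, hC, fun ξ => ?_⟩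
  have h1 := h (c * ξ)
  have h2 : heatKernel 1 ξ ≤ Real.exp (-(1 / 8) * ξ ^ 2) * Real.exp (-(1 / 8) * ξ ^ 2) := by
    rw [heatKernel_eq_exp, ← Real.exp_add]
    have : 1 / √(4 * Real.pi * 1) ≤ 1 := by
      rw [div_le_one (by positivity), Real.one_le_sqrt]
      nlinarith [Real.pi_gt_three]
    calc _ ≤ 1 * Real.exp (-(1 / (4 * 1)) * ξ ^ 2) := by gcongr
      _ = _ := by rw [one_mul]; congr 1; ring
  have h3 : Real.exp (-(1 / 8) * ξ ^ 2) ≤ Real.exp (-(1 / (8 * (c ^ 2 + 1))) * (c * ξ) ^ 2) := by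
    apply Real.exp_le_exp.2
    have : 1 / (8 * (c ^ 2 + 1)) * (c * ξ) ^ 2 ≤ 1 / 8 * ξ ^ 2 := by
      rw [div_mul_eq_mul_div, div_le_iff₀ (by positivity)]
      nlinarith [sq_nonneg ξ]
    linarith
  have hw := lineWeight_pos M (c * ξ)
  calc heatKernel 1 ξ * lineWeight M (c * ξ)
      ≤ (Real.exp (-(1 / 8) * ξ ^ 2) * Real.exp (-(1 / 8) * ξ ^ 2)) * lineWeight M (c * ξ) := by
        gcongr
    _ = (lineWeight M (c * ξ) * Real.exp (-(1 / 8) * ξ ^ 2)) * Real.exp (-(1 / 8) * ξ ^ 2) := by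
        ring
    _ ≤ C * Real.exp (-(1 / 8) * ξ ^ 2) := by
        gcongr
        exact le_trans (by gcongr) h1

/-- The function `E_t g` after the substitution `z = (x - √a ξ)/β`, which makes sense for `t = 0`
as well. -/
def gaussRep (α₁ α₂ : ℝ) (g : ℝ × ℝ → ℝ) (t : ℝ) (x : ℝ × ℝ) : ℝ :=
  (Real.exp (-α₁ * t / 2))⁻¹ * (Real.exp (-α₂ * t / 2))⁻¹ *
    ∫ ξ : ℝ × ℝ, heatKernel 1 ξ.1 * heatKernel 1 ξ.2 *
      g ((x.1 - √(aCoeff α₁ t) * ξ.1) / Real.exp (-α₁ * t / 2),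
        (x.2 - √(aCoeff α₂ t) * ξ.2) / Real.exp (-α₂ * t / 2))

section

variable {α₁ α₂ : ℝ} {g : ℝ × ℝ → ℝ} (hg : Continuous g) {B : ℝ} (hB : ∀ z, |g z| ≤ B)

theorem integrable_heatKernel_prod :
    Integrable fun ξ : ℝ × ℝ => heatKernel 1 ξ.1 * heatKernel 1 ξ.2 :=
  (integrable_heatKernel one_pos).mul_prod (integrable_heatKernel one_pos)

include hg hB in
theorem continuous_gaussRep :
    Continuous fun q : ℝ × (ℝ × ℝ) => gaussRep α₁ α₂ g q.1 q.2 := by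
  have hc : Continuous fun q : (ℝ × (ℝ × ℝ)) × (ℝ × ℝ) => g
      ((q.1.2.1 - √(aCoeff α₁ q.1.1) * q.2.1) / Real.exp (-α₁ * q.1.1 / 2),
        (q.1.2.2 - √(aCoeff α₂ q.1.1) * q.2.2) / Real.exp (-α₂ * q.1.1 / 2)) := by
    refine hg.comp (Continuous.prodMk ?_ ?_)
    · exact Continuous.div (by have := continuous_aCoeff α₁; fun_prop) (by fun_prop)
        fun _ => (Real.exp_pos _).ne'
    · exact Continuous.div (by have := continuous_aCoeff α₂; fun_prop) (by fun_prop)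
        fun _ => (Real.exp_pos _).ne'
  have hk : Continuous fun ξ : ℝ × ℝ => heatKernel 1 ξ.1 * heatKernel 1 ξ.2 :=
    ((continuous_heatKernel 1).comp continuous_fst).mul
      ((continuous_heatKernel 1).comp continuous_snd)
  unfold gaussRep
  refine Continuous.mul ?_ ?_
  · exact Continuous.mul (Continuous.inv₀ (by fun_prop) fun _ => (Real.exp_pos _).ne')
      (Continuous.inv₀ (by fun_prop) fun _ => (Real.exp_pos _).ne')
  · refine continuous_of_dominated (bound := fun ξ : ℝ × ℝ =>
      heatKernel 1 ξ.1 * heatKernel 1 ξ.2 * B) (fun q => ?_) (fun q => ae_of_all _ fun ξ => ?_)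
      (integrable_heatKernel_prod.mul_const B) (ae_of_all _ fun ξ => ?_)
    · exact (hk.mul (hc.comp (by fun_prop : Continuous fun ξ : ℝ × ℝ => (q, ξ)))).aestronglyMeasurable
    · have h0 : 0 ≤ heatKernel 1 ξ.1 * heatKernel 1 ξ.2 :=
        mul_nonneg (heatKernel_nonneg _ _) (heatKernel_nonneg _ _)
      rw [norm_mul, Real.norm_of_nonneg h0]
      exact mul_le_mul_of_nonneg_left (hB _) h0
    · exact continuous_const.mul
        (hc.comp (by fun_prop : Continuous fun q : ℝ × (ℝ × ℝ) => (q, ξ)))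

theorem gaussRep_zero (x : ℝ × ℝ) : gaussRep α₁ α₂ g 0 x = g x := by
  simp only [gaussRep, aCoeff_zero, mul_zero, zero_div, Real.exp_zero, inv_one, one_mul,
    Real.sqrt_zero, zero_mul, sub_zero, div_one, Prod.mk.eta]
  rw [integral_mul_const, Measure.volume_eq_prod,
    integral_prod_mul (f := heatKernel 1) (g := heatKernel 1), integral_heatKernel one_pos]
  ring

include hg hB in
theorem integral_planeKernel_eq_gaussRep (h₁ : 0 < α₁) (h₂ : 0 < α₂) {t : ℝ} (ht : 0 < t)
    (x : ℝ × ℝ) : ∫ z, planeKernel α₁ α₂ t x z * g z = gaussRep α₁ α₂ g t x := by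
  have i1 : Integrable fun z => planeKernel α₁ α₂ t x z * g z :=
    (integrable_tensorKernel (niceKernel_lineKernel h₁ ht) (niceKernel_lineKernel h₂ ht) x).mul_bdd
      hg.aestronglyMeasurable (ae_of_all _ hB)
  set β₁ := Real.exp (-α₁ * t / 2) with hβ₁
  set β₂ := Real.exp (-α₂ * t / 2) with hβ₂
  set σ₁ := √(aCoeff α₁ t) with hσ₁
  set σ₂ := √(aCoeff α₂ t) with hσ₂
  have i2 : Integrable fun ξ : ℝ × ℝ => heatKernel 1 ξ.1 * heatKernel 1 ξ.2 *
      g ((x.1 - σ₁ * ξ.1) / β₁, (x.2 - σ₂ * ξ.2) / β₂) :=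
    integrable_heatKernel_prod.mul_bdd
      (hg.comp (by fun_prop : Continuous fun ξ : ℝ × ℝ =>
        ((x.1 - σ₁ * ξ.1) / β₁, (x.2 - σ₂ * ξ.2) / β₂))).aestronglyMeasurable
      (ae_of_all _ fun _ => hB _)
  rw [Measure.volume_eq_prod] at i1 i2
  unfold gaussRep
  rw [Measure.volume_eq_prod, integral_prod _ i1, integral_prod _ i2]
  simp only [planeKernel, mul_assoc]
  simp_rw [integral_const_mul]
  rw [integral_lineKernel_mul h₁ ht, ← integral_const_mul, ← integral_const_mul]
  refine integral_congr_ae (ae_of_all _ fun ξ => ?_)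
  simp only
  rw [integral_lineKernel_mul h₂ ht, ← hβ₁, ← hβ₂, ← hσ₁, ← hσ₂]
  simp_rw [← mul_assoc, mul_comm (heatKernel 1 _) β₂⁻¹, mul_assoc]
  rw [integral_const_mul]
  ring

/-- Dividing by `β ≤ 1` increases the modulus, which only lowers a negative power of the weight.
Peetre's inequality then turns the shift `√a ξ` into growth in `ξ` alone, uniformly in `t` because
`a ≤ 1/α`. Thus the decay of `g` is inherited by `E_t g`. -/
theorem lineWeight_neg_le {α t M : ℝ} (hα : 0 < α) (ht : 0 ≤ t) (hM : 0 ≤ M) (x ξ : ℝ) :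
    lineWeight (-M) ((x - √(aCoeff α t) * ξ) / Real.exp (-α * t / 2)) ≤
      √2 ^ M * lineWeight M (√(1 / α) * ξ) * lineWeight (-M) x := by
  have hβ1 : Real.exp (-α * t / 2) ≤ 1 :=
    Real.exp_le_one_iff.2 (by nlinarith [mul_nonneg hα.le ht])
  have hβ0 : 0 < Real.exp (-α * t / 2) := Real.exp_pos _
  set y := (x - √(aCoeff α t) * ξ) / Real.exp (-α * t / 2) with hy
  have h1 : lineWeight M (x - √(aCoeff α t) * ξ) ≤ lineWeight M y := by
    apply lineWeight_mono hM
    rw [hy, abs_div, abs_of_pos hβ0]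
    exact le_div_self (abs_nonneg _) hβ0 hβ1
  have h2 : lineWeight M (√(aCoeff α t) * ξ) ≤ lineWeight M (√(1 / α) * ξ) := by
    apply lineWeight_mono hM
    rw [abs_mul, abs_mul, abs_of_nonneg (Real.sqrt_nonneg _), abs_of_nonneg (Real.sqrt_nonneg _)]
    gcongr
    exact aCoeff_le hα t
  have h3 := lineWeight_add_le hM (x - √(aCoeff α t) * ξ) (√(aCoeff α t) * ξ)
  rw [sub_add_cancel] at h3
  have p1 := lineWeight_pos M x
  have p2 := lineWeight_pos M y
  have p3 := lineWeight_pos M (√(1 / α) * ξ)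
  have p4 := lineWeight_pos M (x - √(aCoeff α t) * ξ)
  have p5 := lineWeight_pos M (√(aCoeff α t) * ξ)
  rw [lineWeight_neg, lineWeight_neg, inv_le_iff_one_le_mul₀ p2, mul_assoc, mul_assoc,
    ← mul_assoc _ _ (lineWeight M y)]
  rw [show √2 ^ M * (lineWeight M (√(1 / α) * ξ) * (lineWeight M x)⁻¹ * lineWeight M y) =
    (√2 ^ M * (lineWeight M y * lineWeight M (√(1 / α) * ξ))) / lineWeight M x by ring,
    le_div_iff₀ p1, one_mul]
  exact h3.trans (by gcongr)

include hg in
/-- Uniform decay of `E_t g`, for `g` with compact support. -/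
theorem exists_gaussRep_le (h₁ : 0 < α₁) (h₂ : 0 < α₂) (hgs : HasCompactSupport g) {M : ℝ}
    (hM : 0 ≤ M) (T : ℝ) :
    ∃ C, 0 ≤ C ∧ ∀ t, 0 ≤ t → t ≤ T → ∀ x, |gaussRep α₁ α₂ g t x| ≤
      C * (lineWeight (-M) x.1 * lineWeight (-M) x.2) := by
  obtain ⟨C₀, hC₀⟩ : ∃ C₀, ∀ z : ℝ × ℝ, ‖weight z ^ M * g z‖ ≤ C₀ :=
    ((continuous_weight_rpow M).mul hg).bounded_above_of_compact_support (hgs.mul_left)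
  have hC₀0 : 0 ≤ C₀ := (norm_nonneg _).trans (hC₀ 0)
  have hgd : ∀ z : ℝ × ℝ, |g z| ≤ C₀ * (lineWeight (-M) z.1 * lineWeight (-M) z.2) := by
    intro z
    have h := hC₀ z
    have hw : 0 < weight z ^ M := Real.rpow_pos_of_pos (weight_pos z) _
    rw [norm_mul, Real.norm_of_nonneg hw.le, Real.norm_eq_abs] at h
    rw [← weight_rpow, Real.rpow_neg (weight_pos z).le, ← div_eq_mul_inv, le_div_iff₀ hw]
    linarith
  obtain ⟨D₁, hD₁, d₁⟩ := exists_heatKernel_mul_lineWeight_le M √(1 / α₁)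
  obtain ⟨D₂, hD₂, d₂⟩ := exists_heatKernel_mul_lineWeight_le M √(1 / α₂)
  have hi := (integrable_exp_neg_mul_sq (b := 1 / 8) (by norm_num)).mul_prod
    (integrable_exp_neg_mul_sq (b := 1 / 8) (by norm_num))
  set I := ∫ ξ : ℝ × ℝ, Real.exp (-(1 / 8) * ξ.1 ^ 2) * Real.exp (-(1 / 8) * ξ.2 ^ 2) with hI
  have hI0 : 0 ≤ I := integral_nonneg fun ξ => by positivity
  refine ⟨Real.exp (α₁ * T / 2) * Real.exp (α₂ * T / 2) *
    (C₀ * (√2 ^ M) ^ 2 * D₁ * D₂ * I), by positivity, fun t ht htT x => ?_⟩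
  have hβ : ∀ α, 0 < α → (Real.exp (-α * t / 2))⁻¹ ≤ Real.exp (α * T / 2) := by
    intro α hα
    rw [← Real.exp_neg]
    exact Real.exp_le_exp.2 (by nlinarith)
  have w1 := (lineWeight_pos (-M) x.1).le
  have w2 := (lineWeight_pos (-M) x.2).le
  have hb : |∫ ξ : ℝ × ℝ, heatKernel 1 ξ.1 * heatKernel 1 ξ.2 *
      g ((x.1 - √(aCoeff α₁ t) * ξ.1) / Real.exp (-α₁ * t / 2),
        (x.2 - √(aCoeff α₂ t) * ξ.2) / Real.exp (-α₂ * t / 2))| ≤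
      ∫ ξ : ℝ × ℝ, C₀ * (√2 ^ M) ^ 2 * D₁ * D₂ *
        (lineWeight (-M) x.1 * lineWeight (-M) x.2) *
        (Real.exp (-(1 / 8) * ξ.1 ^ 2) * Real.exp (-(1 / 8) * ξ.2 ^ 2)) := by
    rw [← Real.norm_eq_abs]
    refine norm_integral_le_of_norm_le (hi.const_mul _) (ae_of_all _ fun ξ => ?_)
    have k1 := heatKernel_nonneg 1 ξ.1
    have k2 := heatKernel_nonneg 1 ξ.2
    rw [norm_mul, norm_mul, Real.norm_of_nonneg k1, Real.norm_of_nonneg k2, Real.norm_eq_abs]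
    have l1 := lineWeight_neg_le h₁ ht hM x.1 ξ.1
    have l2 := lineWeight_neg_le h₂ ht hM x.2 ξ.2
    have v1 := (lineWeight_pos M (√(1 / α₁) * ξ.1)).le
    have v2 := (lineWeight_pos M (√(1 / α₂) * ξ.2)).le
    have u2 := (lineWeight_pos (-M) ((x.2 - √(aCoeff α₂ t) * ξ.2) / Real.exp (-α₂ * t / 2))).le
    calc _ ≤ heatKernel 1 ξ.1 * heatKernel 1 ξ.2 * (C₀ *
          ((√2 ^ M * lineWeight M (√(1 / α₁) * ξ.1) * lineWeight (-M) x.1) *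
          (√2 ^ M * lineWeight M (√(1 / α₂) * ξ.2) * lineWeight (-M) x.2))) := by
          refine mul_le_mul_of_nonneg_left ((hgd _).trans ?_) (mul_nonneg k1 k2)
          exact mul_le_mul_of_nonneg_left (mul_le_mul l1 l2 u2 (by positivity)) hC₀0
      _ = C₀ * (√2 ^ M) ^ 2 * (lineWeight (-M) x.1 * lineWeight (-M) x.2) *
          ((heatKernel 1 ξ.1 * lineWeight M (√(1 / α₁) * ξ.1)) *
            (heatKernel 1 ξ.2 * lineWeight M (√(1 / α₂) * ξ.2))) := by ring
      _ ≤ C₀ * (√2 ^ M) ^ 2 * (lineWeight (-M) x.1 * lineWeight (-M) x.2) *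
          ((D₁ * Real.exp (-(1 / 8) * ξ.1 ^ 2)) * (D₂ * Real.exp (-(1 / 8) * ξ.2 ^ 2))) := by
          refine mul_le_mul_of_nonneg_left (mul_le_mul (d₁ _) (d₂ _) (mul_nonneg k2 v2)
            (by positivity)) (by positivity)
      _ = _ := by ring
  rw [integral_const_mul, ← hI] at hb
  unfold gaussRep
  rw [abs_mul, abs_of_nonneg (by positivity : 0 ≤ (Real.exp (-α₁ * t / 2))⁻¹ *
    (Real.exp (-α₂ * t / 2))⁻¹)]
  calc _ ≤ (Real.exp (α₁ * T / 2) * Real.exp (α₂ * T / 2)) *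
        (C₀ * (√2 ^ M) ^ 2 * D₁ * D₂ * (lineWeight (-M) x.1 * lineWeight (-M) x.2) * I) :=
        mul_le_mul (mul_le_mul (hβ α₁ h₁) (hβ α₂ h₂) (by positivity) (by positivity)) hb
          (abs_nonneg _) (by positivity)
    _ = _ := by ring

end

section StrongContinuity

variable {α₁ α₂ m : ℝ}

theorem planeSemigroup_coeFn_gaussRep (h₁ : 0 < α₁) (h₂ : 0 < α₂) (hm : 0 ≤ m)
    {g : ℝ × ℝ → ℝ} (hg : Continuous g) {B : ℝ} (hB : ∀ z, |g z| ≤ B) {f : WLp 2 m}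
    (hf : f =ᵐ[volume] g) {t : ℝ} (ht : 0 ≤ t) :
    planeSemigroup α₁ α₂ m t f =ᵐ[volume] gaussRep α₁ α₂ g t := by
  rcases ht.eq_or_lt with rfl | ht
  · rw [planeSemigroup_zero]
    filter_upwards [hf] with x hx
    rw [gaussRep_zero, ← hx]; rfl
  · rw [planeSemigroup_apply h₁ h₂ hm ht]
    filter_upwards [coeFn_kernelOp (kernelDefined_planeKernel h₁ h₂ hm ht) f] with x hx
    rw [hx, ← integral_planeKernel_eq_gaussRep hg hB h₁ h₂ ht]
    refine integral_congr_ae ?_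
    filter_upwards [hf] with z hz
    rw [hz]

theorem norm_sub_eq_eLpNorm {m : ℝ} {f g : WLp 2 m} {F G : ℝ × ℝ → ℝ} (hf : f =ᵐ[volume] F)
    (hg : g =ᵐ[volume] G) :
    ‖f - g‖ = (eLpNorm (fun x => F x - G x) 2 (weightedMeasure 2 m)).toReal := by
  rw [Lp.norm_def]
  congr 1
  refine eLpNorm_congr_ae ?_
  filter_upwards [Lp.coeFn_sub f g, ae_weightedMeasure (p := 2) (m := m) hf,
    ae_weightedMeasure (p := 2) (m := m) hg] with x h1 h2 h3
  rw [h1, Pi.sub_apply, h2, h3]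

theorem continuous_planeSemigroup_of_compactSupport (h₁ : 0 < α₁) (h₂ : 0 < α₂) (hm : 0 ≤ m)
    {g : ℝ × ℝ → ℝ} (hg : Continuous g) (hgs : HasCompactSupport g) {f : WLp 2 m}
    (hf : f =ᵐ[volume] g) : Continuous fun t : ℝ≥0 => planeSemigroup α₁ α₂ m t f := by
  obtain ⟨B, hB⟩ := hg.bounded_above_of_compact_support hgs
  have hrep := fun t : ℝ≥0 =>
    planeSemigroup_coeFn_gaussRep h₁ h₂ hm hg (fun z => hB z) hf t.coe_nonneg
  have hcont := continuous_gaussRep (α₁ := α₁) (α₂ := α₂) hg (fun z => hB z)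
  rw [continuous_iff_continuousAt]
  intro t₀
  -- With decay of order `m + 1`, multiplying by `b^m` and squaring leaves `(1+x₁²)⁻¹(1+x₂²)⁻¹`, an
  -- integrable majorant for dominated convergence.
  obtain ⟨C, hC0, hC⟩ := exists_gaussRep_le hg h₁ h₂ hgs (M := m + 1) (by positivity) (t₀ + 1)
  rw [ContinuousAt, tendsto_iff_norm_sub_tendsto_zero]
  refine Filter.Tendsto.congr (fun t => (norm_sub_eq_eLpNorm (hrep t) (hrep t₀)).symm) ?_
  suffices h : Filter.Tendsto (fun t : ℝ≥0 => eLpNorm (fun x => gaussRep α₁ α₂ g t x -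
      gaussRep α₁ α₂ g t₀ x) 2 (weightedMeasure 2 m)) (𝓝 t₀) (𝓝 0) by
    have h' := (ENNReal.tendsto_toReal ENNReal.zero_ne_top).comp h
    rwa [ENNReal.toReal_zero] at h'
  simp_rw [eLpNorm_weightedMeasure two_ne_zero (by simp : (2 : ℝ≥0∞) ≠ ⊤)]
  have h2 : (2 : ℝ≥0∞).toReal = 2 := by simp
  rw [h2]
  have key : Filter.Tendsto (fun t : ℝ≥0 => ∫⁻ x, (ENNReal.ofReal (weight x ^ m) *
      ‖gaussRep α₁ α₂ g t x - gaussRep α₁ α₂ g t₀ x‖ₑ) ^ (2 : ℝ)) (𝓝 t₀)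
      (𝓝 (∫⁻ _ : ℝ × ℝ, 0)) := by
    refine tendsto_lintegral_filter_of_dominated_convergence
      (fun x => ENNReal.ofReal ((2 * C) ^ 2 * (lineWeight (-2) x.1 * lineWeight (-2) x.2)))
      (Filter.Eventually.of_forall fun t => ?_) ?_ ?_ (ae_of_all _ fun x => ?_)
    · refine Measurable.pow_const (Measurable.mul (measurable_ofReal_weight_rpow m) ?_) _
      exact ((hcont.comp (by fun_prop : Continuous fun x : ℝ × ℝ => ((t : ℝ), x))).sub
        (hcont.comp (by fun_prop : Continuous fun x : ℝ × ℝ => ((t₀ : ℝ), x)))).measurable.enorm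
    · have : ∀ᶠ t in 𝓝 t₀, t < t₀ + 1 := eventually_lt_nhds (by simp)
      filter_upwards [this] with t ht
      refine ae_of_all _ fun x => ?_
      have ht' : (t : ℝ) ≤ t₀ + 1 := by exact_mod_cast ht.le
      have b1 := hC t t.coe_nonneg ht' x
      have b2 := hC t₀ t₀.coe_nonneg (by linarith) x
      have b3 : |gaussRep α₁ α₂ g t x - gaussRep α₁ α₂ g t₀ x| ≤
          2 * C * (lineWeight (-(m + 1)) x.1 * lineWeight (-(m + 1)) x.2) :=
        (abs_sub _ _).trans (by linarith)
      have hw : 0 ≤ weight x ^ m := Real.rpow_nonneg (weight_pos x).le m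
      rw [Real.enorm_eq_ofReal_abs, ← ENNReal.ofReal_mul hw, ENNReal.ofReal_rpow_of_nonneg
        (by positivity) zero_le_two]
      refine ENNReal.ofReal_le_ofReal ?_
      rw [Real.rpow_two]
      have e1 : ∀ u, lineWeight m u * lineWeight (-(m + 1)) u = lineWeight (-1) u := by
        intro u
        unfold lineWeight
        rw [← Real.rpow_add (zero_lt_one.trans_le (one_le_sqrt_one_add_sq u))]
        congr 1; ring
      calc (weight x ^ m * |gaussRep α₁ α₂ g t x - gaussRep α₁ α₂ g t₀ x|) ^ 2
          ≤ (weight x ^ m * (2 * C * (lineWeight (-(m + 1)) x.1 * lineWeight (-(m + 1)) x.2))) ^ 2 := by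
            gcongr
        _ = (2 * C * ((lineWeight m x.1 * lineWeight (-(m + 1)) x.1) *
            (lineWeight m x.2 * lineWeight (-(m + 1)) x.2))) ^ 2 := by
            rw [weight_rpow]; ring
        _ = _ := by
            rw [e1, e1, mul_pow, mul_pow (lineWeight _ _), lineWeight_sq, lineWeight_sq]
            norm_num
    · have hi := ((integrable_lineWeight (s := 2) one_lt_two).mul_prod
        (integrable_lineWeight (s := 2) one_lt_two)).const_mul ((2 * C) ^ 2)
      exact hi.lintegral_lt_top.ne
    · have hc : Filter.Tendsto (fun t : ℝ≥0 => gaussRep α₁ α₂ g t x) (𝓝 t₀)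
          (𝓝 (gaussRep α₁ α₂ g t₀ x)) :=
        (hcont.comp (by fun_prop : Continuous fun t : ℝ≥0 => ((t : ℝ), x))).tendsto t₀
      have h3 : Filter.Tendsto (fun t : ℝ≥0 =>
          ‖gaussRep α₁ α₂ g t x - gaussRep α₁ α₂ g t₀ x‖ₑ) (𝓝 t₀) (𝓝 0) := by
        have := (hc.sub_const (gaussRep α₁ α₂ g t₀ x)).enorm
        simpa using this
      have h4 := ENNReal.Tendsto.const_mul (a := ENNReal.ofReal (weight x ^ m)) h3
        (Or.inr ENNReal.ofReal_ne_top)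
      rw [mul_zero] at h4
      have h5 := (ENNReal.continuous_rpow_const (y := 2)).tendsto 0 |>.comp h4
      simpa [Function.comp_def] using h5
  have := (ENNReal.continuous_rpow_const (y := 1 / 2)).tendsto _ |>.comp key
  simpa [Function.comp_def] using this

instance (p : ℝ≥0∞) (m : ℝ) : IsLocallyFiniteMeasure (weightedMeasure p m) :=
  IsLocallyFiniteMeasure.withDensity_ofReal (continuous_weight_rpow _)

theorem exists_compactSupport_near {m : ℝ} (f : WLp 2 m) {ε : ℝ} (hε : 0 < ε) :
    ∃ (g : ℝ × ℝ → ℝ) (h : WLp 2 m), Continuous g ∧ HasCompactSupport g ∧ h =ᵐ[volume] g ∧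
      ‖f - h‖ ≤ ε := by
  obtain ⟨g, hgs, hle, hg, hgL⟩ := (Lp.memLp f).exists_hasCompactSupport_eLpNorm_sub_le
    (by simp) (ε := ENNReal.ofReal ε) (by simpa using hε)
  refine ⟨g, hgL.toLp g, hg, hgs, ae_volume hgL.coeFn_toLp, ?_⟩
  rw [Lp.norm_def]
  refine ENNReal.toReal_le_of_le_ofReal hε.le (le_of_eq_of_le (eLpNorm_congr_ae ?_) hle)
  filter_upwards [Lp.coeFn_sub f (hgL.toLp g), hgL.coeFn_toLp] with x h1 h2
  rw [h1, Pi.sub_apply, h2, Pi.sub_apply]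

/-- Continuous functions with compact support are dense and the operators are bounded uniformly on
bounded time intervals, so each orbit is a locally uniform limit of continuous ones. -/
theorem continuous_planeSemigroup (h₁ : 0 < α₁) (h₂ : 0 < α₂) (hm : 0 ≤ m) (f : WLp 2 m) :
    Continuous fun t : ℝ≥0 => planeSemigroup α₁ α₂ m t f := by
  have hT : ∀ T : ℝ≥0, ContinuousOn (fun t : ℝ≥0 => planeSemigroup α₁ α₂ m t f) (Set.Iio T) := by
    intro T
    obtain ⟨C, hC, hb⟩ := exists_norm_planeSemigroup_le h₁ h₂ hm (T : ℝ)
    refine continuousOn_of_uniform_approx_of_continuousOn fun u hu => ?_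
    obtain ⟨ε, hε, hεu⟩ := Metric.mem_uniformity_dist.1 hu
    obtain ⟨g, h, hg, hgs, hhg, hfh⟩ := exists_compactSupport_near f (ε := ε / (2 * C))
      (by positivity)
    refine ⟨_, (continuous_planeSemigroup_of_compactSupport h₁ h₂ hm hg hgs hhg).continuousOn,
      fun t ht => hεu ?_⟩
    rw [dist_eq_norm, ← map_sub]
    have ht' : (t : ℝ) ≤ T := by exact_mod_cast (Set.mem_Iio.1 ht).le
    calc ‖planeSemigroup α₁ α₂ m t (f - h)‖ ≤ C * (ε / (2 * C)) :=
          (ContinuousLinearMap.le_opNorm _ _).trans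
            (mul_le_mul (hb t t.coe_nonneg (Or.inl ht')) hfh (norm_nonneg _) hC.le)
      _ = ε / 2 := by field_simp
      _ < ε := by linarith
  rw [continuous_iff_continuousAt]
  intro t₀
  exact (hT (t₀ + 1)).continuousAt (Iio_mem_nhds (by simp))

end StrongContinuity

/-! ### Operators in the axial variable -/

section Axial

variable {F F' : Type*} [NormedAddCommGroup F] [NormedSpace ℝ F] [NormedAddCommGroup F']
  [NormedSpace ℝ F']

theorem integrable_smul_comp {k : ℝ → ℝ} (hk : Integrable k) (ω : ℝ →ᵇ F) {φ : ℝ → ℝ}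
    (hφ : Continuous φ) : Integrable fun ξ => k ξ • ω (φ ξ) :=
  hk.smul_bdd ‖ω‖ (ω.continuous.comp hφ).aestronglyMeasurable
    (ae_of_all _ fun _ => ω.norm_coe_le_norm _)

theorem norm_integral_smul_comp_le {k : ℝ → ℝ} (hk : Integrable k) (ω : ℝ →ᵇ F) (φ : ℝ → ℝ) :
    ‖∫ ξ, k ξ • ω (φ ξ)‖ ≤ (∫ ξ, |k ξ|) * ‖ω‖ := by
  rw [← integral_mul_const]
  refine norm_integral_le_of_norm_le (hk.norm.mul_const _) (ae_of_all _ fun ξ => ?_)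
  rw [norm_smul, Real.norm_eq_abs]
  exact mul_le_mul_of_nonneg_left (ω.norm_coe_le_norm _) (abs_nonneg _)

/-- Dominated convergence with majorant `C|k|`. The parameter may move both the function and its
argument, as joint continuity of `S_t ω` in `(t, x₃)` requires. -/
theorem continuous_integral_smul_comp {Y : Type*} [TopologicalSpace Y] [FirstCountableTopology Y]
    {k : ℝ → ℝ} (hk : Integrable k) (W : Y → ℝ → F) (hW : Continuous (Function.uncurry W)) {C : ℝ}
    (hC : ∀ y x, ‖W y x‖ ≤ C) {φ : Y → ℝ → ℝ} (hφ : Continuous (Function.uncurry φ)) :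
    Continuous fun y => ∫ ξ, k ξ • W y (φ y ξ) := by
  have hc : Continuous fun q : Y × ℝ => W q.1 (φ q.1 q.2) :=
    hW.comp (continuous_fst.prodMk hφ)
  refine continuous_of_dominated (bound := fun ξ => ‖k ξ‖ * C) (fun y => ?_)
    (fun y => ae_of_all _ fun ξ => ?_) (hk.norm.mul_const C) (ae_of_all _ fun ξ => ?_)
  · exact hk.1.smul (hc.comp (by fun_prop : Continuous fun ξ : ℝ => (y, ξ))).aestronglyMeasurable
  · rw [norm_smul]
    exact mul_le_mul_of_nonneg_left (hC _ _) (norm_nonneg _)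
  · exact (hc.comp (by fun_prop : Continuous fun y : Y => (y, ξ))).const_smul (k ξ)

/-- The operator `ω ↦ (x ↦ ∫ k(ξ) ω(βx - σξ) dξ)`. -/
def averageOp (F : Type*) [NormedAddCommGroup F] [NormedSpace ℝ F] {k : ℝ → ℝ} (hk : Integrable k)
    (β σ : ℝ) : (ℝ →ᵇ F) →L[ℝ] (ℝ →ᵇ F) :=
  LinearMap.mkContinuous
    { toFun := fun ω => BoundedContinuousFunction.ofNormedAddCommGroup
        (fun x => ∫ ξ, k ξ • ω (x * β - σ * ξ))
        (continuous_integral_smul_comp hk (fun _ x => ω x) (ω.continuous.comp continuous_snd)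
          (fun _ x => ω.norm_coe_le_norm x) (by fun_prop))
        ((∫ ξ, |k ξ|) * ‖ω‖) (fun x => norm_integral_smul_comp_le hk ω _)
      map_add' := fun ω η => by
        ext x
        simp only [BoundedContinuousFunction.coe_add, Pi.add_apply, smul_add,
          BoundedContinuousFunction.coe_ofNormedAddCommGroup]
        exact integral_add (integrable_smul_comp hk ω (by fun_prop))
          (integrable_smul_comp hk η (by fun_prop))
      map_smul' := fun c ω => by
        ext x
        simp only [BoundedContinuousFunction.coe_smul, RingHom.id_apply,
          BoundedContinuousFunction.coe_ofNormedAddCommGroup]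
        rw [← integral_smul]
        simp_rw [smul_comm c] }
    (∫ ξ, |k ξ|) fun ω => BoundedContinuousFunction.norm_ofNormedAddCommGroup_le _
      (mul_nonneg (integral_nonneg fun _ => abs_nonneg _) (norm_nonneg _))
      fun x => norm_integral_smul_comp_le hk ω _

theorem averageOp_apply {k : ℝ → ℝ} (hk : Integrable k) (β σ : ℝ) (ω : ℝ →ᵇ F) (x : ℝ) :
    averageOp F hk β σ ω x = ∫ ξ, k ξ • ω (x * β - σ * ξ) := rfl

theorem norm_averageOp_le {k : ℝ → ℝ} (hk : Integrable k) (β σ : ℝ) :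
    ‖averageOp F hk β σ‖ ≤ ∫ ξ, |k ξ| :=
  LinearMap.mkContinuous_norm_le _ (integral_nonneg fun _ => abs_nonneg _) _

theorem averageOp_comp [CompleteSpace F] [CompleteSpace F'] {k : ℝ → ℝ} (hk : Integrable k)
    (β σ : ℝ) (L : F →L[ℝ] F') (ω : ℝ →ᵇ F) (x : ℝ) :
    L (averageOp F hk β σ ω x) = ∫ ξ, k ξ • L (ω (x * β - σ * ξ)) := by
  rw [averageOp_apply, ← L.integral_comp_comm (integrable_smul_comp hk ω (by fun_prop))]
  simp_rw [map_smul]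

/-! ### The axial semigroup -/

theorem axialVar_pos {t : ℝ} (ht : 0 < t) : 0 < axialVar t := aCoeff_pos two_pos ht

theorem axialVar_le (t : ℝ) : axialVar t ≤ 1 / 2 := aCoeff_le two_pos t

theorem continuous_axialVar : Continuous axialVar := continuous_aCoeff 2

/-- The Ornstein–Uhlenbeck semigroup in the axial variable. -/
def axialSemigroup (F : Type*) [NormedAddCommGroup F] [NormedSpace ℝ F] (t : ℝ) :
    (ℝ →ᵇ F) →L[ℝ] (ℝ →ᵇ F) :=
  averageOp F (integrable_heatKernel one_pos) (Real.exp (-t)) √(axialVar t)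

theorem axialSemigroup_apply (t : ℝ) (ω : ℝ →ᵇ F) (x : ℝ) :
    axialSemigroup F t ω x =
      ∫ ξ, heatKernel 1 ξ • ω (x * Real.exp (-t) - √(axialVar t) * ξ) := rfl

theorem axialSemigroup_eq_integral {t : ℝ} (ht : 0 < t) (ω : ℝ →ᵇ F) (x : ℝ) :
    axialSemigroup F t ω x = ∫ y, axialKernel t x y • ω y := by
  simp_rw [axialKernel_eq]
  rw [integral_heatKernel_sub_smul (axialVar_pos ht)]; rfl

theorem integral_abs_heatKernel {a : ℝ} (ha : 0 < a) : ∫ ξ, |heatKernel a ξ| = 1 := by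
  simp_rw [abs_of_nonneg (heatKernel_nonneg _ _)]
  exact integral_heatKernel ha

theorem norm_axialSemigroup_le (t : ℝ) : ‖axialSemigroup F t‖ ≤ 1 :=
  (norm_averageOp_le _ _ _).trans (integral_abs_heatKernel one_pos).le

theorem axialSemigroup_zero [CompleteSpace F] :
    axialSemigroup F 0 = ContinuousLinearMap.id ℝ (ℝ →ᵇ F) := by
  ext ω x
  rw [axialSemigroup_apply]
  have : axialVar 0 = 0 := aCoeff_zero 2
  simp only [this, neg_zero, Real.exp_zero, mul_one, Real.sqrt_zero, zero_mul, sub_zero,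
    ContinuousLinearMap.id_apply]
  rw [integral_smul_const, integral_heatKernel one_pos, one_smul]

theorem axialVar_add (s t : ℝ) :
    axialVar t + Real.exp (-t) ^ 2 * axialVar s = axialVar (s + t) := by
  have h := aCoeff_add (α := 2) t s
  rw [show -2 * t / 2 = -t by ring, add_comm t s] at h
  exact h

/-- Here the dilation acts on the outer point. Evenness of the Gaussian brings the product to the
form of the convolution identity with the roles of `s` and `t` exchanged. -/
theorem axialKernel_mul (s t x y w : ℝ) : axialKernel s x w * axialKernel t w y =
    heatKernel (axialVar t) (y - Real.exp (-t) * w) *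
      heatKernel (axialVar s) (w - x * Real.exp (-s)) := by
  rw [axialKernel_eq, axialKernel_eq, ← heatKernel_neg (axialVar s),
    ← heatKernel_neg (axialVar t), mul_comm]
  congr 2 <;> ring

theorem integral_axialKernel_mul {s t : ℝ} (hs : 0 < s) (ht : 0 < t) (x y : ℝ) :
    ∫ w, axialKernel s x w * axialKernel t w y = axialKernel (s + t) x y := by
  simp_rw [axialKernel_mul]
  rw [integral_heatKernel_mul_heatKernel (axialVar_pos ht) (axialVar_pos hs), axialVar_add,
    axialKernel_eq, ← heatKernel_neg]
  congr 1
  rw [neg_add, Real.exp_add]; ring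

theorem integrable_axialKernel_mul {s t : ℝ} (hs : 0 < s) (ht : 0 < t) (x y : ℝ) :
    Integrable fun w => axialKernel s x w * axialKernel t w y := by
  simp_rw [axialKernel_mul]
  exact integrable_heatKernel_mul_heatKernel (axialVar_pos ht) (axialVar_pos hs) _ _ _

theorem continuous_axialKernel (t : ℝ) : Continuous fun q : ℝ × ℝ => axialKernel t q.1 q.2 := by
  simp_rw [axialKernel_eq]
  exact (continuous_heatKernel _).comp (by fun_prop)

theorem axialKernel_nonneg (t x y : ℝ) : 0 ≤ axialKernel t x y := by
  rw [axialKernel_eq]; exact heatKernel_nonneg _ _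

theorem integrable_axialKernel {t : ℝ} (ht : 0 < t) (x : ℝ) : Integrable (axialKernel t x) := by
  have e : axialKernel t x = fun y => heatKernel (axialVar t) (x * Real.exp (-t) - y) :=
    funext fun y => axialKernel_eq t x y
  rw [e]
  exact (integrable_heatKernel (axialVar_pos ht)).comp_sub_left _

theorem axialSemigroup_add [CompleteSpace F] {s t : ℝ} (hs : 0 ≤ s) (ht : 0 ≤ t) :
    axialSemigroup F (s + t) = (axialSemigroup F s).comp (axialSemigroup F t) := by
  rcases hs.eq_or_lt with rfl | hs
  · rw [zero_add, axialSemigroup_zero]; rfl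
  rcases ht.eq_or_lt with rfl | ht
  · rw [add_zero, axialSemigroup_zero]; rfl
  have hst : 0 < s + t := by positivity
  ext1 ω
  ext1 x
  rw [ContinuousLinearMap.comp_apply, axialSemigroup_eq_integral hst,
    axialSemigroup_eq_integral hs]
  simp_rw [axialSemigroup_eq_integral ht, ← integral_smul, smul_smul]
  have hmeas : AEStronglyMeasurable (Function.uncurry fun w y : ℝ =>
      (axialKernel s x w * axialKernel t w y) • ω y) ((volume : Measure ℝ).prod volume) := by
    refine Continuous.aestronglyMeasurable ?_
    have c1 : Continuous fun q : ℝ × ℝ => axialKernel s x q.1 :=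
      (continuous_axialKernel s).comp (by fun_prop : Continuous fun q : ℝ × ℝ => (x, q.1))
    exact (c1.mul (continuous_axialKernel t)).smul (ω.continuous.comp continuous_snd)
  have hint : Integrable (Function.uncurry fun w y : ℝ =>
      (axialKernel s x w * axialKernel t w y) • ω y) ((volume : Measure ℝ).prod volume) := by
    rw [integrable_prod_iff' hmeas]
    constructor
    · exact ae_of_all _ fun y => (integrable_axialKernel_mul hs ht x y).smul_const (ω y)
    · have h := (integrable_smul_comp (integrable_axialKernel hst x) ω continuous_id).norm
      refine h.congr (ae_of_all _ fun y => ?_)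
      simp only [Function.uncurry, norm_smul, norm_mul, Real.norm_eq_abs,
        abs_of_nonneg (axialKernel_nonneg _ _ _), id]
      rw [integral_mul_const, integral_axialKernel_mul hs ht]
  rw [integral_integral_swap hint]
  refine integral_congr_ae (ae_of_all _ fun y => ?_)
  simp only
  rw [integral_smul_const, integral_axialKernel_mul hs ht]

/-- A bounded linear map passes through the Bochner integral. With `L = E_t` this is the commutation
of the planar and axial factors. -/
theorem axialSemigroup_comp [CompleteSpace F] [CompleteSpace F'] (t : ℝ) (L : F →L[ℝ] F')
    (ω : ℝ →ᵇ F) : L.compLeftContinuousBounded ℝ (axialSemigroup F t ω) =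
      axialSemigroup F' t (L.compLeftContinuousBounded ℝ ω) := by
  ext x
  simp only [ContinuousLinearMap.compLeftContinuousBounded_apply]
  exact averageOp_comp _ _ _ L ω x

/-! ### The axial derivative -/

theorem integrable_heatKernelD {a : ℝ} (ha : 0 < a) : Integrable (heatKernelD a) := by
  refine Integrable.mono' ((integrable_exp_neg_mul_sq (b := 1 / (8 * a)) (by positivity)).const_mul
    (1 / a)) (continuous_heatKernelD a).aestronglyMeasurable (ae_of_all _ fun u => ?_)
  refine (heatKernelD_le_exp ha u).trans (le_of_eq ?_)
  congr 2; ring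

/-- Integrating the Gaussian envelope leaves `√a` in the denominator, the source of
`(1-e^{-2t})^{-1/2}` in the estimate for `∂₃`. -/
theorem integral_abs_heatKernelD_le {a : ℝ} (ha : 0 < a) :
    ∫ u, |heatKernelD a u| ≤ √(8 * Real.pi) / √a := by
  have h : ∫ u, |heatKernelD a u| ≤ ∫ u, 1 / a * Real.exp (-(1 / (8 * a)) * u ^ 2) := by
    refine integral_mono (integrable_heatKernelD ha).abs
      ((integrable_exp_neg_mul_sq (b := 1 / (8 * a)) (by positivity)).const_mul _) fun u => ?_
    refine (heatKernelD_le_exp ha u).trans (le_of_eq ?_)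
    congr 2; ring
  rw [integral_const_mul, integral_gaussian] at h
  refine h.trans (le_of_eq ?_)
  rw [show Real.pi / (1 / (8 * a)) = 8 * Real.pi * a by field_simp,
    Real.sqrt_mul (by positivity)]
  have hs : 0 < √a := Real.sqrt_pos.2 ha
  rw [div_mul_eq_mul_div, one_mul, div_eq_div_iff ha.ne' hs.ne', mul_assoc,
    Real.mul_self_sqrt ha.le]

end Axial

/-! ### The topology of `X^p_loc(m)` -/

section LocTopology

variable {p : ℝ≥0∞} [Fact (1 ≤ p)] {m : ℝ}

theorem bddAbove_locSeminorm (n : ℕ+) (ω : XSpace p m) :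
    BddAbove (Set.range fun x : Set.Icc (-(n : ℝ)) n => ‖ω x‖) :=
  ⟨‖ω‖, by rintro _ ⟨x, rfl⟩; exact ω.norm_coe_le_norm x⟩

theorem locSeminorm_le {n : ℕ+} {ω : XSpace p m} {ε : ℝ} (h : ∀ x : ℝ, |x| ≤ n → ‖ω x‖ ≤ ε) :
    locSeminorm p m n ω ≤ ε :=
  have : Nonempty (Set.Icc (-(n : ℝ)) n) := ⟨⟨0, by simp⟩⟩
  ciSup_le fun x => h x (abs_le.2 x.2)

theorem le_locSeminorm {n : ℕ+} (ω : XSpace p m) {x : ℝ} (hx : |x| ≤ n) :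
    ‖ω x‖ ≤ locSeminorm p m n ω :=
  le_ciSup (bddAbove_locSeminorm n ω) ⟨x, abs_le.1 hx⟩

theorem withSeminorms_locSeminorm (p : ℝ≥0∞) [Fact (1 ≤ p)] (m : ℝ) :
    @WithSeminorms ℝ (XSpace p m) ℕ+ _ _ _ (locSeminorm p m) (locTopology p m) :=
  @WithSeminorms.mk ℝ (XSpace p m) ℕ+ _ _ _ (locSeminorm p m) (locTopology p m) rfl

/-- The seminorms increase with `n`, so a single index and radius suffice, and the supremum can be
replaced by a pointwise bound. -/
theorem mem_nhds_locTopology_iff {V : Set (XSpace p m)} :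
    V ∈ @nhds _ (locTopology p m) (0 : XSpace p m) ↔
      ∃ (n : ℕ+) (ε : ℝ), 0 < ε ∧ ∀ ω : XSpace p m, (∀ x : ℝ, |x| ≤ n → ‖ω x‖ ≤ ε) → ω ∈ V := by
  let _ := locTopology p m
  rw [(withSeminorms_locSeminorm p m).mem_nhds_iff]
  constructor
  · rintro ⟨s, r, hr, h⟩
    -- The index dominates every element of `s`; `r / 2` turns the non-strict bound into the strict
    -- one defining a ball.
    refine ⟨s.sup id ⊔ 1, r / 2, by linarith, fun ω hω => h ?_⟩
    rw [Seminorm.mem_ball_zero]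
    refine Seminorm.finset_sup_apply_lt hr fun i hi => ?_
    refine lt_of_le_of_lt (locSeminorm_le (ε := r / 2) fun x hx => hω x (hx.trans ?_)) (by linarith)
    have : i ≤ s.sup id ⊔ 1 := le_sup_of_le_left (Finset.le_sup (f := id) hi)
    exact_mod_cast this
  · rintro ⟨n, ε, hε, h⟩
    refine ⟨{n}, ε, hε, fun ω hω => h ω fun x hx => ?_⟩
    rw [Seminorm.mem_ball_zero, Finset.sup_singleton] at hω
    exact (le_locSeminorm ω hx).trans hω.le

/-- By currying, joint continuity gives a continuous map into `C(ℝ, L^p(m))` with the compact-open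
topology, that is, uniform convergence on each `[-n, n]`. -/
theorem continuous_locTopology {Y : Type*} [TopologicalSpace Y] (u : Y → XSpace p m)
    (h : Continuous fun q : Y × ℝ => u q.1 q.2) : Continuous[inferInstance, locTopology p m] u := by
  let _ := locTopology p m
  rw [continuous_iff_continuousAt]
  intro y₀
  rw [ContinuousAt, (withSeminorms_locSeminorm p m).tendsto_nhds]
  intro n ε hε
  let G : C(Y, C(ℝ, WLp p m)) := ContinuousMap.curry ⟨fun q : Y × ℝ => u q.1 q.2, h⟩
  have hG := ContinuousMap.tendsto_iff_forall_isCompact_tendstoUniformlyOn.1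
    (G.continuous.tendsto y₀) (Set.Icc (-(n : ℝ)) n) isCompact_Icc
  filter_upwards [Metric.tendstoUniformlyOn_iff.1 hG (ε / 2) (by linarith)] with y hy
  refine lt_of_le_of_lt (locSeminorm_le (ε := ε / 2) fun x hx => ?_) (by linarith)
  have := hy x (abs_le.1 hx)
  rw [dist_comm, dist_eq_norm] at this
  exact this.le

end LocTopology

/-! ### The semigroup `S_t` -/

/-- `‖L_y v - L_{y₀} v₀‖ ≤ C‖v - v₀‖ + ‖L_y v₀ - L_{y₀} v₀‖`: strong continuity and a uniform bound
give joint continuity. -/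
theorem continuous_apply_of_bounded {Y F F' : Type*} [TopologicalSpace Y] [NormedAddCommGroup F]
    [NormedSpace ℝ F] [NormedAddCommGroup F'] [NormedSpace ℝ F'] {L : Y → F →L[ℝ] F'} {C : ℝ}
    (hC : ∀ y, ‖L y‖ ≤ C) (hL : ∀ v, Continuous fun y => L y v) :
    Continuous fun q : Y × F => L q.1 q.2 := by
  rw [continuous_iff_continuousAt]
  rintro ⟨y₀, v₀⟩
  rw [ContinuousAt, tendsto_iff_norm_sub_tendsto_zero]
  have h1 : Filter.Tendsto (fun q : Y × F => C * ‖q.2 - v₀‖ + ‖L q.1 v₀ - L y₀ v₀‖) (𝓝 (y₀, v₀))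
      (𝓝 0) := by
    have c1 : Continuous fun q : Y × F => C * ‖q.2 - v₀‖ + ‖L q.1 v₀ - L y₀ v₀‖ := by
      have := (hL v₀).comp (continuous_fst : Continuous (Prod.fst : Y × F → Y))
      simp only [Function.comp_def] at this
      fun_prop
    have := c1.tendsto (y₀, v₀)
    simpa using this
  refine squeeze_zero (fun _ => norm_nonneg _) (fun q => ?_) h1
  calc ‖L q.1 q.2 - L y₀ v₀‖ = ‖L q.1 (q.2 - v₀) + (L q.1 v₀ - L y₀ v₀)‖ := by
        rw [map_sub]; congr 1; abel
    _ ≤ _ := (norm_add_le _ _).trans (add_le_add ((L q.1).le_of_opNorm_le (hC _) _) le_rfl)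

section Semigroup

variable {α₁ α₂ m : ℝ}

variable (α₁ α₂ m) in
/-- The semigroup `S_t` as a family of bounded operators. -/
def burgersSemigroup (t : ℝ≥0) : XSpace 2 m →L[ℝ] XSpace 2 m :=
  (axialSemigroup (WLp 2 m) t).comp ((planeSemigroup α₁ α₂ m t).compLeftContinuousBounded ℝ)

theorem burgersSemigroup_apply (t : ℝ≥0) (ω : XSpace 2 m) (x : ℝ) :
    burgersSemigroup α₁ α₂ m t ω x = ∫ ξ, heatKernel 1 ξ •
      planeSemigroup α₁ α₂ m t (ω (x * Real.exp (-t) - √(axialVar t) * ξ)) := rfl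

theorem burgersSemigroup_eq (t : ℝ≥0) (ω : XSpace 2 m) :
    burgersSemigroup α₁ α₂ m t ω =
      (planeSemigroup α₁ α₂ m t).compLeftContinuousBounded ℝ (axialSemigroup (WLp 2 m) t ω) :=
  (axialSemigroup_comp _ _ _).symm

theorem tensorDefined_planeKernel (h₁ : 0 < α₁) (h₂ : 0 < α₂) (hm : 0 ≤ m) {t : ℝ} (ht : 0 < t) :
    TensorDefined 2 m (axialKernel t) (planeKernel α₁ α₂ t) := by
  refine ⟨kernelDefined_planeKernel h₁ h₂ hm ht, fun ω x => ?_⟩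
  have h := integrable_smul_comp (integrable_axialKernel ht x)
    ((planeSemigroup α₁ α₂ m t).compLeftContinuousBounded ℝ ω) continuous_id
  refine h.congr (ae_of_all _ fun y => ?_)
  simp only [ContinuousLinearMap.compLeftContinuousBounded_apply, id,
    planeSemigroup_apply h₁ h₂ hm ht]

theorem burgersSemigroup_eq_semigroupS (h₁ : 0 < α₁) (h₂ : 0 < α₂) (hm : 0 ≤ m) (t : ℝ≥0)
    (ω : XSpace 2 m) (x : ℝ) :
    burgersSemigroup α₁ α₂ m t ω x = semigroupS α₁ α₂ (t : ℝ) ω x := by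
  unfold semigroupS
  rcases t.coe_nonneg.eq_or_lt with h | h
  · rw [if_pos h.symm]
    unfold burgersSemigroup
    rw [← h, planeSemigroup_zero, axialSemigroup_zero]
    rfl
  · rw [if_neg h.ne', burgersSemigroup, ContinuousLinearMap.comp_apply,
      axialSemigroup_eq_integral h, tensorOp]
    simp only [ContinuousLinearMap.compLeftContinuousBounded_apply, planeSemigroup_apply h₁ h₂ hm h]

theorem burgersSemigroup_zero :
    burgersSemigroup α₁ α₂ m 0 = ContinuousLinearMap.id ℝ (XSpace 2 m) := by
  ext1 ω
  ext1 x
  rw [burgersSemigroup, NNReal.coe_zero, planeSemigroup_zero, axialSemigroup_zero,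
    ContinuousLinearMap.comp_apply, ContinuousLinearMap.id_apply,
    ContinuousLinearMap.compLeftContinuousBounded_apply, ContinuousLinearMap.id_apply,
    ContinuousLinearMap.id_apply]

/-- The two factors are semigroups and commute, so their product is a semigroup. -/
theorem burgersSemigroup_add (h₁ : 0 < α₁) (h₂ : 0 < α₂) (hm : 0 ≤ m) (s t : ℝ≥0) :
    burgersSemigroup α₁ α₂ m (s + t) =
      (burgersSemigroup α₁ α₂ m s).comp (burgersSemigroup α₁ α₂ m t) := by
  ext1 ω
  rw [ContinuousLinearMap.comp_apply, burgersSemigroup_eq t, burgersSemigroup_eq s,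
    ← axialSemigroup_comp, burgersSemigroup_eq, NNReal.coe_add,
    axialSemigroup_add s.coe_nonneg t.coe_nonneg,
    planeSemigroup_add h₁ h₂ hm s.coe_nonneg t.coe_nonneg]
  ext1 x
  simp only [ContinuousLinearMap.compLeftContinuousBounded_apply, ContinuousLinearMap.comp_apply]

theorem norm_burgersSemigroup_apply_le {t : ℝ≥0} {ω : XSpace 2 m} {C : ℝ} (hC : 0 ≤ C)
    (h : ∀ x, ‖planeSemigroup α₁ α₂ m t (ω x)‖ ≤ C) : ‖burgersSemigroup α₁ α₂ m t ω‖ ≤ C := by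
  have h1 : ‖(planeSemigroup α₁ α₂ m t).compLeftContinuousBounded ℝ ω‖ ≤ C :=
    (BoundedContinuousFunction.norm_le hC).2 h
  calc _ ≤ 1 * ‖(planeSemigroup α₁ α₂ m t).compLeftContinuousBounded ℝ ω‖ :=
        (axialSemigroup (WLp 2 m) t).le_of_opNorm_le (norm_axialSemigroup_le _) _
    _ ≤ C := by rwa [one_mul]

theorem exists_norm_burgersSemigroup_le (h₁ : 0 < α₁) (h₂ : 0 < α₂) (hm : 1 / 2 < m) :
    ∃ C, 0 < C ∧ ∀ t, ‖burgersSemigroup α₁ α₂ m t‖ ≤ C := by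
  -- The value `0` of the time bound is a dummy: the alternative `1/2 < m` covers all times.
  obtain ⟨C, hC, h⟩ := exists_norm_planeSemigroup_le h₁ h₂ (by linarith : 0 ≤ m) 0
  refine ⟨C, hC, fun t => ContinuousLinearMap.opNorm_le_bound _ hC.le fun ω => ?_⟩
  refine norm_burgersSemigroup_apply_le (by positivity) fun x => ?_
  exact ((planeSemigroup α₁ α₂ m t).le_of_opNorm_le (h t t.coe_nonneg (Or.inr hm)) _).trans
    (mul_le_mul_of_nonneg_left (ω.norm_coe_le_norm x) hC.le)

theorem exists_norm_burgersSemigroup_le_of_zeroMean (h₂ : 0 < α₂) (h : α₂ ≤ α₁)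
    (hm : 3 / 2 < m) :
    ∃ C, 0 < C ∧ ∀ ω : XSpace 2 m, ZeroMean ω → ∀ t : ℝ≥0,
      ‖burgersSemigroup α₁ α₂ m t ω‖ ≤ C * Real.exp (-(α₂ / 2) * t) * ‖ω‖ := by
  obtain ⟨C, hC, hb⟩ := exists_norm_planeSemigroup_le_of_zero_mean h₂ h hm
  refine ⟨C, hC, fun ω hω t => norm_burgersSemigroup_apply_le (by positivity) fun x => ?_⟩
  exact (hb t t.coe_nonneg (ω x) (hω x)).trans
    (mul_le_mul_of_nonneg_left (ω.norm_coe_le_norm x) (by positivity))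

theorem continuous_burgersSemigroup (h₁ : 0 < α₁) (h₂ : 0 < α₂) (hm : 0 ≤ m) (ω : XSpace 2 m) :
    Continuous fun q : ℝ≥0 × ℝ => burgersSemigroup α₁ α₂ m q.1 ω q.2 := by
  rw [continuous_iff_continuousAt]
  rintro ⟨t₀, x₀⟩
  set T := t₀ + 1 with hT
  obtain ⟨C, hC, hb⟩ := exists_norm_planeSemigroup_le h₁ h₂ hm T
  -- For `m ≤ 1/2` the planar bound is available only on bounded times. Replacing `t` by `min t T`
  -- makes it hold for every `t` and changes nothing near `t₀`.
  have hb' : ∀ t : ℝ≥0, ‖planeSemigroup α₁ α₂ m (min t T : ℝ≥0)‖ ≤ C := fun t =>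
    hb _ (NNReal.coe_nonneg _) (Or.inl (by exact_mod_cast min_le_right t T))
  have hW : Continuous (Function.uncurry fun (q : ℝ≥0 × ℝ) (y : ℝ) =>
      planeSemigroup α₁ α₂ m (min q.1 T : ℝ≥0) (ω y)) := by
    have h3 := continuous_apply_of_bounded hb' fun v =>
      (continuous_planeSemigroup h₁ h₂ hm v).comp (by fun_prop : Continuous fun t : ℝ≥0 => min t T)
    exact h3.comp (by
      have := ω.continuous
      fun_prop : Continuous fun q : (ℝ≥0 × ℝ) × ℝ => (q.1.1, ω q.2))
  have key := continuous_integral_smul_comp (integrable_heatKernel one_pos)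
    (fun (q : ℝ≥0 × ℝ) (y : ℝ) => planeSemigroup α₁ α₂ m (min q.1 T : ℝ≥0) (ω y)) hW
    (C := C * ‖ω‖) (fun q y => ((planeSemigroup α₁ α₂ m _).le_of_opNorm_le (hb' _) _).trans
      (mul_le_mul_of_nonneg_left (ω.norm_coe_le_norm y) hC.le))
    (φ := fun q ξ => q.2 * Real.exp (-q.1) - √(axialVar q.1) * ξ) (by
      have := continuous_axialVar
      simp only [Function.uncurry_def]
      fun_prop)
  refine key.continuousAt.congr ?_
  have hnear : ∀ᶠ q : ℝ≥0 × ℝ in 𝓝 (t₀, x₀), q.1 < T :=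
    continuous_fst.continuousAt.eventually (eventually_lt_nhds (by simp [hT]))
  filter_upwards [hnear] with q hq
  simp only [min_eq_left hq.le]
  rw [burgersSemigroup_apply]

theorem integrable_heatKernel_mul_abs : Integrable fun ξ => heatKernel 1 ξ * |ξ| := by
  have h := ((integrable_heatKernelD one_pos).norm).const_mul 2
  refine h.congr (ae_of_all _ fun ξ => ?_)
  simp only [heatKernelD, norm_mul, norm_div, Real.norm_eq_abs,
    abs_of_nonneg (heatKernel_nonneg _ _)]
  norm_num
  ring

/-- For `|ξ| ≤ M'` the average sees the difference only on `|y| ≤ n + M'`, where it is small.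
Beyond, the global bound `2R ≤ (2R/M')|ξ|` is paid for by the first moment of the Gaussian. Since
`e^{-t} ≤ 1` and `√(axialVar t) ≤ 1`, the truncation does not depend on `t`. -/
theorem burgersSemigroup_uniform_continuity (h₁ : 0 < α₁) (h₂ : 0 < α₂) (hm : 0 ≤ m) {R : ℝ}
    (hR : 0 < R) (T : ℝ≥0) {V : Set (XSpace 2 m)}
    (hV : V ∈ @nhds _ (locTopology 2 m) (0 : XSpace 2 m)) :
    ∃ U ∈ @nhds _ (locTopology 2 m) (0 : XSpace 2 m), ∀ t : ℝ≥0, t ≤ T →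
      ∀ ω η : XSpace 2 m, ‖ω‖ ≤ R → ‖η‖ ≤ R → ω - η ∈ U →
        burgersSemigroup α₁ α₂ m t ω - burgersSemigroup α₁ α₂ m t η ∈ V := by
  obtain ⟨n, ε, hε, hV⟩ := mem_nhds_locTopology_iff.1 hV
  obtain ⟨C, hC, hb⟩ := exists_norm_planeSemigroup_le h₁ h₂ hm T
  set c : ℝ := ∫ ξ, heatKernel 1 ξ * |ξ| with hc
  have hc0 : 0 ≤ c := integral_nonneg fun ξ => mul_nonneg (heatKernel_nonneg _ _) (abs_nonneg _)
  -- With `M' = M + 1` the tail contributes at most `2RCc/M' ≤ ε/2`; the centre contributes `Cδ =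
  -- ε/2`.
  obtain ⟨M, hM⟩ := exists_nat_gt (4 * R * C * c / ε)
  set δ : ℝ := ε / (2 * C) with hδ
  have hδ0 : 0 < δ := by positivity
  set M' : ℝ := (M : ℝ) + 1 with hM'
  have hM'0 : 0 < M' := by positivity
  obtain ⟨k, hk⟩ : ∃ k : ℕ+, (k : ℕ) = M + 1 := ⟨⟨M + 1, M.succ_pos⟩, rfl⟩
  have hk' : (k : ℝ) = M + 1 := by exact_mod_cast hk
  refine ⟨{ν | ∀ x : ℝ, |x| ≤ n + M' → ‖ν x‖ ≤ δ}, ?_, fun t ht ω η hω hη hU => ?_⟩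
  · refine mem_nhds_locTopology_iff.2 ⟨n + k, δ, hδ0, fun ν hν x hx => hν x ?_⟩
    refine hx.trans (le_of_eq ?_)
    rw [hM', ← hk']
    push_cast
    ring
  · rw [← map_sub]
    refine hV _ fun x hx => ?_
    set ν := ω - η with hν
    have hν2 : ‖ν‖ ≤ 2 * R := (norm_sub_le _ _).trans (by linarith)
    have hpt : ∀ ξ : ℝ, ‖ν (x * Real.exp (-t) - √(axialVar t) * ξ)‖ ≤ δ + 2 * R / M' * |ξ| := by
      intro ξ
      have hlin : |x * Real.exp (-t) - √(axialVar t) * ξ| ≤ n + |ξ| := by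
        refine (abs_sub _ _).trans (add_le_add ?_ ?_)
        · rw [abs_mul, Real.abs_exp]
          refine (mul_le_of_le_one_right (abs_nonneg _) ?_).trans hx
          exact Real.exp_le_one_iff.2 (neg_nonpos.2 t.coe_nonneg)
        · rw [abs_mul, abs_of_nonneg (Real.sqrt_nonneg _)]
          refine mul_le_of_le_one_left (abs_nonneg _) (Real.sqrt_le_one.2 ?_)
          linarith [axialVar_le t]
      rcases le_or_gt |ξ| M' with h | h
      · refine (hU _ (hlin.trans (by linarith))).trans ?_
        exact le_add_of_nonneg_right (by positivity)
      · refine (ν.norm_coe_le_norm _).trans (hν2.trans ?_)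
        have : 2 * R ≤ 2 * R / M' * |ξ| := by
          rw [div_mul_eq_mul_div, le_div_iff₀ hM'0]
          nlinarith
        linarith
    rw [burgersSemigroup_apply]
    have hi : Integrable fun ξ => C * (δ * heatKernel 1 ξ + 2 * R / M' * (heatKernel 1 ξ * |ξ|)) :=
      (((integrable_heatKernel one_pos).const_mul _).add
        (integrable_heatKernel_mul_abs.const_mul _)).const_mul _
    refine (norm_integral_le_of_norm_le hi (ae_of_all _ fun ξ => ?_)).trans ?_
    · rw [norm_smul, Real.norm_of_nonneg (heatKernel_nonneg _ _)]
      have hE := (planeSemigroup α₁ α₂ m t).le_of_opNorm_le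
        (hb t t.coe_nonneg (Or.inl (by exact_mod_cast ht)))
        (ν (x * Real.exp (-t) - √(axialVar t) * ξ))
      calc _ ≤ heatKernel 1 ξ * (C * (δ + 2 * R / M' * |ξ|)) :=
            mul_le_mul_of_nonneg_left (hE.trans (mul_le_mul_of_nonneg_left (hpt ξ) hC.le))
              (heatKernel_nonneg _ _)
        _ = _ := by ring
    · rw [integral_const_mul, integral_add ((integrable_heatKernel one_pos).const_mul _)
        (integrable_heatKernel_mul_abs.const_mul _), integral_const_mul, integral_const_mul,
        integral_heatKernel one_pos, ← hc]
      have h5 : C * (2 * R / M' * c) ≤ ε / 2 := by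
        rw [div_lt_iff₀ hε] at hM
        rw [show C * (2 * R / M' * c) = 2 * R * C * c / M' by ring, div_le_iff₀ hM'0]
        nlinarith
      have h6 : C * (δ * 1) = ε / 2 := by rw [hδ]; field_simp
      rw [mul_add, h6]; linarith

end Semigroup

/-! ### The operators `S_t ∂_k` -/

section TensorCLM

variable {p : ℝ≥0∞} [Fact (1 ≤ p)] {m : ℝ} {k : ℝ → ℝ}

variable (p m) in
/-- The operator `tensorOp g K` for `g(x,y) = k(xβ - y)`, as a bounded operator. -/
def tensorCLM (hk : Integrable k) (β : ℝ) (K : ℝ × ℝ → ℝ × ℝ → ℝ) :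
    XSpace p m →L[ℝ] XSpace 2 m :=
  (averageOp (WLp 2 m) hk β 1).comp ((kernelCLM p m K).compLeftContinuousBounded ℝ)

theorem tensorCLM_apply (hk : Integrable k) (β : ℝ) {K : ℝ × ℝ → ℝ × ℝ → ℝ}
    (hK : ∀ f : WLp p m, kernelCLM p m K f = kernelOp K f) (ω : XSpace p m) (x : ℝ) :
    tensorCLM p m hk β K ω x = tensorOp (fun x y => k (x * β - y)) K ω x := by
  rw [tensorCLM, ContinuousLinearMap.comp_apply, averageOp_apply, tensorOp,
    ← integral_sub_left_eq_self (fun y => k (x * β - y) • (kernelOp K (ω y) : WLp 2 m))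
      volume (x * β)]
  simp only [sub_sub_cancel, one_mul, ContinuousLinearMap.compLeftContinuousBounded_apply, hK]

theorem tensorDefined_of_integrable (hk : Integrable k) (β : ℝ) {K : ℝ × ℝ → ℝ × ℝ → ℝ}
    (hd : KernelDefined p m K) (hK : ∀ f : WLp p m, kernelCLM p m K f = kernelOp K f) :
    TensorDefined p m (fun x y => k (x * β - y)) K := by
  refine ⟨hd, fun ω x => ?_⟩
  have h := integrable_smul_comp (hk.comp_sub_left (x * β))
    ((kernelCLM p m K).compLeftContinuousBounded ℝ ω) continuous_id
  refine h.congr (ae_of_all _ fun y => ?_)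
  simp only [ContinuousLinearMap.compLeftContinuousBounded_apply, id, hK]

theorem norm_tensorCLM_le (hk : Integrable k) (β : ℝ) (K : ℝ × ℝ → ℝ × ℝ → ℝ) {A N : ℝ}
    (hA : ∫ ξ, |k ξ| ≤ A) (hN : ‖kernelCLM p m K‖ ≤ N) (ω : XSpace p m) :
    ‖tensorCLM p m hk β K ω‖ ≤ A * N * ‖ω‖ := by
  have hA0 : 0 ≤ A := (integral_nonneg fun _ => abs_nonneg _).trans hA
  have hN0 : 0 ≤ N := (norm_nonneg _).trans hN
  have h1 : ‖(kernelCLM p m K).compLeftContinuousBounded ℝ ω‖ ≤ N * ‖ω‖ :=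
    (BoundedContinuousFunction.norm_le (by positivity)).2 fun x =>
      ((kernelCLM p m K).le_of_opNorm_le hN _).trans
        (mul_le_mul_of_nonneg_left (ω.norm_coe_le_norm x) hN0)
  rw [mul_assoc]
  exact ((averageOp (WLp 2 m) hk β 1).le_of_opNorm_le
    ((norm_averageOp_le _ _ _).trans hA) _).trans (mul_le_mul_of_nonneg_left h1 hA0)

end TensorCLM

/-- The profile `k` of the axial factor `k(x₃e^{-t} - y₃)` of `S_t ∂_j`. -/
def axialProfile (t : ℝ) : Fin 3 → ℝ → ℝ :=
  ![heatKernel (axialVar t), heatKernel (axialVar t), fun ξ => -heatKernelD (axialVar t) ξ]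

theorem axialFactor_eq (t : ℝ) (j : Fin 3) :
    axialFactor t j = fun x y => axialProfile t j (x * Real.exp (-t) - y) := by
  funext x y
  fin_cases j
  · exact axialKernel_eq t x y
  · exact axialKernel_eq t x y
  · exact axialKernelD_eq t x y

theorem integrable_axialProfile {t : ℝ} (ht : 0 < t) (j : Fin 3) :
    Integrable (axialProfile t j) := by
  fin_cases j
  · exact integrable_heatKernel (axialVar_pos ht)
  · exact integrable_heatKernel (axialVar_pos ht)
  · exact (integrable_heatKernelD (axialVar_pos ht)).neg

/-- The factor in `x₁` of the kernel of `S_t ∂_j`. -/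
def lineFactor₁ (α t : ℝ) : Fin 3 → ℝ → ℝ → ℝ := ![lineKernelD α t, lineKernel α t, lineKernel α t]

/-- The factor in `x₂` of the kernel of `S_t ∂_j`. -/
def lineFactor₂ (α t : ℝ) : Fin 3 → ℝ → ℝ → ℝ := ![lineKernel α t, lineKernelD α t, lineKernel α t]

theorem planeFactor_eq (α₁ α₂ t : ℝ) (j : Fin 3) :
    planeFactor α₁ α₂ t j = tensorKernel (lineFactor₁ α₁ t j) (lineFactor₂ α₂ t j) := by
  fin_cases j
  · exact planeKernelD₁_eq' α₁ α₂ t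
  · exact planeKernelD₂_eq' α₁ α₂ t
  · exact planeKernel_eq α₁ α₂ t

theorem niceKernel_lineFactor₁ {α t : ℝ} (hα : 0 < α) (ht : 0 < t) (j : Fin 3) :
    NiceKernel (lineFactor₁ α t j) := by
  fin_cases j
  exacts [niceKernel_lineKernelD hα ht, niceKernel_lineKernel hα ht, niceKernel_lineKernel hα ht]

theorem niceKernel_lineFactor₂ {α t : ℝ} (hα : 0 < α) (ht : 0 < t) (j : Fin 3) :
    NiceKernel (lineFactor₂ α t j) := by
  fin_cases j
  exacts [niceKernel_lineKernel hα ht, niceKernel_lineKernelD hα ht, niceKernel_lineKernel hα ht]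

theorem exists_lineBound_lineFactor {α₁ α₂ m : ℝ} (h₁ : 0 < α₁) (h₂ : 0 < α₂) (hm : 1 / 2 < m)
    {p : ℝ≥0∞} (hp : 1 ≤ p) (hp2 : p ≤ 2) :
    ∃ r : ℝ, 0 < r ∧ 1 / r + 1 / p.toReal = 3 / 2 ∧ ∃ C, 0 < C ∧ ∀ t, 0 < t →
      let b := fun α => C / aCoeff α t ^ (1 / (2 * p.toReal) - 1 / 4)
      let d := fun α => C * Real.exp (-α * t / 2) / aCoeff α t ^ (1 / (2 * p.toReal) + 1 / 4)
      ∀ j, LineBound m r (lineFactor₁ α₁ t j) (ENNReal.ofReal (![d α₁, b α₁, b α₁] j)) ∧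
        LineBound m r (lineFactor₂ α₂ t j) (ENNReal.ofReal (![b α₂, d α₂, b α₂] j)) := by
  have hpt : p ≠ ⊤ := (hp2.trans_lt (by simp)).ne
  have hq : 1 ≤ p.toReal := by
    rw [← ENNReal.toReal_one]; exact (ENNReal.toReal_le_toReal (by simp) hpt).2 hp
  have hq2 : p.toReal ≤ 2 := by
    have := (ENNReal.toReal_le_toReal hpt (by simp)).2 hp2
    simpa using this
  have hinv : 1 / p.toReal ≤ 1 := by rw [div_le_one (by linarith)]; exact hq
  -- The Schur exponent dual to `p`: it decreases from `2` at `p = 1` to `1` at `p = 2`.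
  set r : ℝ := 1 / (3 / 2 - 1 / p.toReal) with hr
  have hr0 : 0 < r := one_div_pos.2 (by linarith)
  have hqr : 1 / r + 1 / p.toReal = 3 / 2 := by rw [hr, one_div_one_div]; ring
  have hm0 : 0 ≤ m := by linarith
  obtain ⟨C₁, hC₁, b₁⟩ := exists_lineBound_lineKernel h₁ hm0 hq hq2 hr0 hqr 0
  obtain ⟨C₂, hC₂, b₂⟩ := exists_lineBound_lineKernel h₂ hm0 hq hq2 hr0 hqr 0
  refine ⟨r, hr0, hqr, max C₁ C₂, by positivity, fun t ht => ?_⟩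
  have a₁ := aCoeff_pos h₁ ht
  have a₂ := aCoeff_pos h₂ ht
  obtain ⟨u₁, v₁⟩ := b₁ t ht (Or.inr hm)
  obtain ⟨u₂, v₂⟩ := b₂ t ht (Or.inr hm)
  have e₁ := le_max_left C₁ C₂
  have e₂ := le_max_right C₁ C₂
  replace u₁ := u₁.mono hr0.le (N' := ENNReal.ofReal
    (max C₁ C₂ / aCoeff α₁ t ^ (1 / (2 * p.toReal) - 1 / 4)))
    (ENNReal.ofReal_le_ofReal (by gcongr))
  replace u₂ := u₂.mono hr0.le (N' := ENNReal.ofReal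
    (max C₁ C₂ / aCoeff α₂ t ^ (1 / (2 * p.toReal) - 1 / 4)))
    (ENNReal.ofReal_le_ofReal (by gcongr))
  replace v₁ := v₁.mono hr0.le (N' := ENNReal.ofReal
    (max C₁ C₂ * Real.exp (-α₁ * t / 2) / aCoeff α₁ t ^ (1 / (2 * p.toReal) + 1 / 4)))
    (ENNReal.ofReal_le_ofReal (by gcongr))
  replace v₂ := v₂.mono hr0.le (N' := ENNReal.ofReal
    (max C₁ C₂ * Real.exp (-α₂ * t / 2) / aCoeff α₂ t ^ (1 / (2 * p.toReal) + 1 / 4)))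
    (ENNReal.ofReal_le_ofReal (by gcongr))
  intro b d j
  fin_cases j
  exacts [⟨v₁, u₂⟩, ⟨u₁, v₂⟩, ⟨u₁, u₂⟩]

theorem tensorDefined_and_smoothing {α₁ α₂ m : ℝ} (h₁ : 0 < α₁) (h₂ : 0 < α₂) (hm : 1 / 2 < m)
    (p : ℝ≥0∞) [hp : Fact (1 ≤ p)] (hp2 : p ≤ 2) :
    (∀ (t : ℝ) (k : Fin 3), 0 < t →
      TensorDefined p m (axialFactor t k) (planeFactor α₁ α₂ t k)) ∧
    ∃ D : ℝ → Fin 3 → (XSpace p m →L[ℝ] XSpace 2 m),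
      (∀ (t : ℝ) (k : Fin 3), 0 < t → ∀ (ω : XSpace p m) (x₃ : ℝ),
        D t k ω x₃ = tensorOp (axialFactor t k) (planeFactor α₁ α₂ t k) ω x₃) ∧
      ∃ C : ℝ, 0 < C ∧ ∀ (t : ℝ), 0 < t → ∀ ω : XSpace p m,
        ‖D t 0 ω‖ ≤ C * (Real.exp (-α₁ * t / 2) /
          (aCoeff α₁ t ^ (1 / (2 * p.toReal) + 1 / 4) *
            aCoeff α₂ t ^ (1 / (2 * p.toReal) - 1 / 4))) * ‖ω‖ ∧
        ‖D t 1 ω‖ ≤ C * (Real.exp (-α₂ * t / 2) /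
          (aCoeff α₁ t ^ (1 / (2 * p.toReal) - 1 / 4) *
            aCoeff α₂ t ^ (1 / (2 * p.toReal) + 1 / 4))) * ‖ω‖ ∧
        ‖D t 2 ω‖ ≤ C / √(1 - Real.exp (-2 * t)) *
          (1 / (aCoeff α₁ t ^ (1 / (2 * p.toReal) - 1 / 4) *
            aCoeff α₂ t ^ (1 / (2 * p.toReal) - 1 / 4))) * ‖ω‖ := by
  have hm0 : 0 ≤ m := by linarith
  obtain ⟨r, hr, hpr, C, hC, hb⟩ := exists_lineBound_lineFactor h₁ h₂ hm hp.out hp2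
  set b := fun t α => C / aCoeff α t ^ (1 / (2 * p.toReal) - 1 / 4) with hbdef
  set d := fun t α => C * Real.exp (-α * t / 2) / aCoeff α t ^ (1 / (2 * p.toReal) + 1 / 4)
    with hddef
  have hpos : ∀ t, 0 < t → ∀ α, 0 < α → 0 ≤ b t α ∧ 0 ≤ d t α := fun t ht α hα => by
    have := aCoeff_pos hα ht
    exact ⟨by positivity, by positivity⟩
  have hn : ∀ t, 0 < t → ∀ j : Fin 3,
      0 ≤ ![d t α₁, b t α₁, b t α₁] j ∧ 0 ≤ ![b t α₂, d t α₂, b t α₂] j := fun t ht j => by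
    obtain ⟨p1, q1⟩ := hpos t ht α₁ h₁
    obtain ⟨p2, q2⟩ := hpos t ht α₂ h₂
    fin_cases j
    exacts [⟨q1, p2⟩, ⟨p1, q2⟩, ⟨p1, p2⟩]
  have hdef : ∀ t, 0 < t → ∀ j, KernelDefined p m (planeFactor α₁ α₂ t j) := fun t ht j => by
    rw [planeFactor_eq]
    exact kernelDefined_tensorKernel hm0 hp.out hp2 hr hpr (niceKernel_lineFactor₁ h₁ ht j)
      (niceKernel_lineFactor₂ h₂ ht j) (hb t ht j).1 (hb t ht j).2
  have happ : ∀ t, 0 < t → ∀ j (f : WLp p m), kernelCLM p m (planeFactor α₁ α₂ t j) f =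
      kernelOp (planeFactor α₁ α₂ t j) f := fun t ht j f => by
    rw [planeFactor_eq]
    exact kernelCLM_tensorKernel_apply hm0 hp2 hr hpr (niceKernel_lineFactor₁ h₁ ht j)
      (niceKernel_lineFactor₂ h₂ ht j) (hn t ht j).1 (hn t ht j).2 (hb t ht j).1 (hb t ht j).2 f
  have hnorm : ∀ t, 0 < t → ∀ j, ‖kernelCLM p m (planeFactor α₁ α₂ t j)‖ ≤
      ![d t α₁, b t α₁, b t α₁] j * ![b t α₂, d t α₂, b t α₂] j := fun t ht j => by
    rw [planeFactor_eq]
    exact norm_kernelCLM_tensorKernel_le hm0 hp2 hr hpr (niceKernel_lineFactor₁ h₁ ht j)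
      (niceKernel_lineFactor₂ h₂ ht j) (hn t ht j).1 (hn t ht j).2 (hb t ht j).1 (hb t ht j).2
  -- For `t ≤ 0` the operators are `0` by default. In the constant, `C²` comes from the two line
  -- factors, `1` from the unit mass of the axial Gaussian, and `√(8π)√2` from its derivative, since
  -- `axialVar t = (1 - e^{-2t})/2`.
  refine ⟨fun t j ht => ?_, fun t j => if ht : 0 < t then
    tensorCLM p m (integrable_axialProfile ht j) (Real.exp (-t)) (planeFactor α₁ α₂ t j) else 0,
    fun t j ht ω x => ?_, C ^ 2 * (1 + √(8 * Real.pi) * √2), by positivity, fun t ht ω => ?_⟩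
  · rw [axialFactor_eq]
    exact tensorDefined_of_integrable (integrable_axialProfile ht j) _ (hdef t ht j) (happ t ht j)
  · dsimp only
    rw [dif_pos ht, tensorCLM_apply _ _ (happ t ht j), axialFactor_eq]
  · simp only [dif_pos ht]
    have a₁ := aCoeff_pos h₁ ht
    have a₂ := aCoeff_pos h₂ ht
    have c1 : (1 : ℝ) ≤ 1 + √(8 * Real.pi) * √2 := le_add_of_nonneg_right (by positivity)
    refine ⟨?_, ?_, ?_⟩
    · refine (norm_tensorCLM_le (integrable_axialProfile ht 0) _ _
        (integral_abs_heatKernel (axialVar_pos ht)).le (hnorm t ht 0) ω).trans ?_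
      refine mul_le_mul_of_nonneg_right ?_ (norm_nonneg _)
      change 1 * (d t α₁ * b t α₂) ≤ _
      rw [hbdef, hddef]
      dsimp only
      have := mul_le_mul_of_nonneg_right c1 (by positivity : 0 ≤ C ^ 2 * (Real.exp (-α₁ * t / 2) /
          (aCoeff α₁ t ^ (1 / (2 * p.toReal) + 1 / 4) *
            aCoeff α₂ t ^ (1 / (2 * p.toReal) - 1 / 4))))
      refine (le_of_eq ?_).trans (this.trans (le_of_eq ?_))
      · rw [div_mul_div_comm]; ring
      · ring
    · refine (norm_tensorCLM_le (integrable_axialProfile ht 1) _ _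
        (integral_abs_heatKernel (axialVar_pos ht)).le (hnorm t ht 1) ω).trans ?_
      refine mul_le_mul_of_nonneg_right ?_ (norm_nonneg _)
      change 1 * (b t α₁ * d t α₂) ≤ _
      rw [hbdef, hddef]
      dsimp only
      have := mul_le_mul_of_nonneg_right c1 (by positivity : 0 ≤ C ^ 2 * (Real.exp (-α₂ * t / 2) /
          (aCoeff α₁ t ^ (1 / (2 * p.toReal) - 1 / 4) *
            aCoeff α₂ t ^ (1 / (2 * p.toReal) + 1 / 4))))
      refine (le_of_eq ?_).trans (this.trans (le_of_eq ?_))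
      · rw [div_mul_div_comm]; ring
      · ring
    · have hA : ∫ ξ, |axialProfile t 2 ξ| ≤ √(8 * Real.pi) / √(axialVar t) := by
        change ∫ ξ, |-heatKernelD (axialVar t) ξ| ≤ _
        simp_rw [abs_neg]
        exact integral_abs_heatKernelD_le (axialVar_pos ht)
      refine (norm_tensorCLM_le (integrable_axialProfile ht 2) _ _ hA (hnorm t ht 2) ω).trans ?_
      refine mul_le_mul_of_nonneg_right ?_ (norm_nonneg _)
      change _ * (b t α₁ * b t α₂) ≤ _
      rw [hbdef]
      dsimp only
      rw [axialVar, Real.sqrt_div' _ zero_le_two, div_div_eq_mul_div]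
      have hE : 0 < 1 - Real.exp (-2 * t) := by
        have := axialVar_pos ht
        rw [axialVar] at this
        linarith
      have c2 : √(8 * Real.pi) * √2 ≤ 1 + √(8 * Real.pi) * √2 := le_add_of_nonneg_left zero_le_one
      have := mul_le_mul_of_nonneg_right c2 (by positivity :
        0 ≤ C ^ 2 / √(1 - Real.exp (-2 * t)) * (1 / (aCoeff α₁ t ^ (1 / (2 * p.toReal) - 1 / 4) *
            aCoeff α₂ t ^ (1 / (2 * p.toReal) - 1 / 4))))
      refine (le_of_eq ?_).trans (this.trans (le_of_eq ?_))
      · rw [div_mul_div_comm]; ring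
      · ring

/-! ### Smoothness of exponential families -/

section ExpFamily

variable {W : Type*} [MeasurableSpace W] {μ : Measure W} {E : Type} [NormedAddCommGroup E]
  [NormedSpace ℝ E] {T : W → E →L[ℝ] ℝ}

/-- The integral `∫ exp(T w θ) P(w) dμ(w)` converges together with all its `θ`-derivatives. -/
def ExpIntegrable {F : Type*} [NormedAddCommGroup F] (μ : Measure W) (T : W → E →L[ℝ] ℝ)
    (P : W → F) (θ : E) : Prop :=
  AEStronglyMeasurable P μ ∧
    ∃ ε, 0 < ε ∧ Integrable (fun w => Real.exp (T w θ + ε * ‖T w‖) * ‖P w‖) μ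

variable {F : Type} [NormedAddCommGroup F] [NormedSpace ℝ F] {P : W → F} {θ : E}

theorem aestronglyMeasurable_exp (hT : AEStronglyMeasurable T μ) (θ : E) :
    AEStronglyMeasurable (fun w => Real.exp (T w θ)) μ :=
  Real.continuous_exp.comp_aestronglyMeasurable
    ((ContinuousLinearMap.apply ℝ ℝ θ).continuous.comp_aestronglyMeasurable hT)

theorem ExpIntegrable.integrable (h : ExpIntegrable μ T P θ) (hT : AEStronglyMeasurable T μ) :
    Integrable (fun w => Real.exp (T w θ) • P w) μ := by
  obtain ⟨hP, ε, hε, hi⟩ := h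
  refine hi.mono' ((aestronglyMeasurable_exp hT θ).smul hP) (ae_of_all _ fun w => ?_)
  rw [norm_smul, Real.norm_of_nonneg (Real.exp_pos _).le]
  gcongr
  exact le_add_of_nonneg_right (by positivity)

theorem mul_exp_le {ε x : ℝ} (hε : 0 < ε) : x ≤ 2 / ε * Real.exp (ε / 2 * x) := by
  have h := Real.add_one_le_exp (ε / 2 * x)
  rw [div_mul_eq_mul_div, le_div_iff₀ hε]
  linarith

/-- Half of the margin `ε` absorbs the extra factor `‖T w‖`, so the class is stable under
differentiation in `θ`. -/
theorem ExpIntegrable.smulRight (h : ExpIntegrable μ T P θ) (hT : AEStronglyMeasurable T μ) :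
    ExpIntegrable μ T (fun w => (T w).smulRight (P w)) θ := by
  obtain ⟨hP, ε, hε, hi⟩ := h
  have hm : AEStronglyMeasurable (fun w => (T w).smulRight (P w)) μ :=
    (ContinuousLinearMap.smulRightL ℝ E F).aestronglyMeasurable_comp₂ hT hP
  refine ⟨hm, ε / 2, by positivity, (hi.const_mul (2 / ε)).mono' ?_ (ae_of_all _ fun w => ?_)⟩
  · refine AEStronglyMeasurable.mul (Real.continuous_exp.comp_aestronglyMeasurable ?_) hm.norm
    exact ((ContinuousLinearMap.apply ℝ ℝ θ).continuous.comp_aestronglyMeasurable hT).add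
      (hT.norm.const_mul _)
  · rw [norm_mul, Real.norm_of_nonneg (Real.exp_pos _).le, norm_norm,
      ContinuousLinearMap.norm_smulRight_apply]
    have e : Real.exp (T w θ + ε * ‖T w‖) =
        Real.exp (T w θ + ε / 2 * ‖T w‖) * Real.exp (ε / 2 * ‖T w‖) := by
      rw [← Real.exp_add]; congr 1; ring
    rw [e]
    calc _ ≤ Real.exp (T w θ + ε / 2 * ‖T w‖) *
          (2 / ε * Real.exp (ε / 2 * ‖T w‖) * ‖P w‖) := by
          gcongr; exact mul_exp_le hε
      _ = _ := by ring

/-- On a ball of radius `ε` around `θ` one has `T w η ≤ T w θ + ε‖T w‖`, so the margin in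
`ExpIntegrable` is exactly a majorant for the differentiated integrand. -/
theorem ExpIntegrable.hasFDerivAt (h : ExpIntegrable μ T P θ) (hT : AEStronglyMeasurable T μ) :
    HasFDerivAt (fun θ => ∫ w, Real.exp (T w θ) • P w ∂μ)
      (∫ w, Real.exp (T w θ) • (T w).smulRight (P w) ∂μ) θ := by
  have h' := h.smulRight hT
  obtain ⟨hm, ε, hε, hi⟩ := h'
  refine hasFDerivAt_integral_of_dominated_of_fderiv_le (s := Metric.ball θ ε)
    (F' := fun θ w => Real.exp (T w θ) • (T w).smulRight (P w)) (Metric.ball_mem_nhds θ hε)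
    (Filter.Eventually.of_forall fun η => (aestronglyMeasurable_exp hT η).smul h.1)
    (h.integrable hT) ((aestronglyMeasurable_exp hT θ).smul hm) (ae_of_all _ fun w η hη => ?_) hi
    (ae_of_all _ fun w η _ => ?_)
  · rw [norm_smul, Real.norm_of_nonneg (Real.exp_pos _).le]
    gcongr
    have h1 : T w (η - θ) ≤ ‖T w‖ * ‖η - θ‖ := (le_abs_self _).trans ((T w).le_opNorm _)
    rw [map_sub] at h1
    have h2 : ‖η - θ‖ ≤ ε := (mem_ball_iff_norm.1 hη).le
    nlinarith [norm_nonneg (T w)]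
  · have h1 : HasFDerivAt (fun η => Real.exp (T w η)) (Real.exp (T w η) • T w) η :=
      (T w).hasFDerivAt.exp
    refine (h1.smul_const (P w)).congr_fderiv ?_
    ext v
    simp [smul_smul]

/-- The derivative is an integral of the same kind with amplitude `T ⊗ P`, valued in `E →L[ℝ] F`.
The induction therefore runs over all target spaces at once. -/
theorem contDiffOn_integral_exp (hT : AEStronglyMeasurable T μ) {Ω : Set E} (hΩ : IsOpen Ω)
    (n : ℕ) : ∀ {F : Type} [NormedAddCommGroup F] [NormedSpace ℝ F] {P : W → F},
      (∀ θ ∈ Ω, ExpIntegrable μ T P θ) →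
      ContDiffOn ℝ n (fun θ => ∫ w, Real.exp (T w θ) • P w ∂μ) Ω := by
  induction n with
  | zero =>
    intro F _ _ P h
    exact contDiffOn_zero.2 fun θ hθ =>
      ((h θ hθ).hasFDerivAt hT).continuousAt.continuousWithinAt
  | succ n ih =>
    intro F _ _ P h
    rw [Nat.cast_add, Nat.cast_one, contDiffOn_succ_iff_fderiv_of_isOpen hΩ]
    refine ⟨fun θ hθ => ((h θ hθ).hasFDerivAt hT).differentiableAt.differentiableWithinAt,
      fun hω => by simp at hω, ?_⟩
    exact (ih fun θ hθ => (h θ hθ).smulRight hT).congr fun θ hθ => ((h θ hθ).hasFDerivAt hT).fderiv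

end ExpFamily

/-! ### Gaussian moments -/

section GaussMoment

variable {W ι : Type} [MeasurableSpace W] [Fintype ι] {μ : Measure W} {ξ : W → ι → ℝ}

/-- The linear form `θ ↦ ∑ i, (θ i).1 + ξᵢ (θ i).2.1 + ξᵢ² (θ i).2.2`. -/
def quadForm (ξ : ι → ℝ) : (ι → ℝ × ℝ × ℝ) →L[ℝ] ℝ :=
  ∑ i, (ContinuousLinearMap.fst ℝ ℝ (ℝ × ℝ) +
    ξ i • (ContinuousLinearMap.fst ℝ ℝ ℝ).comp (ContinuousLinearMap.snd ℝ ℝ (ℝ × ℝ)) +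
    ξ i ^ 2 • (ContinuousLinearMap.snd ℝ ℝ ℝ).comp (ContinuousLinearMap.snd ℝ ℝ (ℝ × ℝ))).comp
      (ContinuousLinearMap.proj i)

theorem quadForm_apply (ξ : ι → ℝ) (θ : ι → ℝ × ℝ × ℝ) :
    quadForm ξ θ = ∑ i, ((θ i).1 + ξ i * (θ i).2.1 + ξ i ^ 2 * (θ i).2.2) := by
  simp [quadForm]

theorem norm_quadForm_le (ξ : ι → ℝ) : ‖quadForm ξ‖ ≤ ∑ i, (1 + |ξ i| + ξ i ^ 2) := by
  refine ContinuousLinearMap.opNorm_le_bound _ (Finset.sum_nonneg fun i _ => by positivity)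
    fun θ => ?_
  rw [quadForm_apply, Finset.sum_mul]
  refine (norm_sum_le _ _).trans (Finset.sum_le_sum fun i _ => ?_)
  have h0 := norm_le_pi_norm θ i
  have h1 := (norm_fst_le (θ i)).trans h0
  have h2 := (norm_snd_le (θ i)).trans h0
  have h3 := (norm_fst_le (θ i).2).trans h2
  have h4 := (norm_snd_le (θ i).2).trans h2
  rw [Real.norm_eq_abs] at h1 h3 h4
  calc ‖(θ i).1 + ξ i * (θ i).2.1 + ξ i ^ 2 * (θ i).2.2‖
      ≤ |(θ i).1| + |ξ i| * |(θ i).2.1| + ξ i ^ 2 * |(θ i).2.2| := by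
        rw [Real.norm_eq_abs]
        refine (abs_add_three _ _ _).trans ?_
        rw [abs_mul, abs_mul, abs_of_nonneg (sq_nonneg (ξ i))]
    _ ≤ ‖θ‖ + |ξ i| * ‖θ‖ + ξ i ^ 2 * ‖θ‖ := by gcongr
    _ = _ := by ring

theorem aestronglyMeasurable_quadForm (hξ : Measurable ξ) :
    AEStronglyMeasurable (fun w => quadForm (ξ w)) μ := by
  have : Continuous (quadForm : (ι → ℝ) → (ι → ℝ × ℝ × ℝ) →L[ℝ] ℝ) := by
    unfold quadForm
    fun_prop
  exact this.comp_aestronglyMeasurable hξ.aestronglyMeasurable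

/-- Integrability of `P` against all Gaussians in `ξ`. -/
def GaussIntegrable (μ : Measure W) (ξ : W → ι → ℝ) (P : W → ℝ) : Prop :=
  AEStronglyMeasurable P μ ∧
    ∀ ε, 0 < ε → Integrable (fun w => Real.exp (-ε * ∑ i, ξ w i ^ 2) * P w) μ

variable {P : W → ℝ}

theorem GaussIntegrable.coord_mul (h : GaussIntegrable μ ξ P) (hξ : Measurable ξ) (i : ι) :
    GaussIntegrable μ ξ fun w => ξ w i * P w := by
  have hi : Measurable fun w => ξ w i := measurable_pi_iff.1 hξ i
  have hm : AEStronglyMeasurable (fun w => ξ w i * P w) μ := hi.aestronglyMeasurable.mul h.1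
  refine ⟨hm, fun ε hε => ((h.2 (ε / 2) (by positivity)).norm.const_mul (1 + 2 / ε)).mono' ?_
    (ae_of_all _ fun w => ?_)⟩
  · refine AEStronglyMeasurable.mul (Measurable.aestronglyMeasurable ?_) hm
    fun_prop
  · simp only [norm_mul, Real.norm_of_nonneg (Real.exp_pos _).le, Real.norm_eq_abs]
    set S := ∑ j, ξ w j ^ 2 with hS
    have h1 : ξ w i ^ 2 ≤ S := Finset.single_le_sum (f := fun j => ξ w j ^ 2)
      (fun j _ => sq_nonneg _) (Finset.mem_univ i)
    have h2 : |ξ w i| ≤ 1 + S := by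
      nlinarith [sq_abs (ξ w i), sq_nonneg (|ξ w i| - 1), abs_nonneg (ξ w i)]
    have h3 : |ξ w i| ≤ (1 + 2 / ε) * Real.exp (ε / 2 * S) := by
      have hS0 : 0 ≤ S := (sq_nonneg _).trans h1
      have h4 : 1 ≤ Real.exp (ε / 2 * S) := Real.one_le_exp (by positivity)
      have h5 := mul_exp_le (x := S) hε
      linarith
    have e : Real.exp (-(ε / 2) * S) = Real.exp (-ε * S) * Real.exp (ε / 2 * S) := by
      rw [← Real.exp_add]; congr 1; ring
    rw [e]
    calc _ ≤ Real.exp (-ε * S) * ((1 + 2 / ε) * Real.exp (ε / 2 * S) * |P w|) := by gcongr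
      _ = _ := by ring

theorem GaussIntegrable.expIntegrable (h : GaussIntegrable μ ξ P) (hξ : Measurable ξ)
    {θ : ι → ℝ × ℝ × ℝ} (hθ : ∀ i, (θ i).2.2 < 0) :
    ExpIntegrable μ (fun w => quadForm (ξ w)) P θ := by
  -- Of the `4δ` available in each quadratic coefficient, one `δ` pays for the quadratic part of
  -- `δ‖T‖`, two for the linear terms by Young's inequality, and one remains as the Gaussian of
  -- `GaussIntegrable`.
  obtain ⟨δ, hδ, hδ0⟩ : ∃ δ : ℝ, (∀ i, 4 * δ < -(θ i).2.2) ∧ 0 < δ := by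
    have h1 : ∀ᶠ δ : ℝ in 𝓝[>] 0, ∀ i, 4 * δ < -(θ i).2.2 := by
      refine Filter.eventually_all.2 fun i => ?_
      have : Filter.Tendsto (fun δ : ℝ => 4 * δ) (𝓝[>] 0) (𝓝 (4 * 0)) :=
        ((continuous_const.mul continuous_id).tendsto 0).mono_left nhdsWithin_le_nhds
      exact this.eventually (eventually_lt_nhds (by linarith [hθ i]))
    exact (h1.and self_mem_nhdsWithin).exists
  have hm := aestronglyMeasurable_quadForm (μ := μ) hξ
  set C := ∑ i, ((θ i).1 + δ + (|(θ i).2.1| + δ) ^ 2 / δ) with hC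
  refine ⟨h.1, δ, hδ0, ((h.2 δ hδ0).norm.const_mul (Real.exp C)).mono' ?_
    (ae_of_all _ fun w => ?_)⟩
  · refine AEStronglyMeasurable.mul (Real.continuous_exp.comp_aestronglyMeasurable ?_) h.1.norm
    exact ((ContinuousLinearMap.apply ℝ ℝ θ).continuous.comp_aestronglyMeasurable hm).add
      (hm.norm.const_mul _)
  · simp only [norm_mul, Real.norm_of_nonneg (Real.exp_pos _).le, norm_norm]
    rw [← mul_assoc, ← Real.exp_add]
    refine mul_le_mul_of_nonneg_right (Real.exp_le_exp.2 ?_) (norm_nonneg _)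
    have h1 := mul_le_mul_of_nonneg_left (norm_quadForm_le (ξ w)) hδ0.le
    refine (add_le_add le_rfl h1).trans ?_
    rw [quadForm_apply, Finset.mul_sum, hC, Finset.mul_sum, ← Finset.sum_add_distrib,
      ← Finset.sum_add_distrib]
    refine Finset.sum_le_sum fun i _ => ?_
    have h2 : ξ w i * (θ i).2.1 ≤ |(θ i).2.1| * |ξ w i| := by
      rw [mul_comm, ← abs_mul]; exact le_abs_self _
    have h3 : ξ w i ^ 2 * (θ i).2.2 ≤ ξ w i ^ 2 * (-(4 * δ)) :=
      mul_le_mul_of_nonneg_left (by linarith [hδ i]) (sq_nonneg _)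
    set M := |(θ i).2.1| + δ with hM
    have h4 : M * |ξ w i| ≤ M ^ 2 / δ + 2 * δ * ξ w i ^ 2 := by
      have h5 : M ^ 2 / δ = (M / δ) ^ 2 * δ := by field_simp
      have h6 : M * |ξ w i| = (M / δ) * |ξ w i| * δ := by field_simp
      rw [h5, h6, ← sq_abs (ξ w i)]
      nlinarith [mul_nonneg hδ0.le (sq_nonneg (M / δ - |ξ w i|)),
        mul_nonneg hδ0.le (sq_nonneg (M / δ)), mul_nonneg hδ0.le (sq_nonneg |ξ w i|)]
    have h7 : M * |ξ w i| = |(θ i).2.1| * |ξ w i| + δ * |ξ w i| := by rw [hM]; ring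
    nlinarith

/-- The integral of `P` against the exponential of a quadratic form in `ξ`. -/
def gaussMoment (μ : Measure W) (ξ : W → ι → ℝ) (P : W → ℝ) (θ : ι → ℝ × ℝ × ℝ) : ℝ :=
  ∫ w, Real.exp (quadForm (ξ w) θ) • P w ∂μ

/-- Chain rule: differentiating the exponent brings down only `1`, `ξᵢ` and `ξᵢ²`, so the derivative
is a combination of the first three moments in each coordinate. -/
theorem hasDerivAt_gaussMoment (h : GaussIntegrable μ ξ P) (hξ : Measurable ξ)
    {θ : ℝ → ι → ℝ × ℝ × ℝ} {θ' : ι → ℝ × ℝ × ℝ} {s : ℝ} (hθ : ∀ i, (θ s i).2.2 < 0)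
    (hd : ∀ i, HasDerivAt (fun s => θ s i) (θ' i) s) :
    HasDerivAt (fun s => gaussMoment μ ξ P (θ s))
      (∑ i, ((θ' i).1 * gaussMoment μ ξ P (θ s) +
        (θ' i).2.1 * gaussMoment μ ξ (fun w => ξ w i * P w) (θ s) +
        (θ' i).2.2 * gaussMoment μ ξ (fun w => ξ w i * (ξ w i * P w)) (θ s))) s := by
  have hT := aestronglyMeasurable_quadForm (μ := μ) hξ
  have h1 := ((h.expIntegrable hξ hθ).hasFDerivAt hT).comp_hasDerivAt s (hasDerivAt_pi.2 hd)
  refine h1.congr_deriv ?_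
  rw [ContinuousLinearMap.integral_apply (((h.expIntegrable hξ hθ).smulRight hT).integrable hT)]
  have i1 := fun i => (h.expIntegrable hξ hθ).integrable hT |>.const_mul (θ' i).1
  have i2 := fun i => ((h.coord_mul hξ i).expIntegrable hξ hθ).integrable hT |>.const_mul (θ' i).2.1
  have i3 := fun i => (((h.coord_mul hξ i).coord_mul hξ i).expIntegrable hξ hθ).integrable hT
    |>.const_mul (θ' i).2.2
  have e : ∀ w, (Real.exp (quadForm (ξ w) (θ s)) • (quadForm (ξ w)).smulRight (P w)) θ' =
      ∑ i, ((θ' i).1 * Real.exp (quadForm (ξ w) (θ s)) • P w +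
        (θ' i).2.1 * Real.exp (quadForm (ξ w) (θ s)) • (ξ w i * P w) +
        (θ' i).2.2 * Real.exp (quadForm (ξ w) (θ s)) • (ξ w i * (ξ w i * P w))) := by
    intro w
    simp only [_root_.smul_apply, ContinuousLinearMap.smulRight_apply,
      quadForm_apply _ θ', smul_eq_mul]
    rw [Finset.sum_mul, Finset.mul_sum]
    exact Finset.sum_congr rfl fun i _ => by ring
  simp_rw [e]
  refine (integral_finsetSum _ fun i _ => ((i1 i).add (i2 i)).add (i3 i)).trans ?_
  refine Finset.sum_congr rfl fun i _ => ?_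
  refine (integral_add ((i1 i).add (i2 i)) (i3 i)).trans ?_
  rw [integral_add' (i1 i) (i2 i), integral_const_mul, integral_const_mul, integral_const_mul]
  rfl

theorem contDiffAt_gaussMoment (h : GaussIntegrable μ ξ P) (hξ : Measurable ξ)
    {θ : ι → ℝ × ℝ × ℝ} (hθ : ∀ i, (θ i).2.2 < 0) (n : ℕ) :
    ContDiffAt ℝ n (gaussMoment μ ξ P) θ := by
  have hΩ : IsOpen {θ : ι → ℝ × ℝ × ℝ | ∀ i, (θ i).2.2 < 0} := by
    simp only [Set.ofPred_forall]
    exact isOpen_iInter_of_finite fun i => isOpen_lt (by fun_prop) continuous_const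
  exact (contDiffOn_integral_exp (aestronglyMeasurable_quadForm hξ) hΩ n
    fun θ hθ => h.expIntegrable hξ hθ).contDiffAt (hΩ.mem_nhds hθ)

end GaussMoment

/-! ### The Gaussian kernels as exponential families -/

/-- Negative `α` is admitted because the axial factor is treated below as the case `α = -2`. -/
theorem aCoeff_pos_of_ne_zero {α t : ℝ} (hα : α ≠ 0) (ht : 0 < t) : 0 < aCoeff α t := by
  rcases hα.lt_or_gt with h | h
  · unfold aCoeff
    have : 1 < Real.exp (-α * t) := Real.one_lt_exp_iff.2 (by nlinarith)
    exact div_pos_of_neg_of_neg (by linarith) h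
  · exact aCoeff_pos h ht

/-- The coefficients of the exponent of `lineKernel α t x` as a quadratic polynomial. -/
def lineParam (α t x : ℝ) : ℝ × ℝ × ℝ :=
  (-(Real.log (4 * Real.pi * aCoeff α t) / 2) - x ^ 2 / (4 * aCoeff α t),
    Real.exp (-α * t / 2) * x / (2 * aCoeff α t), -(Real.exp (-α * t / 2) ^ 2 / (4 * aCoeff α t)))

theorem lineKernel_eq_exp {α t : ℝ} (hα : α ≠ 0) (ht : 0 < t) (x w : ℝ) :
    lineKernel α t x w = Real.exp ((lineParam α t x).1 + w * (lineParam α t x).2.1 +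
      w ^ 2 * (lineParam α t x).2.2) := by
  have ha := aCoeff_pos_of_ne_zero hα ht
  have h1 : 1 / √(4 * Real.pi * aCoeff α t) =
      Real.exp (-(Real.log (4 * Real.pi * aCoeff α t) / 2)) := by
    rw [Real.exp_neg, Real.exp_half, Real.exp_log (by positivity), one_div]
  rw [lineKernel, h1, ← Real.exp_add]
  congr 1
  simp only [lineParam]
  field_simp
  ring

theorem lineParam_neg {α t : ℝ} (hα : α ≠ 0) (ht : 0 < t) (x : ℝ) :
    (lineParam α t x).2.2 < 0 := by
  have ha := aCoeff_pos_of_ne_zero hα ht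
  exact neg_neg_of_pos (by positivity)

theorem exp_half_sq (α t : ℝ) : Real.exp (-α * t / 2) ^ 2 = Real.exp (-α * t) := by
  rw [← Real.exp_nat_mul]; congr 1; push_cast; ring

theorem hasDerivAt_lineParam_right (α t x : ℝ) :
    HasDerivAt (lineParam α t)
      (-(x / (2 * aCoeff α t)), Real.exp (-α * t / 2) / (2 * aCoeff α t), 0) x := by
  refine HasDerivAt.prodMk ?_ (HasDerivAt.prodMk ?_ (hasDerivAt_const _ _))
  · refine (((hasDerivAt_pow 2 x).div_const (4 * aCoeff α t)).const_sub _).congr_deriv ?_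
    rw [show (4 : ℝ) * aCoeff α t = 2 * (2 * aCoeff α t) by ring]
    push_cast
    rw [pow_one, mul_div_mul_left _ _ two_ne_zero]
  · refine (((hasDerivAt_id x).const_mul (Real.exp (-α * t / 2))).div_const _).congr_deriv ?_
    rw [mul_one]

theorem hasDerivAt_aCoeff {α : ℝ} (hα : α ≠ 0) (t : ℝ) :
    HasDerivAt (aCoeff α) (Real.exp (-α * t / 2) ^ 2) t := by
  rw [exp_half_sq]
  have h := ((((hasDerivAt_id t).const_mul (-α)).exp).const_sub 1).div_const α
  refine h.congr_deriv ?_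
  simp only [id]
  field_simp

/-- Everything follows from `a' = β²` and `β' = -(α/2)β`. -/
theorem hasDerivAt_lineParam_left {α t : ℝ} (hα : α ≠ 0) (ht : 0 < t) (x : ℝ) :
    let a := aCoeff α t
    let β := Real.exp (-α * t / 2)
    HasDerivAt (fun t => lineParam α t x) (-(β ^ 2 / (2 * a)) + x ^ 2 * β ^ 2 / (4 * a ^ 2),
      -(α * β * x / (4 * a)) - β ^ 3 * x / (2 * a ^ 2),
      α * β ^ 2 / (4 * a) + β ^ 4 / (4 * a ^ 2)) t := by
  intro a β
  have ha : 0 < a := aCoeff_pos_of_ne_zero hα ht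
  have da : HasDerivAt (aCoeff α) (β ^ 2) t := hasDerivAt_aCoeff hα t
  have dβ : HasDerivAt (fun t => Real.exp (-α * t / 2)) (-(α / 2) * β) t := by
    refine (((hasDerivAt_id t).const_mul (-α)).div_const 2).exp.congr_deriv ?_
    simp only [id]
    ring
  refine HasDerivAt.prodMk ?_ (HasDerivAt.prodMk ?_ ?_)
  · have h1 := ((da.const_mul (4 * Real.pi)).log (by positivity)).div_const 2
    have h2 := (hasDerivAt_const t (x ^ 2)).div (da.const_mul 4) (by positivity)
    refine (h1.neg.sub h2).congr_deriv ?_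
    change -(4 * Real.pi * β ^ 2 / (4 * Real.pi * a) / 2) -
      (0 * (4 * a) - x ^ 2 * (4 * β ^ 2)) / (4 * a) ^ 2 = _
    field_simp
    ring
  · refine ((dβ.mul_const x).div (da.const_mul 2) (by positivity)).congr_deriv ?_
    change (-(α / 2) * β * x * (2 * a) - β * x * (2 * β ^ 2)) / (2 * a) ^ 2 = _
    field_simp
    ring
  · refine ((dβ.pow 2).div (da.const_mul 4) (by positivity)).neg.congr_deriv ?_
    change -((((2 : ℕ) : ℝ) * β ^ (2 - 1) * (-(α / 2) * β) * (4 * a) - β ^ 2 * (4 * β ^ 2)) /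
      (4 * a) ^ 2) = _
    push_cast
    field_simp
    ring

theorem contDiffAt_lineParam {α : ℝ} (hα : α ≠ 0) {q : ℝ × ℝ} (hq : 0 < q.1) (n : ℕ) :
    ContDiffAt ℝ n (fun q : ℝ × ℝ => lineParam α q.1 q.2) q := by
  have ha := aCoeff_pos_of_ne_zero hα hq
  have da : ContDiffAt ℝ n (fun q : ℝ × ℝ => aCoeff α q.1) q := by
    unfold aCoeff; fun_prop
  have dβ : ContDiffAt ℝ n (fun q : ℝ × ℝ => Real.exp (-α * q.1 / 2)) q := by fun_prop
  have dx : ContDiffAt ℝ n (fun q : ℝ × ℝ => q.2) q := contDiffAt_snd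
  have d4 : ContDiffAt ℝ n (fun q : ℝ × ℝ => 4 * aCoeff α q.1) q := contDiffAt_const.mul da
  refine ContDiffAt.prodMk ?_ (ContDiffAt.prodMk ?_ ?_)
  · exact (((contDiffAt_const.mul da).log (by positivity)).div_const 2).neg.sub
      ((dx.pow 2).div d4 (by positivity))
  · exact (dβ.mul dx).div (contDiffAt_const.mul da) (by positivity)
  · exact ((dβ.pow 2).div d4 (by positivity)).neg

section GaussSolution

variable {W ι : Type} [MeasurableSpace W] [Fintype ι] {μ : Measure W} {ξ : W → ι → ℝ}
  {P : W → ℝ} {α : ι → ℝ}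

/-- The function `∫ ∏ i, lineKernel (α i) t (x i) (ξ i) P dμ` of `t` and `x`. -/
def gaussSolution (μ : Measure W) (ξ : W → ι → ℝ) (α : ι → ℝ) (P : W → ℝ) (t : ℝ) (x : ι → ℝ) :
    ℝ :=
  gaussMoment μ ξ P fun i => lineParam (α i) t (x i)

theorem gaussSolution_eq (hα : ∀ i, α i ≠ 0) {t : ℝ} (ht : 0 < t) (x : ι → ℝ) :
    gaussSolution μ ξ α P t x = ∫ w, (∏ i, lineKernel (α i) t (x i) (ξ w i)) * P w ∂μ := by
  unfold gaussSolution gaussMoment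
  refine integral_congr_ae (ae_of_all _ fun w => ?_)
  simp only [quadForm_apply, Real.exp_sum, smul_eq_mul, lineKernel_eq_exp (hα _) ht]

theorem hasDerivAt_gaussSolution_time (h : GaussIntegrable μ ξ P) (hξ : Measurable ξ)
    (hα : ∀ i, α i ≠ 0) {t : ℝ} (ht : 0 < t) (x : ι → ℝ) :
    let a := fun i => aCoeff (α i) t
    let β := fun i => Real.exp (-α i * t / 2)
    HasDerivAt (fun t => gaussSolution μ ξ α P t x)
      (∑ i, ((-(β i ^ 2 / (2 * a i)) + x i ^ 2 * β i ^ 2 / (4 * a i ^ 2)) *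
          gaussSolution μ ξ α P t x +
        (-(α i * β i * x i / (4 * a i)) - β i ^ 3 * x i / (2 * a i ^ 2)) *
          gaussSolution μ ξ α (fun w => ξ w i * P w) t x +
        (α i * β i ^ 2 / (4 * a i) + β i ^ 4 / (4 * a i ^ 2)) *
          gaussSolution μ ξ α (fun w => ξ w i * (ξ w i * P w)) t x)) t :=
  hasDerivAt_gaussMoment h hξ (θ := fun t i => lineParam (α i) t (x i))
    (fun i => lineParam_neg (hα i) ht _) fun i => hasDerivAt_lineParam_left (hα i) ht (x i)

theorem hasDerivAt_gaussSolution_space [DecidableEq ι] (h : GaussIntegrable μ ξ P)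
    (hξ : Measurable ξ) (hα : ∀ i, α i ≠ 0) {t : ℝ} (ht : 0 < t) (x : ι → ℝ) (i : ι) (s : ℝ) :
    HasDerivAt (fun s => gaussSolution μ ξ α P t (Function.update x i s))
      (Real.exp (-α i * t / 2) / (2 * aCoeff (α i) t) *
          gaussSolution μ ξ α (fun w => ξ w i * P w) t (Function.update x i s) -
        s / (2 * aCoeff (α i) t) * gaussSolution μ ξ α P t (Function.update x i s)) s := by
  have hd := hasDerivAt_gaussMoment h hξ
    (θ := fun s j => lineParam (α j) t (Function.update x i s j))
    (θ' := Pi.single i (-(s / (2 * aCoeff (α i) t)),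
      Real.exp (-α i * t / 2) / (2 * aCoeff (α i) t), 0)) (s := s)
    (fun j => lineParam_neg (hα j) ht _) fun j => by
      rcases eq_or_ne j i with rfl | hj
      · simpa using hasDerivAt_lineParam_right (α j) t s
      · simpa [hj] using hasDerivAt_const s _
  refine hd.congr_deriv ?_
  rw [Finset.sum_eq_single i (fun j _ hj => by simp [hj]) (by simp)]
  simp only [Pi.single_eq_same]
  unfold gaussSolution
  ring

/-- The equation holds coordinate by coordinate: both sides are combinations of the moments of order
0, 1, 2 in `ξᵢ`, and their coefficients agree because `αᵢ a = 1 - β²`. -/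
theorem gaussSolution_pde [DecidableEq ι] (h : GaussIntegrable μ ξ P)
    (hξ : Measurable ξ) (hα : ∀ i, α i ≠ 0) {t : ℝ} (ht : 0 < t) (x : ι → ℝ) :
    deriv (fun t => gaussSolution μ ξ α P t x) t =
      ∑ i, (iteratedDeriv 2 (fun s => gaussSolution μ ξ α P t (Function.update x i s)) (x i) +
        α i / 2 * x i *
          deriv (fun s => gaussSolution μ ξ α P t (Function.update x i s)) (x i) +
        α i / 2 * gaussSolution μ ξ α P t x) := by
  rw [(hasDerivAt_gaussSolution_time h hξ hα ht x).deriv]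
  refine Finset.sum_congr rfl fun i _ => ?_
  have d1 := fun s => (hasDerivAt_gaussSolution_space h hξ hα ht x i s).deriv
  have d2 := ((hasDerivAt_gaussSolution_space (h.coord_mul hξ i) hξ hα ht x i (x i)).const_mul
    (Real.exp (-α i * t / 2) / (2 * aCoeff (α i) t))).sub
      (((hasDerivAt_id (x i)).div_const (2 * aCoeff (α i) t)).mul
        (hasDerivAt_gaussSolution_space h hξ hα ht x i (x i)))
  rw [iteratedDeriv_succ, iteratedDeriv_one, funext d1]
  refine Eq.trans ?_ (congrArg₂ (· + ·) (congrArg₂ (· + ·) d2.deriv rfl) rfl).symm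
  simp only [Function.update_eq_self, id]
  have ha := aCoeff_pos_of_ne_zero (hα i) ht
  -- Eliminating `α i` leaves a rational identity in `a`, `β`, `x i` and three moments treated as
  -- free variables.
  have hαβ : α i = (1 - Real.exp (-α i * t / 2) ^ 2) / aCoeff (α i) t := by
    rw [eq_div_iff ha.ne', exp_half_sq, aCoeff, mul_div_cancel₀ _ (hα i)]
  set a := aCoeff (α i) t
  set β := Real.exp (-α i * t / 2)
  generalize gaussSolution μ ξ α P t x = V₀
  generalize gaussSolution μ ξ α (fun w => ξ w i * P w) t x = V₁
  generalize gaussSolution μ ξ α (fun w => ξ w i * (ξ w i * P w)) t x = V₂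
  clear_value a β
  rw [hαβ]
  field_simp
  ring

theorem contDiffAt_gaussSolution (h : GaussIntegrable μ ξ P) (hξ : Measurable ξ)
    (hα : ∀ i, α i ≠ 0) {q : ℝ × (ι → ℝ)} (hq : 0 < q.1) (n : ℕ) :
    ContDiffAt ℝ n (fun q : ℝ × (ι → ℝ) => gaussSolution μ ξ α P q.1 q.2) q := by
  have h1 : ContDiffAt ℝ n (fun (q : ℝ × (ι → ℝ)) (i : ι) => lineParam (α i) q.1 (q.2 i)) q := by
    refine contDiffAt_pi.2 fun i => ?_
    have h2 : ContDiffAt ℝ n (fun q : ℝ × (ι → ℝ) => q.2 i) q :=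
      contDiffAt_pi.1 contDiffAt_snd i
    have h3 : ContDiffAt ℝ n (fun q : ℝ × (ι → ℝ) => (q.1, q.2 i)) q := contDiffAt_fst.prodMk h2
    have h4 := contDiffAt_lineParam (hα i) (q := (q.1, q.2 i)) hq n
    exact h4.comp q h3
  exact (contDiffAt_gaussMoment h hξ (fun i => lineParam_neg (hα i) hq _) n).comp q h1

end GaussSolution

/-! ### Smooth solutions of the linear equation -/

/-- Smoothness and the equation are local in time and the equation is autonomous, so only restarts
at positive times need to be treated. -/
theorem SolvesLinear.of_translate {α₁ α₂ : ℝ} {u : ℝ → ℝ → ℝ → ℝ → ℝ}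
    (h : ∀ s, 0 < s → ∃ v, SolvesLinear α₁ α₂ v ∧
      ∀ t x₁ x₂ x₃, 0 < t → u (s + t) x₁ x₂ x₃ = v t x₁ x₂ x₃) : SolvesLinear α₁ α₂ u := by
  have hopen : IsOpen {q : ℝ × ℝ × ℝ × ℝ | 0 < q.1} := isOpen_lt continuous_const continuous_fst
  constructor
  · intro q hq
    have hq' : 0 < q.1 := hq
    obtain ⟨v, ⟨hv, -⟩, huv⟩ := h (q.1 / 2) (by positivity)
    have h1 : ContDiffAt ℝ (⊤ : ℕ∞) (fun q : ℝ × ℝ × ℝ × ℝ => v q.1 q.2.1 q.2.2.1 q.2.2.2)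
        (q.1 - q.1 / 2, q.2) := hv.contDiffAt (hopen.mem_nhds (by
          change 0 < q.1 - q.1 / 2
          linarith))
    have h2 : ContDiffAt ℝ (⊤ : ℕ∞) (fun r : ℝ × ℝ × ℝ × ℝ => (r.1 - q.1 / 2, r.2)) q :=
      (contDiffAt_fst.sub contDiffAt_const).prodMk contDiffAt_snd
    refine ((h1.comp q h2).congr_of_eventuallyEq ?_).contDiffWithinAt
    have h3 : ∀ᶠ r : ℝ × ℝ × ℝ × ℝ in 𝓝 q, q.1 / 2 < r.1 :=
      continuous_fst.continuousAt.eventually (eventually_gt_nhds (by linarith))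
    filter_upwards [h3] with r hr
    have := huv (r.1 - q.1 / 2) r.2.1 r.2.2.1 r.2.2.2 (by linarith)
    rwa [add_sub_cancel] at this
  · intro t x₁ x₂ x₃ ht
    obtain ⟨v, ⟨-, hv⟩, huv⟩ := h (t / 2) (by positivity)
    have hu : ∀ r, t / 2 < r → ∀ x₁ x₂ x₃, u r x₁ x₂ x₃ = v (r - t / 2) x₁ x₂ x₃ :=
      fun r hr x₁ x₂ x₃ => by
        have := huv (r - t / 2) x₁ x₂ x₃ (by linarith)
        rwa [add_sub_cancel] at this
    have h1 : (fun r => u r x₁ x₂ x₃) =ᶠ[𝓝 t] fun r => v (r - t / 2) x₁ x₂ x₃ := by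
      filter_upwards [eventually_gt_nhds (by linarith : t / 2 < t)] with r hr using hu r hr _ _ _
    rw [h1.deriv_eq, deriv_comp_sub_const (f := fun r => v r x₁ x₂ x₃)]
    simp only [hu t (by linarith)]
    exact hv (t - t / 2) x₁ x₂ x₃ (by linarith)

/-- The coordinates of `(ℝ × ℝ) × ℝ`. -/
def spaceCoord (w : (ℝ × ℝ) × ℝ) : Fin 3 → ℝ := ![w.1.1, w.1.2, w.2]

theorem measurable_spaceCoord : Measurable spaceCoord := by
  refine measurable_pi_iff.2 fun i => ?_
  fin_cases i
  exacts [measurable_fst.comp measurable_fst, measurable_snd.comp measurable_fst, measurable_snd]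

theorem gaussIntegrable_spaceCoord {P : (ℝ × ℝ) × ℝ → ℝ} (hP : StronglyMeasurable P) {C : ℝ}
    (hC : ∀ w, |P w| ≤ C) : GaussIntegrable volume spaceCoord P := by
  refine ⟨hP.aestronglyMeasurable, fun ε hε => ?_⟩
  have h1 := integrable_exp_neg_mul_sq hε
  have h2 := (h1.mul_prod h1).mul_prod h1
  refine (h2.mul_bdd hP.aestronglyMeasurable (ae_of_all _ hC)).congr (ae_of_all _ fun w => ?_)
  simp only [spaceCoord, Fin.sum_univ_three, Matrix.cons_val]
  rw [← Real.exp_add, ← Real.exp_add]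
  congr 2
  ring

/-- At `α = -2` the line operator is `∂² - x∂ - 1`; the factor `e^t` removes the zero-order term. -/
theorem axialKernel_eq_lineKernel (t x y : ℝ) :
    axialKernel t x y = Real.exp t * lineKernel (-2) t x y := by
  have hE : Real.exp t ≠ 0 := (Real.exp_pos t).ne'
  have hs : √(Real.exp t ^ 2) = Real.exp t := Real.sqrt_sq (Real.exp_pos t).le
  have e1 : Real.exp (-(-2) * t) = Real.exp t ^ 2 := by
    rw [← Real.exp_nat_mul]; congr 1; push_cast; ring
  have e2 : Real.exp (-(-2) * t / 2) = Real.exp t := by congr 1; ring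
  have ha : aCoeff (-2) t = Real.exp t ^ 2 * axialVar t := by
    have e3 : Real.exp t ^ 2 * Real.exp (-2 * t) = 1 := by
      rw [← e1, ← Real.exp_add, show -(-2) * t + -2 * t = 0 by ring, Real.exp_zero]
    rw [aCoeff, axialVar, e1]
    linear_combination (1 / 2) * e3
  rw [axialKernel_eq, lineKernel, heatKernel, e2, ha,
    show 4 * Real.pi * (Real.exp t ^ 2 * axialVar t) = Real.exp t ^ 2 * (4 * Real.pi * axialVar t)
      by ring, Real.sqrt_mul (sq_nonneg (Real.exp t)), hs, Real.exp_neg]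
  have e4 : -(x - y * Real.exp t) ^ 2 / (4 * (Real.exp t ^ 2 * axialVar t)) =
      -(x * (Real.exp t)⁻¹ - y) ^ 2 / (4 * axialVar t) := by
    rw [show -(x - y * Real.exp t) ^ 2 = Real.exp t ^ 2 * (-(x * (Real.exp t)⁻¹ - y) ^ 2) by
      field_simp, show 4 * (Real.exp t ^ 2 * axialVar t) = Real.exp t ^ 2 * (4 * axialVar t) by ring,
      mul_div_mul_left _ _ (by positivity)]
  rw [e4, one_div_mul_eq_div, ← mul_assoc]
  field_simp

/-- Three line factors with parameters `α₁, α₂, -2`, times `e^t`, which restores the zero-order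
coefficient from `(α₁+α₂-2)/2` to `(α₁+α₂)/2`. -/
theorem solvesLinear_integral {α₁ α₂ : ℝ} (h₁ : 0 < α₁) (h₂ : 0 < α₂) {P : (ℝ × ℝ) × ℝ → ℝ}
    (hP : StronglyMeasurable P) {C : ℝ} (hC : ∀ w, |P w| ≤ C) :
    ∃ v, SolvesLinear α₁ α₂ v ∧ ∀ t x₁ x₂ x₃, 0 < t → v t x₁ x₂ x₃ =
      ∫ w : (ℝ × ℝ) × ℝ, planeKernel α₁ α₂ t (x₁, x₂) w.1 * axialKernel t x₃ w.2 * P w := by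
  set α : Fin 3 → ℝ := ![α₁, α₂, -2] with hαdef
  have hα : ∀ i, α i ≠ 0 := by
    intro i
    fin_cases i
    exacts [h₁.ne', h₂.ne', by norm_num [hαdef]]
  have hG := gaussIntegrable_spaceCoord hP hC
  have hξ := measurable_spaceCoord
  set V := gaussSolution volume spaceCoord α P with hV
  refine ⟨fun t x₁ x₂ x₃ => Real.exp t * V t ![x₁, x₂, x₃], ⟨?_, fun t x₁ x₂ x₃ ht => ?_⟩,
    fun t x₁ x₂ x₃ ht => ?_⟩
  · refine contDiffOn_infty.2 fun n q hq => ContDiffAt.contDiffWithinAt ?_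
    have h1 : ContDiffAt ℝ n (fun q : ℝ × ℝ × ℝ × ℝ => (![q.2.1, q.2.2.1, q.2.2.2] : Fin 3 → ℝ))
        q := by
      refine contDiffAt_pi.2 fun i => ?_
      fin_cases i
      · exact contDiffAt_fst.comp q contDiffAt_snd
      · exact contDiffAt_fst.comp q (contDiffAt_snd.comp q contDiffAt_snd)
      · exact contDiffAt_snd.comp q (contDiffAt_snd.comp q contDiffAt_snd)
    have h2 : ∀ G : ℝ × (Fin 3 → ℝ) → ℝ, ContDiffAt ℝ n G (q.1, ![q.2.1, q.2.2.1, q.2.2.2]) →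
        ContDiffAt ℝ n (fun q : ℝ × ℝ × ℝ × ℝ => Real.exp q.1 *
          G (q.1, ![q.2.1, q.2.2.1, q.2.2.2])) q := fun G hG =>
      contDiffAt_fst.exp.mul (hG.comp q (contDiffAt_fst.prodMk h1))
    exact h2 _ (contDiffAt_gaussSolution hG hξ hα
      (q := (q.1, (![q.2.1, q.2.2.1, q.2.2.2] : Fin 3 → ℝ))) hq n)
  · have hd := (hasDerivAt_gaussSolution_time hG hξ hα ht ![x₁, x₂, x₃]).differentiableAt
    have hpde := gaussSolution_pde hG hξ hα ht ![x₁, x₂, x₃]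
    have e0 : ∀ s, Function.update ![x₁, x₂, x₃] 0 s = ![s, x₂, x₃] := fun s => by
      funext i; fin_cases i <;> rfl
    have e1 : ∀ s, Function.update ![x₁, x₂, x₃] 1 s = ![x₁, s, x₃] := fun s => by
      funext i; fin_cases i <;> rfl
    have e2 : ∀ s, Function.update ![x₁, x₂, x₃] 2 s = ![x₁, x₂, s] := fun s => by
      funext i; fin_cases i <;> rfl
    simp only [Fin.sum_univ_three, e0, e1, e2, hαdef, Matrix.cons_val] at hpde
    have ht' : deriv (fun s => Real.exp s * V s ![x₁, x₂, x₃]) t =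
        Real.exp t * V t ![x₁, x₂, x₃] + Real.exp t * deriv (fun s => V s ![x₁, x₂, x₃]) t :=
      ((Real.hasDerivAt_exp t).mul hd.hasDerivAt).deriv
    simp only [ht', iteratedDeriv_const_mul_field, deriv_const_mul_field]
    rw [hV, hαdef, hpde]
    ring
  · simp only [hV]
    rw [gaussSolution_eq hα ht, ← integral_const_mul]
    refine integral_congr_ae (ae_of_all _ fun w => ?_)
    simp only [Fin.prod_univ_three, hαdef, spaceCoord, Matrix.cons_val, planeKernel,
      axialKernel_eq_lineKernel]
    ring

/-! ### The solution operator, pointwise -/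

section Functional

variable {m : ℝ}

theorem integrable_mul_of_memLp_two (hm : 0 ≤ m) {g : ℝ × ℝ → ℝ} (hg : MemLp g 2 volume)
    (f : WLp 2 m) : Integrable fun z => g z * f z :=
  hg.integrable_mul (memLp_volume hm f)

/-- Cauchy–Schwarz in the unweighted `L²`, into which `L²(m)` embeds with norm at most one because
the weight is at least `1`. -/
theorem abs_integral_mul_le (hm : 0 ≤ m) {g : ℝ × ℝ → ℝ} (hg : MemLp g 2 volume) (f : WLp 2 m) :
    |∫ z, g z * f z| ≤ (eLpNorm g 2 volume).toReal * ‖f‖ := by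
  have hf := memLp_volume hm f
  have e : ∫ z, g z * f z = inner ℝ (hg.toLp g) (hf.toLp f) := by
    rw [L2.inner_def]
    refine integral_congr_ae ?_
    filter_upwards [hg.coeFn_toLp, hf.coeFn_toLp] with z h1 h2
    rw [h1, h2]
    simp [mul_comm]
  rw [e]
  refine (abs_real_inner_le_norm _ _).trans ?_
  rw [Lp.norm_toLp, Lp.norm_toLp, Lp.norm_def]
  exact mul_le_mul_of_nonneg_left (ENNReal.toReal_mono (Lp.eLpNorm_ne_top f)
    (eLpNorm_mono_measure f (volume_le_weightedMeasure 2 hm))) ENNReal.toReal_nonneg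

/-- The functional `f ↦ ∫ g f` on `L²(m)`, for `g ∈ L²`. -/
def pairing (hm : 0 ≤ m) {g : ℝ × ℝ → ℝ} (hg : MemLp g 2 volume) : WLp 2 m →L[ℝ] ℝ :=
  LinearMap.mkContinuous
    { toFun := fun f => ∫ z, g z * f z
      map_add' := fun f₁ f₂ => by
        rw [← integral_add (integrable_mul_of_memLp_two hm hg f₁)
          (integrable_mul_of_memLp_two hm hg f₂)]
        refine integral_congr_ae ?_
        filter_upwards [ae_volume (Lp.coeFn_add f₁ f₂)] with z hz
        rw [hz, Pi.add_apply, mul_add]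
      map_smul' := fun c f => by
        rw [RingHom.id_apply, smul_eq_mul, ← integral_const_mul]
        refine integral_congr_ae ?_
        filter_upwards [ae_volume (Lp.coeFn_smul c f)] with z hz
        rw [hz, Pi.smul_apply, smul_eq_mul]; ring }
    (eLpNorm g 2 volume).toReal fun f => abs_integral_mul_le hm hg f

theorem pairing_apply (hm : 0 ≤ m) {g : ℝ × ℝ → ℝ} (hg : MemLp g 2 volume) (f : WLp 2 m) :
    pairing hm hg f = ∫ z, g z * f z := rfl

theorem eLpNorm_two_le {g : ℝ × ℝ → ℝ} (hg : Integrable g) {B : ℝ} (hB : ∀ z, |g z| ≤ B) :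
    eLpNorm g 2 volume ≤ ENNReal.ofReal (B * ∫ z, |g z|) ^ (1 / 2 : ℝ) := by
  rw [eLpNorm_eq_lintegral_rpow_enorm_toReal two_ne_zero (by simp)]
  simp only [ENNReal.toReal_ofNat]
  gcongr
  rw [← integral_const_mul, ofReal_integral_eq_lintegral_ofReal (hg.abs.const_mul B)
    (ae_of_all _ fun z => mul_nonneg ((abs_nonneg _).trans (hB z)) (abs_nonneg _))]
  refine lintegral_mono fun z => ?_
  rw [← ofReal_norm, ENNReal.ofReal_rpow_of_nonneg (norm_nonneg _) zero_le_two,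
    Real.rpow_two, Real.norm_eq_abs]
  refine ENNReal.ofReal_le_ofReal ?_
  rw [sq]
  exact mul_le_mul_of_nonneg_right (hB z) (abs_nonneg _)

end Functional

section Solution

variable {α₁ α₂ m : ℝ}

theorem integral_lineKernel_eq {α t : ℝ} (hα : 0 < α) (ht : 0 < t) (x : ℝ) :
    ∫ z, lineKernel α t x z = Real.exp (α * t / 2) := by
  have ha := aCoeff_pos hα ht
  simp_rw [lineKernel_eq]
  rw [Measure.integral_comp_mul_left (fun z => heatKernel (aCoeff α t) (x - z)),
    integral_sub_left_eq_self (heatKernel (aCoeff α t)), integral_heatKernel ha,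
    abs_of_pos (inv_pos.2 (Real.exp_pos _)), smul_eq_mul, mul_one, ← Real.exp_neg]
  congr 1; ring

/-- The squared `L²` norm is at most the supremum times the mass, and the mass `e^{(α₁+α₂)t/2}` does
not depend on `x`. -/
theorem memLp_planeKernel (h₁ : 0 < α₁) (h₂ : 0 < α₂) {t : ℝ} (ht : 0 < t) :
    ∃ N : ℝ, ∀ x, MemLp (planeKernel α₁ α₂ t x) 2 volume ∧
      (eLpNorm (planeKernel α₁ α₂ t x) 2 volume).toReal ≤ N := by
  have n₁ := niceKernel_lineKernel h₁ ht
  have n₂ := niceKernel_lineKernel h₂ ht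
  obtain ⟨B, hB⟩ := exists_abs_tensorKernel_le n₁ n₂
  rw [← planeKernel_eq] at hB
  set A := ENNReal.ofReal (B * (Real.exp (α₁ * t / 2) * Real.exp (α₂ * t / 2))) ^ (1 / 2 : ℝ)
    with hA
  have hA' : A ≠ ⊤ := ENNReal.rpow_ne_top_of_nonneg (by norm_num) ENNReal.ofReal_ne_top
  have key : ∀ x, eLpNorm (planeKernel α₁ α₂ t x) 2 volume ≤ A := fun x => by
    have hi : Integrable (planeKernel α₁ α₂ t x) := integrable_tensorKernel n₁ n₂ x
    refine (eLpNorm_two_le hi (hB x)).trans (le_of_eq ?_)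
    have e : ∫ z, |planeKernel α₁ α₂ t x z| =
        Real.exp (α₁ * t / 2) * Real.exp (α₂ * t / 2) := by
      simp_rw [abs_of_nonneg (planeKernel_nonneg _ _ _)]
      rw [← integral_lineKernel_eq h₁ ht x.1, ← integral_lineKernel_eq h₂ ht x.2,
        ← integral_prod_mul]
      rfl
    rw [e]
  refine ⟨A.toReal, fun x => ⟨⟨?_, (key x).trans_lt hA'.lt_top⟩, ENNReal.toReal_mono hA' (key x)⟩⟩
  exact ((continuous_planeKernel h₁ h₂ ht).comp
    (by fun_prop : Continuous fun z : ℝ × ℝ => (x, z))).aestronglyMeasurable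

/-- The pointwise representative `∫ K_t(x,z) (Φ_t ω)(x₃)(z) dz` of `S_t ω`, where `Φ_t` is the axial
semigroup. -/
def burgersSolution (α₁ α₂ : ℝ) (ω : XSpace 2 m) (t x₁ x₂ x₃ : ℝ) : ℝ :=
  ∫ z, planeKernel α₁ α₂ t (x₁, x₂) z * axialSemigroup (WLp 2 m) t ω x₃ z

theorem burgersSemigroup_ae_eq (h₁ : 0 < α₁) (h₂ : 0 < α₂) (hm : 0 ≤ m) (ω : XSpace 2 m)
    {t : ℝ≥0} (ht : 0 < t) (x₃ : ℝ) :
    (burgersSemigroup α₁ α₂ m t ω x₃ : ℝ × ℝ → ℝ) =ᵐ[volume]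
      fun x => burgersSolution α₁ α₂ ω t x.1 x.2 x₃ := by
  rw [burgersSemigroup_eq, ContinuousLinearMap.compLeftContinuousBounded_apply,
    planeSemigroup_apply h₁ h₂ hm (by exact_mod_cast ht)]
  exact coeFn_kernelOp (kernelDefined_planeKernel h₁ h₂ hm (by exact_mod_cast ht)) _

theorem burgersSolution_bounded (h₁ : 0 < α₁) (h₂ : 0 < α₂) (hm : 0 ≤ m) (ω : XSpace 2 m) {t : ℝ}
    (ht : 0 < t) : ∃ C, ∀ x₁ x₂ x₃, |burgersSolution α₁ α₂ ω t x₁ x₂ x₃| ≤ C := by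
  obtain ⟨N, hN⟩ := memLp_planeKernel h₁ h₂ ht
  have hN0 : 0 ≤ N := ENNReal.toReal_nonneg.trans (hN 0).2
  refine ⟨N * ‖axialSemigroup (WLp 2 m) t ω‖, fun x₁ x₂ x₃ =>
    (abs_integral_mul_le hm (hN (x₁, x₂)).1 _).trans ?_⟩
  exact mul_le_mul (hN _).2 (BoundedContinuousFunction.norm_coe_le_norm _ _) (norm_nonneg _) hN0

/-- A Carathéodory function: for fixed `x` it is continuous in `x₃`, as a bounded functional of a
continuous `L²(m)`-valued map; for fixed `x₃` it is a measurable parameter integral in `x`. No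
jointly measurable representative of `ω` itself is needed. -/
theorem stronglyMeasurable_burgersSolution (h₁ : 0 < α₁) (h₂ : 0 < α₂) (hm : 0 ≤ m)
    (ω : XSpace 2 m) {t : ℝ} (ht : 0 < t) :
    StronglyMeasurable fun w : (ℝ × ℝ) × ℝ => burgersSolution α₁ α₂ ω t w.1.1 w.1.2 w.2 := by
  obtain ⟨N, hN⟩ := memLp_planeKernel h₁ h₂ ht
  have h1 : ∀ x : ℝ × ℝ, Continuous fun y => burgersSolution α₁ α₂ ω t x.1 x.2 y := fun x =>
    (pairing hm (hN x).1).continuous.comp (axialSemigroup (WLp 2 m) t ω).continuous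
  have h2 : ∀ y, StronglyMeasurable fun x : ℝ × ℝ => burgersSolution α₁ α₂ ω t x.1 x.2 y := by
    intro y
    have hf : StronglyMeasurable fun q : (ℝ × ℝ) × (ℝ × ℝ) =>
        axialSemigroup (WLp 2 m) t ω y q.2 :=
      (Lp.stronglyMeasurable (axialSemigroup (WLp 2 m) t ω y)).comp_measurable measurable_snd
    exact ((continuous_planeKernel h₁ h₂ ht).stronglyMeasurable.mul hf).integral_prod_right
  have h := stronglyMeasurable_uncurry_of_continuous_of_stronglyMeasurable
    (u := fun (y : ℝ) (x : ℝ × ℝ) => burgersSolution α₁ α₂ ω t x.1 x.2 y) h1 h2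
  have e : (fun w : (ℝ × ℝ) × ℝ => burgersSolution α₁ α₂ ω t w.1.1 w.1.2 w.2) =
      (Function.uncurry fun (y : ℝ) (x : ℝ × ℝ) => burgersSolution α₁ α₂ ω t x.1 x.2 y) ∘
        Prod.swap := rfl
  rw [e]
  exact h.comp_measurable measurable_swap

/-- The axial law writes `Φ_{t+s}` as `Φ_t Φ_s`, the pairing passes through the Bochner integral,
and planar Chapman–Kolmogorov turns `K_{t+s}` against `Φ_s ω` into `K_t` against the solution at
time `s`. -/
theorem burgersSolution_add (h₁ : 0 < α₁) (h₂ : 0 < α₂) (hm : 0 ≤ m) (ω : XSpace 2 m)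
    {s t : ℝ} (hs : 0 < s) (ht : 0 < t) (x₁ x₂ x₃ : ℝ) :
    burgersSolution α₁ α₂ ω (s + t) x₁ x₂ x₃ =
      ∫ w : (ℝ × ℝ) × ℝ, planeKernel α₁ α₂ t (x₁, x₂) w.1 * axialKernel t x₃ w.2 *
        burgersSolution α₁ α₂ ω s w.1.1 w.1.2 w.2 := by
  rw [add_comm s t]
  obtain ⟨N, hN⟩ := memLp_planeKernel h₁ h₂ (add_pos ht hs)
  obtain ⟨C, hC⟩ := burgersSolution_bounded h₁ h₂ hm ω hs
  have hK : Integrable (planeKernel α₁ α₂ t (x₁, x₂)) :=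
    integrable_tensorKernel (niceKernel_lineKernel h₁ ht) (niceKernel_lineKernel h₂ ht) _
  have hi : Integrable (fun w : (ℝ × ℝ) × ℝ => planeKernel α₁ α₂ t (x₁, x₂) w.1 *
      axialKernel t x₃ w.2 * burgersSolution α₁ α₂ ω s w.1.1 w.1.2 w.2)
      ((volume : Measure (ℝ × ℝ)).prod volume) :=
    (hK.mul_prod (integrable_axialKernel ht x₃)).mul_bdd
      (stronglyMeasurable_burgersSolution h₁ h₂ hm ω hs).aestronglyMeasurable
      (ae_of_all _ fun w => hC w.1.1 w.1.2 w.2)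
  rw [Measure.volume_eq_prod, integral_prod_symm _ hi]
  change pairing hm (hN (x₁, x₂)).1 (axialSemigroup (WLp 2 m) (t + s) ω x₃) = _
  rw [axialSemigroup_add ht.le hs.le, ContinuousLinearMap.comp_apply,
    axialSemigroup_eq_integral ht]
  refine ((pairing hm (hN (x₁, x₂)).1).integral_comp_comm (integrable_smul_comp
    (integrable_axialKernel ht x₃) (axialSemigroup (WLp 2 m) s ω) continuous_id)).symm.trans ?_
  refine integral_congr_ae (ae_of_all _ fun y => ?_)
  set f := axialSemigroup (WLp 2 m) s ω y with hf
  have e1 : pairing hm (hN (x₁, x₂)).1 f =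
      ∫ w, planeKernel α₁ α₂ t (x₁, x₂) w * burgersSolution α₁ α₂ ω s w.1 w.2 y := by
    rw [pairing_apply, ← integral_planeKernel_mul_planeSemigroup h₁ h₂ hm ht hs]
    refine integral_congr_ae ?_
    rw [planeSemigroup_apply h₁ h₂ hm hs]
    filter_upwards [coeFn_kernelOp (kernelDefined_planeKernel h₁ h₂ hm hs) f] with w hw
    rw [hw]
    rfl
  simp only [id, map_smul, smul_eq_mul]
  rw [e1, ← integral_const_mul]
  refine integral_congr_ae (ae_of_all _ fun w => ?_)
  simp only
  ring

/-- At any time `s > 0` the solution is bounded and measurable, hence admissible data for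
`solvesLinear_integral`. -/
theorem solvesLinear_burgersSolution (h₁ : 0 < α₁) (h₂ : 0 < α₂) (hm : 0 ≤ m) (ω : XSpace 2 m) :
    SolvesLinear α₁ α₂ (burgersSolution α₁ α₂ ω) := by
  refine SolvesLinear.of_translate fun s hs => ?_
  obtain ⟨C, hC⟩ := burgersSolution_bounded h₁ h₂ hm ω hs
  obtain ⟨v, hv, e⟩ := solvesLinear_integral h₁ h₂
    (stronglyMeasurable_burgersSolution h₁ h₂ hm ω hs) fun w => hC w.1.1 w.1.2 w.2
  refine ⟨v, hv, fun t x₁ x₂ x₃ ht => ?_⟩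
  rw [e t x₁ x₂ x₃ ht, burgersSolution_add h₁ h₂ hm ω hs ht]

end Solution

end BurgersSemigroup

end

/-! ### Assembly of the theorem -/

theorem proposition4p4 (α₁ α₂ m : ℝ) (hα₂ : 0 < α₂) (hα : α₂ ≤ α₁) (hm : 0 ≤ m) :
    -- all integrals in the formula for `S_t` converge
    (∀ t : ℝ, 0 < t → TensorDefined 2 m (axialKernel t) (planeKernel α₁ α₂ t)) ∧
    -- the formula defines a semigroup of bounded linear operators on `X²(m)`
    ∃ S : ℝ≥0 → (XSpace 2 m →L[ℝ] XSpace 2 m),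
      (∀ (t : ℝ≥0) (ω : XSpace 2 m) (x₃ : ℝ), S t ω x₃ = semigroupS α₁ α₂ (t : ℝ) ω x₃) ∧
      S 0 = ContinuousLinearMap.id ℝ (XSpace 2 m) ∧
      (∀ s t : ℝ≥0, S (s + t) = (S s).comp (S t)) ∧
      -- continuity in time with values in `X²_loc(m)`
      (∀ ω₀ : XSpace 2 m, Continuous[inferInstance, locTopology 2 m] fun t : ℝ≥0 => S t ω₀) ∧
      -- `S_t ω₀` solves the linear equation for `t > 0`
      (∀ ω₀ : XSpace 2 m, ∃ u : ℝ → ℝ → ℝ → ℝ → ℝ, SolvesLinear α₁ α₂ u ∧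
        ∀ (t : ℝ≥0) (x₃ : ℝ), 0 < t →
          (S t ω₀ x₃ : ℝ × ℝ → ℝ) =ᵐ[volume] fun x => u t x.1 x.2 x₃) ∧
      -- continuity of `S_t : B_R → X²_loc(m)`, uniformly in `t ∈ [0,T]`
      (∀ R : ℝ, 0 < R → ∀ T : ℝ≥0, ∀ V ∈ @nhds _ (locTopology 2 m) (0 : XSpace 2 m),
        ∃ U ∈ @nhds _ (locTopology 2 m) (0 : XSpace 2 m), ∀ t : ℝ≥0, t ≤ T →
          ∀ ω η : XSpace 2 m, ‖ω‖ ≤ R → ‖η‖ ≤ R → ω - η ∈ U → S t ω - S t η ∈ V) ∧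
      -- i) uniform boundedness
      (1 / 2 < m → ∃ C : ℝ, 0 < C ∧ ∀ t : ℝ≥0, ‖S t‖ ≤ C) ∧
      -- ii) decay on the zero-mean subspace
      (3 / 2 < m → ∃ C : ℝ, 0 < C ∧ ∀ ω : XSpace 2 m, ZeroMean ω → ∀ t : ℝ≥0,
        ‖S t ω‖ ≤ C * Real.exp (-(α₂ / 2) * t) * ‖ω‖) ∧
      -- iii) smoothing estimates for `S_t ∂_k`
      (3 / 2 < m → ∀ (p : ℝ≥0∞) [Fact (1 ≤ p)], p ≤ 2 →
        (∀ (t : ℝ) (k : Fin 3), 0 < t →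
          TensorDefined p m (axialFactor t k) (planeFactor α₁ α₂ t k)) ∧
        ∃ D : ℝ → Fin 3 → (XSpace p m →L[ℝ] XSpace 2 m),
          (∀ (t : ℝ) (k : Fin 3), 0 < t → ∀ (ω : XSpace p m) (x₃ : ℝ),
            D t k ω x₃ = tensorOp (axialFactor t k) (planeFactor α₁ α₂ t k) ω x₃) ∧
          ∃ C : ℝ, 0 < C ∧ ∀ (t : ℝ), 0 < t → ∀ ω : XSpace p m,
            ‖D t 0 ω‖ ≤ C * (Real.exp (-α₁ * t / 2) /
              (aCoeff α₁ t ^ (1 / (2 * p.toReal) + 1 / 4) *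
                aCoeff α₂ t ^ (1 / (2 * p.toReal) - 1 / 4))) * ‖ω‖ ∧
            ‖D t 1 ω‖ ≤ C * (Real.exp (-α₂ * t / 2) /
              (aCoeff α₁ t ^ (1 / (2 * p.toReal) - 1 / 4) *
                aCoeff α₂ t ^ (1 / (2 * p.toReal) + 1 / 4))) * ‖ω‖ ∧
            ‖D t 2 ω‖ ≤ C / √(1 - Real.exp (-2 * t)) *
              (1 / (aCoeff α₁ t ^ (1 / (2 * p.toReal) - 1 / 4) *
                aCoeff α₂ t ^ (1 / (2 * p.toReal) - 1 / 4))) * ‖ω‖) := by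
  have hα₁ : 0 < α₁ := hα₂.trans_le hα
  exact ⟨fun t ht => tensorDefined_planeKernel hα₁ hα₂ hm ht, burgersSemigroup α₁ α₂ m,
    fun t ω x₃ => burgersSemigroup_eq_semigroupS hα₁ hα₂ hm t ω x₃, burgersSemigroup_zero,
    fun s t => burgersSemigroup_add hα₁ hα₂ hm s t,
    fun ω₀ => continuous_locTopology _ (continuous_burgersSemigroup hα₁ hα₂ hm ω₀),
    fun ω₀ => ⟨burgersSolution α₁ α₂ ω₀, solvesLinear_burgersSolution hα₁ hα₂ hm ω₀,
      fun t x₃ ht => burgersSemigroup_ae_eq hα₁ hα₂ hm ω₀ ht x₃⟩,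
    fun R hR T V hV => burgersSemigroup_uniform_continuity hα₁ hα₂ hm hR T hV,
    fun hm' => exists_norm_burgersSemigroup_le hα₁ hα₂ hm',
    fun hm' => exists_norm_burgersSemigroup_le_of_zeroMean hα₂ hα hm',
    fun hm' p _ hp => tensorDefined_and_smoothing hα₁ hα₂ (by linarith) p hp⟩
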